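/- Let $\mathbb M=\mathbb R^d$, and let $\mathcal P_2(\mathbb M)$ be the set of Borel probability measures on $\mathbb M$ with finite second moment, with the Wasserstein distance $W_2$; $\Gamma_0(m,\nu)$ is the set of couplings $\gamma$ of $m,\nu$ with $\int|x-y|^2d\gamma=W_2^2(m,\nu)$, and $T_m$ is the closure of $\nabla C_c^\infty(\mathbb M)$ in $L^2(m)$. **Differential calculus.** Let $U:\mathcal P_2(\mathbb M)\to\mathbb R$. A field $\zeta\in L^2(m)$ is a subgradient of $U$ at $m$ if $U[\nu]-U[m]\ge\inf_{\gamma\in\Gamma_0(m,\nu)}\int\zeta(x)\cdot(y-x)\,\gamma(dx,dy)+o(W_2(m,\nu))$, and a supergradient if $-\zeta$ is a subgradient of $-U$. $U$ is differentiable at $m$ if it has a subgradient and a supergradient at $m$; then $\nabla_wU[m]$ is the subgradient of minimal norm in $L^2(m)$. $U$ is continuously differentiable if it is differentiable everywhere and $(m,x)\mapsto\nabla_wU[m](x)$ has a jointly continuous version. $U$ is twice differentiable at $m$ if it is differentiable near $m$, with $\nabla_wU[\nu]$ continuous and $|\nabla_wU[\nu](x)|\le C_m(1+|x|)$ for $\nu$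 near $m$, and there are bounded Borel matrix fields $\tilde A[m]$ on $\mathbb M$ and $A_{mm}$ on $\mathbb M^2$, the rows of $A_{mm}(x,\cdot)$ lying in $T_m$, a concave modulus $\rho$ and a function $\epsilon_2\ge0$ with $\epsilon_2(0^+)=0$ such that for all $\nu\in\mathcal P_2(\mathbb M)$, $\gamma\in\Gamma_0(m,\nu)$ and $x,y\in\mathbb M$ $$\Bigl|\nabla_wU[\nu](y)-\nabla_wU[m](x)-\tilde A[m](x)(y-x)-\int A_{mm}(x,a)(b-a)\,\gamma(da,db)\Bigr|\le|x-y|\rho(|x-y|)+W_2(m,\nu)\,\epsilon_2(W_2(m,\nu)).$$ Then $\tilde A[m]$ is the Jacobian matrix $\nabla(\nabla_wU[m])$, and $\nabla_w^2U[m]:=A_{mm}$. $U$ is twice continuously differentiable if it is twice differentiable everywhere and $\tilde A[m](x)$, $\nabla_w^2U[m](x,y)$ are jointly continuous in all variables, including $m$. $\mathrm{Hess}\,U[m]$ is the bounded bilinear form on $T_m$ that extends $(\zeta_1,\zeta_2)\mapsto\zeta_1\cdot(\zeta_2\cdot U[m])-(\nabla\zeta_2\,\zeta_1)\cdot U[m]$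 from $\nabla C_c^\infty(\mathbb M)$, where $\zeta\cdot U[\nu]=\int\langle\nabla_wU[\nu],\zeta\rangle d\nu$. For $\epsilon\ge0$, $$\triangle_{w,\epsilon}U[m]=\sum_{i=1}^d\Bigl(\mathrm{Hess}\,U[m](\zeta_i,\zeta_i)+\epsilon\int\langle\tilde A[m]\zeta_i,\zeta_i\rangle\,dm\Bigr),$$ where $\zeta_i$ is the Wasserstein gradient of $m\mapsto\int x_i\,m(dx)$. For complex-valued $U$ all notions are applied to the real and imaginary parts. **Data.** Let $P_k$ be the group of permutations of $\{1,\dots,k\}$. For $\xi,x\in\mathbb M^k$ put $\langle\xi,x\rangle=\sum_{j=1}^k\langle\xi_j,x_j\rangle$, $$F^k_\xi[m]=\frac1k\int_{\mathbb M^k}\frac1{k!}\sum_{\sigma\in P_k}e^{-2\pi i\sum_j\langle\xi_{\sigma(j)},x_j\rangle}\,m(dx_1)\cdots m(dx_k),\qquad \lambda_k^2(\xi)=4\pi^2\Bigl|\sum_{j=1}^k\xi_j\Bigr|^2 .$$ Let $s,\delta>0$, $C\in\mathbb R$, and let $a_k:\mathbb M^k\to\mathbb C$ $(k\ge1)$ be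 Borel functions, invariant under permutations of $(\xi_1,\dots,\xi_k)$, with $\sum_k\frac1{k!}\int|a_k|^2(1+\lambda_k^2)^s\,d\xi<\infty$. Assume, for all $k\ge1$ (for all $k\ge2$ where $\xi_2$ occurs), $$\int|a_k|\,d\xi\le\frac{Ck!}{k^\delta},\qquad\int|a_k||\xi_1|\,d\xi,\ \int|a_k||\xi_1|^2d\xi\le\frac{Ck!}{k^{1+\delta}},\qquad\int|a_k||\xi_1||\xi_2|\,d\xi\le\frac{Ck!}{k^{2+\delta}}.$$ Let $U_0[m]=\sum_{k\ge1}\frac1{k!}\int_{\mathbb M^k}a_k(\xi)F^k_\xi[m]\,d\xi$. This series, and those below, converge absolutely for every $m\in\mathcal P_2(\mathbb M)$ and all $x_1,x_2\in\mathbb M$. **(i)** $U_0$ is continuously differentiable on $\mathcal P_2(\mathbb M)$, and (the continuous version of) its gradient is $$\nabla_wU_0[m](x_1)=\sum_{k\ge1}\frac{-2\pi i}{k!}\int_{\mathbb M^{k-1}\times\mathbb M^k}a_k(\xi)\,\xi_1e^{-2\pi i\langle\xi,x\rangle}\,m(dx_2)\cdots m(dx_k)\,d\xi .$$ **(ii)**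 If moreover $\int|a_k||\xi_1|^3d\xi\le\frac{Ck!}{k^{1+\delta}}$ for $k\ge1$ and $\int|a_k||\xi_1|^2|\xi_2|\,d\xi\le\frac{Ck!}{k^{3+\delta}}$ for $k\ge2$, then $U_0$ is twice continuously differentiable on $\mathcal P_2(\mathbb M)$, with $$\nabla\bigl(\nabla_wU_0[m](x_1)\bigr)=\sum_{k\ge1}\frac{-4\pi^2}{k!}\int_{\mathbb M^{k-1}\times\mathbb M^k}a_k(\xi)\,\xi_1\otimes\xi_1\,e^{-2\pi i\langle\xi,x\rangle}\,m(dx_2)\cdots m(dx_k)\,d\xi,$$ $$\nabla_w^2U_0[m](x_1,x_2)=\sum_{k\ge2}\frac{-4\pi^2(k-1)}{k!}\int_{\mathbb M^{k-2}\times\mathbb M^k}a_k(\xi)\,\xi_1\otimes\xi_2\,e^{-2\pi i\langle\xi,x\rangle}\,m(dx_3)\cdots m(dx_k)\,d\xi .$$ **(iii)** Under the assumptions of (ii), for every $\epsilon\ge0$ and $m\in\mathcal P_2(\mathbb M)$, $\triangle_{w,\epsilon}U_0[m]$ and all $\triangle_{w,\epsilon}F^k_\xi[m]$ exist, $\xi\mapsto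 a_k(\xi)\triangle_{w,\epsilon}F^k_\xi[m]$ is integrable, and $$\triangle_{w,\epsilon}U_0[m]=\sum_{k\ge1}\frac1{k!}\int_{\mathbb M^k}a_k(\xi)\,\triangle_{w,\epsilon}F^k_\xi[m]\,d\xi .$$ -/

import Mathlib

open MeasureTheory Filter Topology
open scoped ENNReal Matrix

noncomputable section

namespace Wass

/-- The space `𝕄 = ℝ^d` with its Euclidean norm. -/
abbrev E (d : ℕ) : Type := EuclideanSpace ℝ (Fin d)

/-- `𝒫₂(ℝ^d)`: Borel probability measures on `ℝ^d` with finite second moment. -/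
def P2 (d : ℕ) : Type :=
  {m : Measure (E d) // IsProbabilityMeasure m ∧ ∫⁻ x, ‖x‖ₑ ^ 2 ∂m < ⊤}

/-- The underlying measure of an element of `𝒫₂(ℝ^d)`. -/
def P2.meas {d : ℕ} (m : P2 d) : Measure (E d) := m.1

instance {d : ℕ} (m : P2 d) : IsProbabilityMeasure m.meas := m.2.1

variable {d : ℕ}

/-! ### The Wasserstein distance and optimal couplings -/

/-- `Γ(m, ν)`: Borel measures on `𝕄²` with first marginal `m` and second marginal `ν`. -/
def couplings (m ν : P2 d) : Set (Measure (E d × E d)) :=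
  {γ | γ.map Prod.fst = m.meas ∧ γ.map Prod.snd = ν.meas}

/-- The quadratic transport cost `∫ |x - y|² γ(dx, dy)`. -/
def cost (γ : Measure (E d × E d)) : ℝ≥0∞ := ∫⁻ p, ‖p.1 - p.2‖ₑ ^ 2 ∂γ

/-- The Wasserstein distance `W₂`. -/
def W2 (m ν : P2 d) : ℝ := Real.sqrt (⨅ γ ∈ couplings m ν, cost γ).toReal

/-- `Γ₀(m, ν)`: the couplings `γ` with `∫ |x - y|² dγ = W₂(m, ν)²`. -/
def optimalCouplings (m ν : P2 d) : Set (Measure (E d × E d)) :=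
  {γ | γ ∈ couplings m ν ∧ cost γ = ENNReal.ofReal (W2 m ν ^ 2)}

/-- Joint continuity on `𝒫₂(ℝ^d) × X`, where `𝒫₂(ℝ^d)` carries the distance `W₂`. -/
def JointlyContinuous {X Y : Type*} [PseudoMetricSpace X] [PseudoMetricSpace Y]
    (f : P2 d → X → Y) : Prop :=
  ∀ (m : P2 d) (x : X), ∀ ε > 0, ∃ η > 0, ∀ (ν : P2 d) (y : X),
    W2 m ν < η → dist y x < η → dist (f ν y) (f m x) < ε

/-! ### Tangent spaces -/

/-- `‖ζ‖_m`, the norm of `L²(m)`. -/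
def normL2 (m : P2 d) (ζ : E d → E d) : ℝ := Real.sqrt (∫ x, ‖ζ x‖ ^ 2 ∂m.meas)

/-- `φ ∈ C_c^∞(𝕄)`. -/
def IsTest (φ : E d → ℝ) : Prop := ContDiff ℝ (⊤ : ℕ∞) φ ∧ HasCompactSupport φ

/-- `ζ ∈ C_c^∞(𝕄, 𝕄)`. -/
def IsTestField (ζ : E d → E d) : Prop := ContDiff ℝ (⊤ : ℕ∞) ζ ∧ HasCompactSupport ζ

/-- `ζ ∈ T_m 𝒫₂(ℝ^d)`, the closure of `∇ C_c^∞(𝕄)` in `L²(m)`. -/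
def MemTangent (m : P2 d) (ζ : E d → E d) : Prop :=
  MemLp ζ 2 m.meas ∧ ∀ ε > 0, ∃ φ : E d → ℝ, IsTest φ ∧
    eLpNorm (fun x => ζ x - gradient φ x) 2 m.meas < ENNReal.ofReal ε

/-! ### First order differentiability -/

/-- `ζ ∈ ∂_• U[m]`: `ζ ∈ L²(m)` and
`U[ν] - U[m] ≥ inf_{γ ∈ Γ₀(m, ν)} ∫ ζ(x) · (y - x) γ(dx, dy) + o(W₂(m, ν))`.
The infimum is taken in the extended reals. -/
def IsSubgradient (U : P2 d → ℝ) (m : P2 d) (ζ : E d → E d) : Prop :=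
  MemLp ζ 2 m.meas ∧ ∀ ε > 0, ∃ η > 0, ∀ ν : P2 d, W2 m ν < η →
    (⨅ γ ∈ optimalCouplings m ν, ((∫ p, inner ℝ (ζ p.1) (p.2 - p.1) ∂γ : ℝ) : EReal))
      ≤ ((U ν - U m + ε * W2 m ν : ℝ) : EReal)

/-- `ζ ∈ ∂^• U[m]`. -/
def IsSupergradient (U : P2 d → ℝ) (m : P2 d) (ζ : E d → E d) : Prop :=
  IsSubgradient (fun ν => -U ν) m (fun x => -ζ x)

/-- `U` is differentiable at `m` in the sense of Wasserstein. -/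
def WDifferentiableAt (U : P2 d → ℝ) (m : P2 d) : Prop :=
  (∃ ζ, IsSubgradient U m ζ) ∧ ∃ ζ, IsSupergradient U m ζ

/-- `U` is differentiable at `m` and `ζ` is (a Borel version of) its Wasserstein gradient
`∇_w U[m]`, the element of minimal norm of the subdifferential. -/
def IsWGradient (U : P2 d → ℝ) (m : P2 d) (ζ : E d → E d) : Prop :=
  WDifferentiableAt U m ∧ IsSubgradient U m ζ ∧
    ∀ η, IsSubgradient U m η → normL2 m ζ ≤ normL2 m η

/-- `U` is continuously differentiable on `𝒫₂(ℝ^d)`, and `(m, x) ↦ A m x` is the (unique) jointly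
continuous version of `(m, x) ↦ ∇_w U[m](x)`. -/
structure HasContinuousGradient (U : P2 d → ℝ) (A : P2 d → E d → E d) : Prop where
  gradient : ∀ m, IsWGradient U m (A m)
  continuous : JointlyContinuous A

/-! ### Second order differentiability -/

/-- Concave moduli `ρ : [0, ∞) → [0, ∞)`. -/
structure IsConcaveModulus (ρ : ℝ → ℝ) : Prop where
  continuousOn : ContinuousOn ρ (Set.Ici 0)
  monotoneOn : MonotoneOn ρ (Set.Ici 0)
  subadditive : ∀ s t, 0 ≤ s → 0 ≤ t → ρ (s + t) ≤ ρ s + ρ t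
  map_zero : ρ 0 = 0
  concaveOn : ConcaveOn ℝ (Set.Ici 0) ρ

/-- `P_γ[m](x, y) = Ã(x)(y - x) + ∫ Ā(x, a)(b - a) γ(da, db)`. -/
def expansion (A1 : E d → Matrix (Fin d) (Fin d) ℝ) (A2 : E d → E d → Matrix (Fin d) (Fin d) ℝ)
    (γ : Measure (E d × E d)) (x y : E d) : E d :=
  Matrix.toEuclideanLin (A1 x) (y - x) + ∫ p, Matrix.toEuclideanLin (A2 x p.1) (p.2 - p.1) ∂γ

/-- `U` is twice differentiable at `m`, where `A ν` is the version of `∇_w U[ν]` in use,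
`A1 = Ã[m]` and `A2 = ∇²_w U[m]` (the matrix field `A_{mm}` whose rows have been
projected onto `T_m 𝒫₂(ℝ^d)`). -/
structure IsTwiceWDifferentiableAt (U : P2 d → ℝ) (m : P2 d) (A : P2 d → E d → E d)
    (A1 : E d → Matrix (Fin d) (Fin d) ℝ) (A2 : E d → E d → Matrix (Fin d) (Fin d) ℝ) :
    Prop where
  gradient : ∃ r > 0, ∃ K : ℝ, ∀ ν, W2 m ν < r →
    IsWGradient U ν (A ν) ∧ Continuous (A ν) ∧ ∀ x, ‖A ν x‖ ≤ K * (1 + ‖x‖)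
  measurable₁ : ∀ i j, Measurable fun x => A1 x i j
  measurable₂ : ∀ i j, Measurable fun p : E d × E d => A2 p.1 p.2 i j
  bounded₁ : ∃ K : ℝ, ∀ x i j, |A1 x i j| ≤ K
  bounded₂ : ∃ K : ℝ, ∀ x y i j, |A2 x y i j| ≤ K
  tangent : ∀ x i, MemTangent m fun y => WithLp.toLp 2 (A2 x y i)
  expand : ∃ ρ ε₂ : ℝ → ℝ, IsConcaveModulus ρ ∧ (∀ t, 0 ≤ t → 0 ≤ ε₂ t) ∧
    Tendsto ε₂ (𝓝[>] 0) (𝓝 0) ∧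
    ∀ ν, ∀ γ ∈ optimalCouplings m ν, ∀ x y,
      ‖A ν y - A m x - expansion A1 A2 γ x y‖
        ≤ ‖x - y‖ * ρ ‖x - y‖ + W2 m ν * ε₂ (W2 m ν)

/-- `U` is twice continuously differentiable on `𝒫₂(ℝ^d)` with `∇_w U[m] = A m`,
`∇(∇_w U[m]) = Ã[m] = A1 m` (the Jacobian matrix in the space variable) and
`∇²_w U[m] = A2 m`. -/
structure HasContinuousHessian (U : P2 d → ℝ) (A : P2 d → E d → E d)
    (A1 : P2 d → E d → Matrix (Fin d) (Fin d) ℝ)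
    (A2 : P2 d → E d → E d → Matrix (Fin d) (Fin d) ℝ) : Prop where
  twice : ∀ m, IsTwiceWDifferentiableAt U m A (A1 m) (A2 m)
  jacobian : ∀ m x,
    HasFDerivAt (A m) (LinearMap.toContinuousLinearMap (Matrix.toEuclideanLin (A1 m x))) x
  continuous₁ : ∀ i j, JointlyContinuous fun m x => A1 m x i j
  continuous₂ : ∀ i j, JointlyContinuous fun m (p : E d × E d) => A2 m p.1 p.2 i j

/-! ### The Hessian and the (perturbed) Wasserstein Laplacian -/

/-- `ν ↦ ζ · (U[ν]) = ⟨∇_w U[ν]; ζ⟩_ν`, where `A ν` is a version of `∇_w U[ν]`. -/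
def lieDeriv (A : P2 d → E d → E d) (ζ : E d → E d) (ν : P2 d) : ℝ :=
  ∫ x, inner ℝ (A ν x) (ζ x) ∂ν.meas

/-- `U` has a Hessian at `m`, and `H` is the bounded bilinear form `Hess U[m]` on
`T_m 𝒫₂(ℝ^d)` which extends
`(ζ₁, ζ₂) ↦ ζ₁ · (ζ₂ · (U[m])) - (∇ζ₂ ζ₁) · (U[m])` from `∇ C_c^∞(𝕄)`.
Only the values of `H` on tangent vectors are meaningful. -/
def IsHessianAt (U : P2 d → ℝ) (m : P2 d) (H : (E d → E d) → (E d → E d) → ℝ) : Prop :=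
  (∃ A : P2 d → E d → E d,
    (∃ r > 0, ∀ ν, W2 m ν < r → IsWGradient U ν (A ν)) ∧
    (∀ ζ, IsTestField ζ → WDifferentiableAt (lieDeriv A ζ) m) ∧
    ∀ φ₁ φ₂ : E d → ℝ, IsTest φ₁ → IsTest φ₂ →
      ∃ B, IsWGradient (lieDeriv A (gradient φ₂)) m B ∧
        H (gradient φ₁) (gradient φ₂) =
          (∫ x, inner ℝ (B x) (gradient φ₁ x) ∂m.meas) -
          ∫ x, inner ℝ (A m x) (fderiv ℝ (gradient φ₂) x (gradient φ₁ x)) ∂m.meas) ∧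
  (∀ ζ ζ' η : E d → E d, ∀ c : ℝ, MemTangent m ζ → MemTangent m ζ' → MemTangent m η →
    H (c • ζ + ζ') η = c * H ζ η + H ζ' η ∧ H η (c • ζ + ζ') = c * H η ζ + H η ζ') ∧
  ∃ K : ℝ, ∀ ζ η, MemTangent m ζ → MemTangent m η → |H ζ η| ≤ K * normL2 m ζ * normL2 m η

/-- `U` is twice differentiable at `m`, and `L = (△_{w,ε} U)[m]`, that is,
`L = ∑ᵢ (Hess U[m](ζᵢ, ζᵢ) + ε ∫ ⟨Ã[m](x) ζᵢ(x), ζᵢ(x)⟩ m(dx))`, where `ζᵢ` is the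
Wasserstein gradient of the `i`-th moment `ν ↦ ∫ xᵢ ν(dx)`.
The number `L` is determined by `ε`, `U` and `m`: the expansion along fully supported `ν → m`
determines the continuous map `A m` everywhere, `A1` is its Jacobian, and `H` is determined on
tangent vectors by its values on `∇ C_c^∞(𝕄)`. -/
def IsWLaplacianAt (ε : ℝ) (U : P2 d → ℝ) (m : P2 d) (L : ℝ) : Prop :=
  ∃ (A : P2 d → E d → E d) (A1 : E d → Matrix (Fin d) (Fin d) ℝ)
    (A2 : E d → E d → Matrix (Fin d) (Fin d) ℝ) (H : (E d → E d) → (E d → E d) → ℝ)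
    (ζ : Fin d → E d → E d),
    IsTwiceWDifferentiableAt U m A A1 A2 ∧ IsHessianAt U m H ∧
    (∀ i, IsWGradient (fun ν : P2 d => ∫ x, x i ∂ν.meas) m (ζ i) ∧ MemTangent m (ζ i)) ∧
    L = ∑ i, (H (ζ i) (ζ i) +
      ε * ∫ x, inner ℝ (Matrix.toEuclideanLin (A1 x) (ζ i x)) (ζ i x) ∂m.meas)

/-! ### Complex-valued functions: everything is applied to real and imaginary parts -/

def reVec (v : Fin d → ℂ) : E d := WithLp.toLp 2 fun i => (v i).re

def imVec (v : Fin d → ℂ) : E d := WithLp.toLp 2 fun i => (v i).im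

def reMat (M : Matrix (Fin d) (Fin d) ℂ) : Matrix (Fin d) (Fin d) ℝ := M.map Complex.re

def imMat (M : Matrix (Fin d) (Fin d) ℂ) : Matrix (Fin d) (Fin d) ℝ := M.map Complex.im

/-- Complex version of `HasContinuousGradient`. -/
def HasContinuousGradientC (U : P2 d → ℂ) (A : P2 d → E d → Fin d → ℂ) : Prop :=
  HasContinuousGradient (fun m => (U m).re) (fun m x => reVec (A m x)) ∧
  HasContinuousGradient (fun m => (U m).im) (fun m x => imVec (A m x))

/-- Complex version of `HasContinuousHessian`. -/
def HasContinuousHessianC (U : P2 d → ℂ) (A : P2 d → E d → Fin d → ℂ)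
    (A1 : P2 d → E d → Matrix (Fin d) (Fin d) ℂ)
    (A2 : P2 d → E d → E d → Matrix (Fin d) (Fin d) ℂ) : Prop :=
  HasContinuousHessian (fun m => (U m).re) (fun m x => reVec (A m x))
    (fun m x => reMat (A1 m x)) (fun m x y => reMat (A2 m x y)) ∧
  HasContinuousHessian (fun m => (U m).im) (fun m x => imVec (A m x))
    (fun m x => imMat (A1 m x)) (fun m x y => imMat (A2 m x y))

/-- Complex version of `IsWLaplacianAt`. -/
def IsWLaplacianAtC (ε : ℝ) (U : P2 d → ℂ) (m : P2 d) (L : ℂ) : Prop :=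
  IsWLaplacianAt ε (fun ν => (U ν).re) m L.re ∧ IsWLaplacianAt ε (fun ν => (U ν).im) m L.im

/-! ### Fourier coefficients and the associated series -/

/-- The product measure `m^{⊗k}` on `𝕄^k`. -/
def power (m : P2 d) (k : ℕ) : Measure (Fin k → E d) := Measure.pi fun _ => m.meas

/-- `e^{-2πi ⟨ξ, x⟩}` for `ξ, x ∈ 𝕄^k`, where `⟨ξ, x⟩ = ∑ⱼ ⟨ξⱼ, xⱼ⟩`. -/
def character {k : ℕ} (ξ x : Fin k → E d) : ℂ :=
  Complex.exp (-2 * Real.pi * Complex.I * ((∑ j, inner ℝ (ξ j) (x j) : ℝ) : ℂ))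

/-- `Φ^k_ξ`, the symmetrization of the character. -/
def Phi (k : ℕ) (ξ x : Fin k → E d) : ℂ :=
  1 / (Nat.factorial k : ℂ) * ∑ σ : Equiv.Perm (Fin k), character (fun j => ξ (σ j)) x

/-- `F^k_ξ[m] = (1/k) ∫ Φ^k_ξ dm^{⊗k}`. -/
def F (k : ℕ) (ξ : Fin k → E d) (m : P2 d) : ℂ :=
  1 / (k : ℂ) * ∫ x, Phi k ξ x ∂(power m k)

/-- `λ_k²(ξ) = 4π² |∑ⱼ ξⱼ|²`. -/
def lamSq {k : ℕ} (ξ : Fin k → E d) : ℝ := 4 * Real.pi ^ 2 * ‖∑ j, ξ j‖ ^ 2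

/-- `(a_k)_{k ≥ 1} ∈ 𝒜^s`: each `a_k` is Borel and symmetric, and
`∑_k (1/k!) ∫ |a_k|² (1 + λ_k²)^s dξ < ∞`. The value of `a` at `k = 0` plays no role. -/
structure MemAs (s : ℝ) (a : (k : ℕ) → (Fin k → E d) → ℂ) : Prop where
  measurable : ∀ n, Measurable (a (n + 1))
  symmetric : ∀ n (σ : Equiv.Perm (Fin (n + 1))) (ξ : Fin (n + 1) → E d),
    a (n + 1) (fun j => ξ (σ j)) = a (n + 1) ξ
  finite : ∑' n : ℕ, (Nat.factorial (n + 1) : ℝ≥0∞)⁻¹ *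
    ∫⁻ ξ, ‖a (n + 1) ξ‖ₑ ^ 2 * ENNReal.ofReal ((1 + lamSq ξ) ^ s) < ⊤

/-- `C k! / k^p`. -/
def bound (C p : ℝ) (k : ℕ) : ℝ≥0∞ := ENNReal.ofReal (C * (Nat.factorial k : ℝ) / (k : ℝ) ^ p)

/-- `∫ |a_k| ≤ C k! / k^δ` for `k ≥ 1`. -/
def ZerothMomentBound (C δ : ℝ) (a : (k : ℕ) → (Fin k → E d) → ℂ) : Prop :=
  ∀ n : ℕ, ∫⁻ ξ, ‖a (n + 1) ξ‖ₑ ≤ bound C δ (n + 1)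

/-- `∫ |a_k| |ξ₁|, ∫ |a_k| |ξ₁|² ≤ C k! / k^{1+δ}` for `k ≥ 1`. -/
def FirstMomentBound (C δ : ℝ) (a : (k : ℕ) → (Fin k → E d) → ℂ) : Prop :=
  ∀ n : ℕ, ∫⁻ ξ, ‖a (n + 1) ξ‖ₑ * ‖ξ 0‖ₑ ≤ bound C (1 + δ) (n + 1) ∧
    ∫⁻ ξ, ‖a (n + 1) ξ‖ₑ * ‖ξ 0‖ₑ ^ 2 ≤ bound C (1 + δ) (n + 1)

/-- `∫ |a_k| |ξ₁| |ξ₂| ≤ C k! / k^{2+δ}` for `k ≥ 2`. -/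
def MixedMomentBound (C δ : ℝ) (a : (k : ℕ) → (Fin k → E d) → ℂ) : Prop :=
  ∀ n : ℕ, ∫⁻ ξ, ‖a (n + 2) ξ‖ₑ * ‖ξ 0‖ₑ * ‖ξ 1‖ₑ ≤ bound C (2 + δ) (n + 2)

/-- `∫ |a_k| |ξ₁|³ ≤ C k! / k^{1+δ}` for `k ≥ 1` and
`∫ |a_k| |ξ₁|² |ξ₂| ≤ C k! / k^{3+δ}` for `k ≥ 2`. -/
def ThirdMomentBound (C δ : ℝ) (a : (k : ℕ) → (Fin k → E d) → ℂ) : Prop :=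
  (∀ n : ℕ, ∫⁻ ξ, ‖a (n + 1) ξ‖ₑ * ‖ξ 0‖ₑ ^ 3 ≤ bound C (1 + δ) (n + 1)) ∧
  ∀ n : ℕ, ∫⁻ ξ, ‖a (n + 2) ξ‖ₑ * ‖ξ 0‖ₑ ^ 2 * ‖ξ 1‖ₑ ≤ bound C (3 + δ) (n + 2)

/-- The term of index `k = n + 1` of `U₀`: `(1/k!) ∫ a_k(ξ) F^k_ξ[m] dξ`. -/
def U0Term (a : (k : ℕ) → (Fin k → E d) → ℂ) (n : ℕ) (m : P2 d) : ℂ :=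
  1 / (Nat.factorial (n + 1) : ℂ) * ∫ ξ, a (n + 1) ξ * F (n + 1) ξ m

/-- `U₀ = ∑_{k ≥ 1} (1/k!) ∫ a_k(ξ) F^k_ξ dξ`. -/
def U0 (a : (k : ℕ) → (Fin k → E d) → ℂ) (m : P2 d) : ℂ := ∑' n, U0Term a n m

/-- The `i`-th component of the term of index `k = n + 1` of the gradient series:
`(-2πi/k!) ∫_{𝕄^{k-1} × 𝕄^k} a_k(ξ) ξ₁ e^{-2πi⟨ξ, x⟩} m(dx₂) ⋯ m(dx_k) dξ`. -/
def gradTerm (a : (k : ℕ) → (Fin k → E d) → ℂ) (n : ℕ) (m : P2 d) (x₁ : E d) (i : Fin d) : ℂ :=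
  -2 * Real.pi * Complex.I / (Nat.factorial (n + 1) : ℂ) *
    ∫ p : (Fin n → E d) × (Fin (n + 1) → E d),
      a (n + 1) p.2 * (p.2 0 i : ℂ) * character p.2 (Fin.cons x₁ p.1)
      ∂((power m n).prod volume)

def gradSeries (a : (k : ℕ) → (Fin k → E d) → ℂ) (m : P2 d) (x₁ : E d) (i : Fin d) : ℂ :=
  ∑' n, gradTerm a n m x₁ i

/-- The `(i, j)` entry of the term of index `k = n + 1` of the series for `∇(∇_w U₀)`:
`(-4π²/k!) ∫_{𝕄^{k-1} × 𝕄^k} a_k(ξ) ξ₁ ⊗ ξ₁ e^{-2πi⟨ξ, x⟩} m(dx₂) ⋯ m(dx_k) dξ`. -/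
def jacTerm (a : (k : ℕ) → (Fin k → E d) → ℂ) (n : ℕ) (m : P2 d) (x₁ : E d) (i j : Fin d) : ℂ :=
  -4 * Real.pi ^ 2 / (Nat.factorial (n + 1) : ℂ) *
    ∫ p : (Fin n → E d) × (Fin (n + 1) → E d),
      a (n + 1) p.2 * (p.2 0 i : ℂ) * (p.2 0 j : ℂ) * character p.2 (Fin.cons x₁ p.1)
      ∂((power m n).prod volume)

def jacSeries (a : (k : ℕ) → (Fin k → E d) → ℂ) (m : P2 d) (x₁ : E d) :
    Matrix (Fin d) (Fin d) ℂ :=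
  Matrix.of fun i j => ∑' n, jacTerm a n m x₁ i j

/-- The `(i, j)` entry of the term of index `k = n + 2` of the series for `∇²_w U₀`:
`(-4π²(k-1)/k!) ∫_{𝕄^{k-2} × 𝕄^k} a_k(ξ) ξ₁ ⊗ ξ₂ e^{-2πi⟨ξ, x⟩} m(dx₃) ⋯ m(dx_k) dξ`.
The term `k = 1` vanishes because of the factor `k - 1`. -/
def hessTerm (a : (k : ℕ) → (Fin k → E d) → ℂ) (n : ℕ) (m : P2 d) (x₁ x₂ : E d)
    (i j : Fin d) : ℂ :=
  -4 * Real.pi ^ 2 * ((n : ℂ) + 1) / (Nat.factorial (n + 2) : ℂ) *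
    ∫ p : (Fin n → E d) × (Fin (n + 2) → E d),
      a (n + 2) p.2 * (p.2 0 i : ℂ) * (p.2 1 j : ℂ) *
        character p.2 (Fin.cons x₁ (Fin.cons x₂ p.1))
      ∂((power m n).prod volume)

def hessSeries (a : (k : ℕ) → (Fin k → E d) → ℂ) (m : P2 d) (x₁ x₂ : E d) :
    Matrix (Fin d) (Fin d) ℂ :=
  Matrix.of fun i j => ∑' n, hessTerm a n m x₁ x₂ i j

end Wass

end

open Wass

open MeasureTheory Filter Topology
open scoped ENNReal Matrix

noncomputable section

namespace Wass

variable {d : ℕ}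

/-! ### Couplings and the Wasserstein distance -/

/-! By Fubini `F k ξ` is `1/k` times the product of the Fourier transforms `hat m (ξ j)`;
symmetrization does not change it (`F_eq_modeU`). Each `hat m (ξ j)` is linear in `m`, and plane
waves have derivatives controlled by powers of `‖ξ j‖`. Telescoping products of numbers in the unit
disc therefore gives `F k ξ` expansions of first and second order in the measure, with errors
quadratic in `W2` and constants `modeK1 ξ`, `modeK2 ξ` that are `1/k` times polynomials of degree 2
and 3 in `∑ ‖ξ j‖` (`firstOrder_mode`, `secondOrder_mode`).

All that the calculus needs is collected in the predicates `FirstOrder` and `SecondOrder`: linear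
identities, and norm bounds in which one constant `K` enters linearly. Such conditions survive
integration over a parameter as soon as `K` is integrable (`FirstOrder.integral`,
`SecondOrder.integral`). This is applied twice, to `dξ` with weight `a_k / k!` and to the counting
measure on the degrees `k`. The moment hypotheses say that the weighted constants are of order
`k^{-1-δ}`, hence summable. Permutation invariance of `a_k` collapses the averages over indices to
the terms in `ξ₁`, or in `ξ₁, ξ₂` with multiplicity `k - 1`, that appear in the stated series.

It remains to see that `FirstOrder` and `SecondOrder` imply the Wasserstein notions. An expansion
makes `B` both a subgradient and a supergradient. For minimality of the norm, any other subgradient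
`η` is tested along `x ↦ x + t ∇φ(x)`. For small `t` the only optimal plan is the one induced by
this map (`eq_of_mem_optimalCouplings_map`), and comparison with the expansion shows that `η - B` is
orthogonal to all gradients of test functions. If `B` is orthogonal to every such field, Pythagoras
concludes (`isWGradient_of_expansion`). That orthogonality is the clause `orth`; it is linear, and
for plane waves it follows by cutting off at infinity.

For the Hessian, `ν ↦ ∫ ⟨A ν, ζ⟩ dν` is expanded in turn. Its gradient is the spatial gradient of
`⟨A m, ζ⟩` plus an integral of the transposed measure derivative against `ζ`. Subtracting the
connection term leaves a form without derivatives of the fields, `hessForm`, which is bounded on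
`L²(m)` (`FirstOrder.isHessianAt`). At the constant fields `eᵢ` it yields `lap`, which is linear in
the two second derivatives and so commutes with the integral over `ξ` and the sum over `k`. -/

lemma P2.lintegral_lt_top (m : P2 d) : ∫⁻ x, ‖x‖ₑ ^ 2 ∂m.meas < ⊤ := m.2.2

lemma P2.memLp_id (m : P2 d) : MemLp (fun x : E d => x) 2 m.meas := by
  refine ⟨aestronglyMeasurable_id, ?_⟩
  have := eLpNorm_lt_top_iff_lintegral_rpow_enorm_lt_top (f := fun x : E d => x) (μ := m.meas)
    (p := 2) (by norm_num) (by norm_num)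
  rw [this]
  simpa using m.lintegral_lt_top

lemma isProbabilityMeasure_of_mem_couplings {m ν : P2 d} {γ : Measure (E d × E d)}
    (h : γ ∈ couplings m ν) : IsProbabilityMeasure γ := by
  have : IsProbabilityMeasure (γ.map Prod.fst) := by rw [h.1]; infer_instance
  exact Measure.isProbabilityMeasure_of_map Prod.fst

lemma prod_mem_couplings (m ν : P2 d) : m.meas.prod ν.meas ∈ couplings m ν := by
  constructor
  · simp [Measure.map_fst_prod]
  · simp [Measure.map_snd_prod]

lemma memLp_fst {m ν : P2 d} {γ : Measure (E d × E d)} (h : γ ∈ couplings m ν)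
    {G : Type*} [NormedAddCommGroup G] {f : E d → G} {p : ℝ≥0∞} (hf : MemLp f p m.meas) :
    MemLp (fun q : E d × E d => f q.1) p γ := by
  rw [← h.1] at hf
  exact hf.comp_of_map measurable_fst.aemeasurable

lemma memLp_snd {m ν : P2 d} {γ : Measure (E d × E d)} (h : γ ∈ couplings m ν)
    {G : Type*} [NormedAddCommGroup G] {f : E d → G} {p : ℝ≥0∞} (hf : MemLp f p ν.meas) :
    MemLp (fun q : E d × E d => f q.2) p γ := by
  rw [← h.2] at hf
  exact hf.comp_of_map measurable_snd.aemeasurable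

lemma integral_fst {m ν : P2 d} {γ : Measure (E d × E d)} (h : γ ∈ couplings m ν)
    {G : Type*} [NormedAddCommGroup G] [NormedSpace ℝ G] {f : E d → G}
    (hf : AEStronglyMeasurable f m.meas) : ∫ q, f q.1 ∂γ = ∫ x, f x ∂m.meas := by
  rw [← h.1] at hf ⊢
  exact (integral_map measurable_fst.aemeasurable hf).symm

lemma integral_snd {m ν : P2 d} {γ : Measure (E d × E d)} (h : γ ∈ couplings m ν)
    {G : Type*} [NormedAddCommGroup G] [NormedSpace ℝ G] {f : E d → G}
    (hf : AEStronglyMeasurable f ν.meas) : ∫ q, f q.2 ∂γ = ∫ x, f x ∂ν.meas := by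
  rw [← h.2] at hf ⊢
  exact (integral_map measurable_snd.aemeasurable hf).symm

lemma memLp_sub {m ν : P2 d} {γ : Measure (E d × E d)} (h : γ ∈ couplings m ν) :
    MemLp (fun q : E d × E d => q.2 - q.1) 2 γ :=
  (memLp_snd h ν.memLp_id).sub (memLp_fst h m.memLp_id)

lemma integrable_norm_sq_sub {m ν : P2 d} {γ : Measure (E d × E d)} (h : γ ∈ couplings m ν) :
    Integrable (fun q : E d × E d => ‖q.2 - q.1‖ ^ 2) γ :=
  (memLp_sub h).integrable_norm_pow (by norm_num)

lemma cost_eq_ofReal {m ν : P2 d} {γ : Measure (E d × E d)} (h : γ ∈ couplings m ν) :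
    cost γ = ENNReal.ofReal (∫ q, ‖q.2 - q.1‖ ^ 2 ∂γ) := by
  rw [ofReal_integral_eq_lintegral_ofReal (integrable_norm_sq_sub h)
    (Eventually.of_forall fun _ => by positivity)]
  refine lintegral_congr fun q => ?_
  rw [ENNReal.ofReal_pow (norm_nonneg _), ofReal_norm, ← enorm_neg, neg_sub]

lemma W2_nonneg (m ν : P2 d) : 0 ≤ W2 m ν := Real.sqrt_nonneg _

/-- The product coupling has finite cost. Hence the `toReal` in `W2` loses nothing. -/
lemma iInf_cost_lt_top (m ν : P2 d) : (⨅ γ ∈ couplings m ν, cost γ) < ⊤ := by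
  refine lt_of_le_of_lt (iInf₂_le _ (prod_mem_couplings m ν)) ?_
  rw [cost_eq_ofReal (prod_mem_couplings m ν)]
  exact ENNReal.ofReal_lt_top

lemma ofReal_W2_sq (m ν : P2 d) :
    ENNReal.ofReal (W2 m ν ^ 2) = ⨅ γ ∈ couplings m ν, cost γ := by
  rw [W2, Real.sq_sqrt ENNReal.toReal_nonneg, ENNReal.ofReal_toReal (iInf_cost_lt_top m ν).ne]

lemma W2_sq_le {m ν : P2 d} {γ : Measure (E d × E d)} (h : γ ∈ couplings m ν) :
    W2 m ν ^ 2 ≤ ∫ q, ‖q.2 - q.1‖ ^ 2 ∂γ := by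
  have h1 : ENNReal.ofReal (W2 m ν ^ 2) ≤ cost γ := (ofReal_W2_sq m ν).trans_le (iInf₂_le _ h)
  rw [cost_eq_ofReal h] at h1
  exact (ENNReal.ofReal_le_ofReal_iff (integral_nonneg fun _ => by positivity)).1 h1

lemma integral_eq_W2_sq {m ν : P2 d} {γ : Measure (E d × E d)} (h : γ ∈ optimalCouplings m ν) :
    ∫ q, ‖q.2 - q.1‖ ^ 2 ∂γ = W2 m ν ^ 2 := by
  have h1 := h.2
  rw [cost_eq_ofReal h.1] at h1
  exact (ENNReal.ofReal_eq_ofReal_iff (integral_nonneg fun _ => by positivity)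
    (sq_nonneg _)).1 h1

/-- Nonnegativity of the variance. -/
lemma integral_norm_sq_sq_le {Ω : Type*} [MeasurableSpace Ω] {γ : Measure Ω}
    [IsProbabilityMeasure γ] {f : Ω → ℝ} (hf : MemLp f 2 γ) :
    (∫ q, f q ∂γ) ^ 2 ≤ ∫ q, f q ^ 2 ∂γ := by
  have h1 := hf.integrable (by norm_num)
  have h2 := hf.integrable_sq
  set c := ∫ q, f q ∂γ
  have h3 : 0 ≤ ∫ q, (f q - c) ^ 2 ∂γ := integral_nonneg fun _ => by positivity
  have h4 : ∫ q, (f q - c) ^ 2 ∂γ = ∫ q, (f q ^ 2 - 2 * c * f q + c ^ 2) ∂γ :=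
    integral_congr_ae (Eventually.of_forall fun q => by simp only; ring)
  have h5 : Integrable (fun q => f q ^ 2 - 2 * c * f q) γ := h2.sub (h1.const_mul _)
  rw [h4, integral_add h5 (integrable_const _),
    integral_sub h2 (h1.const_mul _), integral_const_mul] at h3
  simp only [integral_const, probReal_univ, one_smul] at h3
  change 0 ≤ _ - 2 * c * c + c ^ 2 at h3
  linarith

lemma integral_norm_le_W2 {m ν : P2 d} {γ : Measure (E d × E d)}
    (h : γ ∈ optimalCouplings m ν) : ∫ q, ‖q.2 - q.1‖ ∂γ ≤ W2 m ν := by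
  have := isProbabilityMeasure_of_mem_couplings h.1
  refine le_of_sq_le_sq ?_ (W2_nonneg _ _)
  rw [← integral_eq_W2_sq h]
  exact integral_norm_sq_sq_le (memLp_sub h.1).norm

lemma integrable_norm_sub {m ν : P2 d} {γ : Measure (E d × E d)} (h : γ ∈ couplings m ν) :
    Integrable (fun q : E d × E d => ‖q.2 - q.1‖) γ := by
  have := isProbabilityMeasure_of_mem_couplings h
  exact ((memLp_sub h).integrable (by norm_num)).norm

/-- A coupling whose cost is minimal is optimal. -/
lemma mem_optimalCouplings_iff {m ν : P2 d} {γ : Measure (E d × E d)} :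
    γ ∈ optimalCouplings m ν ↔ γ ∈ couplings m ν ∧ ∀ γ' ∈ couplings m ν, cost γ ≤ cost γ' := by
  refine and_congr_right fun h => ?_
  rw [ofReal_W2_sq]
  constructor
  · intro h1 γ' h'
    exact h1.trans_le (iInf₂_le _ h')
  · intro h1
    exact le_antisymm (le_iInf₂ h1) (iInf₂_le _ h)

lemma map_diag_mem_couplings (m : P2 d) (T : E d → E d) (hT : Measurable T) (ν : P2 d)
    (h : m.meas.map T = ν.meas) : m.meas.map (fun x => (x, T x)) ∈ couplings m ν := by
  have h1 : Measurable fun x => (x, T x) := measurable_id.prodMk hT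
  constructor
  · rw [Measure.map_map measurable_fst h1]
    exact Measure.map_id
  · rw [Measure.map_map measurable_snd h1]
    exact h

/-- Zero cost is minimal. This plan specializes expansions in the measure to `ν = m`, and so
isolates the spatial derivative. -/
lemma diag_mem_optimalCouplings (m : P2 d) :
    m.meas.map (fun x => (x, x)) ∈ optimalCouplings m m := by
  rw [mem_optimalCouplings_iff]
  refine ⟨map_diag_mem_couplings m id measurable_id m Measure.map_id, fun γ' _ => ?_⟩
  have : cost (m.meas.map (fun x => (x, x))) = 0 := by
    rw [cost, lintegral_map (by fun_prop) (by fun_prop)]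
    simp
  simp [this]

lemma W2_self (m : P2 d) : W2 m m = 0 := by
  have h := integral_eq_W2_sq (diag_mem_optimalCouplings m)
  rw [integral_map (by fun_prop) (by fun_prop)] at h
  simpa using h.symm

/-! ### Existence of optimal couplings -/

/-- Outside `K ×ˢ L` a coupling has at most the mass of the first marginal off `K` plus that of the
second off `L`, whatever the coupling. -/
lemma isTightMeasureSet_couplings (m ν : P2 d) : IsTightMeasureSet (couplings m ν) := by
  rw [isTightMeasureSet_iff_exists_isCompact_measure_compl_le]
  intro ε hε
  have hε2 : 0 < ε / 2 := ENNReal.half_pos hε.ne'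
  obtain ⟨K, hK, hK'⟩ := isTightMeasureSet_iff_exists_isCompact_measure_compl_le.1
    (isTightMeasureSet_singleton (μ := m.meas)) _ hε2
  obtain ⟨L, hL, hL'⟩ := isTightMeasureSet_iff_exists_isCompact_measure_compl_le.1
    (isTightMeasureSet_singleton (μ := ν.meas)) _ hε2
  refine ⟨K ×ˢ L, hK.prod hL, fun γ hγ => ?_⟩
  have hsub : (K ×ˢ L)ᶜ ⊆ Prod.fst ⁻¹' Kᶜ ∪ Prod.snd ⁻¹' Lᶜ := by
    rintro ⟨x, y⟩ h
    simp only [Set.mem_compl_iff, Set.mem_prod, not_and_or] at h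
    exact h
  refine (measure_mono hsub).trans ((measure_union_le _ _).trans ?_)
  rw [← Measure.map_apply measurable_fst hK.measurableSet.compl,
    ← Measure.map_apply measurable_snd hL.measurableSet.compl, hγ.1, hγ.2,
    ← ENNReal.add_halves ε]
  exact add_le_add (hK' _ rfl) (hL' _ rfl)

/-- The cost is the supremum over `n` of the integrals of `min (|x - y|²) n`, which are weakly
continuous because the integrands are bounded and continuous. -/
lemma lowerSemicontinuous_cost :
    LowerSemicontinuous fun γ : ProbabilityMeasure (E d × E d) =>
      cost (γ : Measure (E d × E d)) := by
  have h1 : (fun γ : ProbabilityMeasure (E d × E d) => cost (γ : Measure (E d × E d))) =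
      fun γ : ProbabilityMeasure (E d × E d) => ⨆ n : ℕ, ∫⁻ p, ((min (‖p.1 - p.2‖₊ ^ 2) (n : NNReal) : NNReal) : ℝ≥0∞)
        ∂(γ : Measure (E d × E d)) := by
    ext γ
    rw [← lintegral_iSup (fun n => by fun_prop)]
    · refine lintegral_congr fun p => ?_
      obtain ⟨n, hn⟩ := exists_nat_ge (‖p.1 - p.2‖₊ ^ 2)
      apply le_antisymm
      · refine le_iSup_of_le n ?_
        rw [min_eq_left hn]; simp [enorm]
      · refine iSup_le fun n => ?_
        refine (ENNReal.coe_le_coe.2 (min_le_left _ _)).trans ?_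
        simp [enorm]
    · intro a b hab p
      exact ENNReal.coe_le_coe.2 (min_le_min le_rfl (by exact_mod_cast hab))
  rw [h1]
  refine lowerSemicontinuous_iSup fun n => Continuous.lowerSemicontinuous ?_
  let f : BoundedContinuousFunction (E d × E d) NNReal :=
    BoundedContinuousFunction.mkOfBound
      ⟨fun p => min (‖p.1 - p.2‖₊ ^ 2) (n : NNReal), by fun_prop⟩ n (by
        intro x y
        rw [NNReal.dist_eq, abs_le]
        have h0 : ∀ z : E d × E d, ((min (‖z.1 - z.2‖₊ ^ 2) (n : NNReal) : NNReal) : ℝ) ≤ n := by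
          intro z
          exact NNReal.coe_le_coe.2 (min_le_right (‖z.1 - z.2‖₊ ^ 2) (n : NNReal))
        have h1 := h0 x
        have h2 := h0 y
        have h3 := (min (‖x.1 - x.2‖₊ ^ 2) (n : NNReal)).coe_nonneg
        have h4 := (min (‖y.1 - y.2‖₊ ^ 2) (n : NNReal)).coe_nonneg
        constructor
        · exact (by linarith : (-n : ℝ) ≤
            ((min (‖x.1 - x.2‖₊ ^ 2) (n : NNReal) : NNReal) : ℝ) -
            ((min (‖y.1 - y.2‖₊ ^ 2) (n : NNReal) : NNReal) : ℝ))
        · exact (by linarith : 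
            ((min (‖x.1 - x.2‖₊ ^ 2) (n : NNReal) : NNReal) : ℝ) -
            ((min (‖y.1 - y.2‖₊ ^ 2) (n : NNReal) : NNReal) : ℝ) ≤ n))
  exact ProbabilityMeasure.continuous_lintegral_boundedContinuousFunction f

/-- The direct method: by Prokhorov the couplings form a weakly compact set, and the cost is lower
semicontinuous. Existence is essential, since an infimum over an empty set of plans would be `⊤` and
no field could be a subgradient. -/
theorem exists_mem_optimalCouplings (m ν : P2 d) : ∃ γ, γ ∈ optimalCouplings m ν := by
  let S : Set (ProbabilityMeasure (E d × E d)) :=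
    {γ | (γ : Measure (E d × E d)) ∈ couplings m ν}
  have hS : IsClosed S := by
    let mp : ProbabilityMeasure (E d) := ⟨m.meas, inferInstance⟩
    let νp : ProbabilityMeasure (E d) := ⟨ν.meas, inferInstance⟩
    have h1 : S = {γ | γ.map (f := Prod.fst) measurable_fst.aemeasurable = mp} ∩
        {γ | γ.map (f := Prod.snd) measurable_snd.aemeasurable = νp} := by
      ext γ
      simp only [S, couplings, Set.mem_inter_iff, Set.mem_ofPred_eq]
      refine and_congr ?_ ?_
      · exact (Subtype.ext_iff (a1 := γ.map (f := Prod.fst) _) (a2 := mp)).symm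
      · exact (Subtype.ext_iff (a1 := γ.map (f := Prod.snd) _) (a2 := νp)).symm
    rw [h1]
    exact (isClosed_eq (ProbabilityMeasure.continuous_map continuous_fst) continuous_const).inter
      (isClosed_eq (ProbabilityMeasure.continuous_map continuous_snd) continuous_const)
  have hc : IsCompact S := by
    rw [← hS.closure_eq]
    refine isCompact_closure_of_isTightMeasureSet
      ((isTightMeasureSet_couplings m ν).subset ?_)
    rintro _ ⟨μ, hμ, rfl⟩
    exact hμ
  have hne : S.Nonempty := ⟨⟨m.meas.prod ν.meas, inferInstance⟩, prod_mem_couplings m ν⟩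
  obtain ⟨γ, hγ, hmin⟩ := LowerSemicontinuousOn.exists_isMinOn hne hc
    (lowerSemicontinuous_cost.lowerSemicontinuousOn S)
  refine ⟨γ, mem_optimalCouplings_iff.2 ⟨hγ, fun γ' h' => ?_⟩⟩
  have h'' : (⟨γ', isProbabilityMeasure_of_mem_couplings h'⟩ :
    ProbabilityMeasure (E d × E d)) ∈ S := h'
  exact isMinOn_iff.1 hmin _ h''

/-! ### Transport along the gradient of a test function -/

/-- The push-forward of `m` under a square integrable Borel map. -/
def P2.map (m : P2 d) (T : E d → E d) (hT : Measurable T) (h : MemLp T 2 m.meas) : P2 d :=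
  ⟨m.meas.map T, Measure.isProbabilityMeasure_map hT.aemeasurable, by
    rw [lintegral_map (by fun_prop) hT]
    have := (eLpNorm_lt_top_iff_lintegral_rpow_enorm_lt_top (f := T) (μ := m.meas)
      (p := 2) (by norm_num) (by norm_num)).1 h.2
    simpa using this⟩

lemma P2.meas_map (m : P2 d) (T : E d → E d) (hT : Measurable T) (h : MemLp T 2 m.meas) :
    (m.map T hT h).meas = m.meas.map T := rfl

lemma gradient_eq (φ : E d → ℝ) :
    gradient φ = fun x => (InnerProductSpace.toDual ℝ (E d)).symm (fderiv ℝ φ x) := rfl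

lemma inner_gradient (φ : E d → ℝ) (x v : E d) :
    inner ℝ (gradient φ x) v = fderiv ℝ φ x v := by
  simp [gradient]

lemma norm_gradient (φ : E d → ℝ) (x : E d) : ‖gradient φ x‖ = ‖fderiv ℝ φ x‖ := by
  simp [gradient]

lemma IsTest.contDiff_gradient {φ : E d → ℝ} (h : IsTest φ) :
    ContDiff ℝ (⊤ : ℕ∞) (gradient φ) := by
  rw [gradient_eq]
  exact (InnerProductSpace.toDual ℝ (E d)).symm.contDiff.comp
    (h.1.fderiv_right (m := (⊤ : ℕ∞)) (by simp))

lemma IsTest.hasCompactSupport_gradient {φ : E d → ℝ} (h : IsTest φ) :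
    HasCompactSupport (gradient φ) :=
  (h.2.fderiv ℝ).comp_left (map_zero (InnerProductSpace.toDual ℝ (E d)).symm)

lemma IsTest.isTestField_gradient {φ : E d → ℝ} (h : IsTest φ) : IsTestField (gradient φ) :=
  ⟨h.contDiff_gradient, h.hasCompactSupport_gradient⟩

lemma IsTestField.exists_norm_le {ζ : E d → E d} (h : IsTestField ζ) : ∃ C, ∀ x, ‖ζ x‖ ≤ C :=
  h.2.exists_bound_of_continuous h.1.continuous

lemma IsTestField.exists_lipschitz {ζ : E d → E d} (h : IsTestField ζ) :
    ∃ C : NNReal, LipschitzWith C ζ :=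
  h.1.lipschitzWith_of_hasCompactSupport h.2 (by simp)

lemma IsTestField.memLp {ζ : E d → E d} (h : IsTestField ζ) (p : ℝ≥0∞) (m : P2 d) :
    MemLp ζ p m.meas := by
  obtain ⟨C, hC⟩ := h.exists_norm_le
  exact MemLp.of_bound h.1.continuous.aestronglyMeasurable C (Eventually.of_forall hC)

/-- The mean value inequality on the segment, where the derivative stays within `L * ‖y - x‖` of its
value at `x`. The factor 1/2 of Taylor's formula is given up. -/
lemma norm_sub_sub_fderiv_le {F G : Type*} [NormedAddCommGroup F] [NormedSpace ℝ F]
    [NormedAddCommGroup G] [NormedSpace ℝ G] {f : F → G} {L : ℝ}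
    (hf : Differentiable ℝ f) (hL : ∀ x y, ‖fderiv ℝ f y - fderiv ℝ f x‖ ≤ L * ‖y - x‖) (x y : F) :
    ‖f y - f x - fderiv ℝ f x (y - x)‖ ≤ L * ‖y - x‖ ^ 2 := by
  have h0 : 0 ≤ L * ‖y - x‖ := (norm_nonneg _).trans (hL x y)
  have h := (convex_segment x y).norm_image_sub_le_of_norm_hasFDerivWithin_le'
    (f := f) (f' := fun z => fderiv ℝ f z) (φ := fderiv ℝ f x) (C := L * ‖y - x‖)
    (fun z _ => (hf z).hasFDerivAt.hasFDerivWithinAt) (fun z hz => ?_)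
    (left_mem_segment ℝ x y) (right_mem_segment ℝ x y)
  · calc _ ≤ L * ‖y - x‖ * ‖y - x‖ := h
      _ = _ := by ring
  -- The sign of `L` is not assumed; the Lipschitz bound forces `0 ≤ L` only when `y ≠ x`.
  · rcases eq_or_ne (y - x) 0 with h1 | h1
    · have : y = x := sub_eq_zero.1 h1
      subst this
      rw [segment_same, Set.mem_singleton_iff] at hz
      simp [hz]
    · have hL0 : 0 ≤ L := nonneg_of_mul_nonneg_left h0 (norm_pos_iff.2 h1)
      refine (hL x z).trans (mul_le_mul_of_nonneg_left ?_ hL0)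
      exact norm_sub_le_of_mem_segment hz

/-- For small `t`, the map `x ↦ x + t ∇φ(x)` is the only optimal transport plan from `m` to its
image measure. -/
theorem eq_of_mem_optimalCouplings_map {φ : E d → ℝ} (hφ : IsTest φ) :
    ∃ t₀ > 0, ∀ t : ℝ, 0 ≤ t → t ≤ t₀ → ∀ (m : P2 d)
      (hT : Measurable fun x => x + t • gradient φ x)
      (h : MemLp (fun x => x + t • gradient φ x) 2 m.meas),
      ∀ γ ∈ optimalCouplings m (m.map _ hT h),
        γ = m.meas.map fun x => (x, x + t • gradient φ x) := by
  obtain ⟨L, hL⟩ := hφ.isTestField_gradient.exists_lipschitz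
  have hφd : Differentiable ℝ φ := hφ.1.differentiable (by simp)
  have hsecond : ∀ x y, |φ y - φ x - inner ℝ (gradient φ x) (y - x)| ≤ L * ‖y - x‖ ^ 2 := by
    intro x y
    rw [inner_gradient]
    refine norm_sub_sub_fderiv_le hφd (fun a b => ?_) x y
    have := hL.dist_le_mul b a
    rw [dist_eq_norm, dist_eq_norm, gradient_eq, ← map_sub, LinearIsometryEquiv.norm_map] at this
    exact this
  -- This threshold gives `t * L ≤ 1/4`. It makes the duality inequality `key` strict off the
  -- diagonal and keeps the map injective with a Lipschitz inverse.
  refine ⟨1 / (4 * (L + 1)), by positivity, fun t ht0 ht m hT h γ hγ => ?_⟩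
  have htL : t * L ≤ 1 / 4 := by
    rw [le_div_iff₀ (by positivity)] at ht
    nlinarith [L.coe_nonneg]
  set T : E d → E d := fun x => x + t • gradient φ x with hTdef
  have hTc : Continuous T := continuous_id.add (hφ.contDiff_gradient.continuous.const_smul t)
  -- Kantorovich duality with a slack. The potentials are `-tφ` at `x` and `tφ + t²|∇φ|²/2` at the
  -- preimage `x'` of the target point. Equality holds for `x = x'`, and the surplus `|x - x'|²/4`
  -- forces uniqueness.
  have key : ∀ x x', t * φ x' - t * φ x + t ^ 2 * ‖gradient φ x'‖ ^ 2 / 2 + ‖x - x'‖ ^ 2 / 4 ≤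
      ‖T x' - x‖ ^ 2 / 2 := by
    intro x x'
    have h1 := hsecond x' x
    have h2 : ‖T x' - x‖ ^ 2 = ‖x - x'‖ ^ 2 - 2 * (t * inner ℝ (gradient φ x') (x - x')) +
        t ^ 2 * ‖gradient φ x'‖ ^ 2 := by
      have : T x' - x = t • gradient φ x' - (x - x') := by simp only [hTdef]; abel
      rw [this, norm_sub_sq_real, norm_smul, real_inner_smul_left, mul_pow, Real.norm_eq_abs,
        sq_abs]
      ring
    rw [h2]
    have h3 := mul_le_mul_of_nonneg_left (abs_le.1 h1).1 ht0
    have h4 : t * (L * ‖x - x'‖ ^ 2) ≤ 1 / 4 * ‖x - x'‖ ^ 2 := by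
      rw [← mul_assoc]; exact mul_le_mul_of_nonneg_right htL (sq_nonneg _)
    nlinarith
  have hanti : AntilipschitzWith 2 T := by
    refine AntilipschitzWith.of_le_mul_dist fun x y => ?_
    rw [dist_eq_norm, dist_eq_norm]
    have h1 := hL.dist_le_mul x y
    rw [dist_eq_norm, dist_eq_norm] at h1
    have h2 : x - y = (T x - T y) - t • (gradient φ x - gradient φ y) := by
      simp only [hTdef, smul_sub]; abel
    have h3 : ‖x - y‖ ≤ ‖T x - T y‖ + t * ‖gradient φ x - gradient φ y‖ := by
      conv_lhs => rw [h2]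
      refine (norm_sub_le _ _).trans ?_
      rw [norm_smul, Real.norm_of_nonneg ht0]
    have h4 := mul_le_mul_of_nonneg_left h1 ht0
    rw [← mul_assoc] at h4
    have h5 := mul_le_mul_of_nonneg_right htL (norm_nonneg (x - y))
    have h6 := norm_nonneg (x - y)
    norm_num
    linarith
  have huc : UniformContinuous T :=
    uniformContinuous_id.add (hL.uniformContinuous.const_smul t)
  have hemb : MeasurableEmbedding T := (hanti.isClosedEmbedding huc).measurableEmbedding
  -- `T` is a closed embedding, so it has a Borel left inverse `S`. On the image measure `S` is a
  -- two-sided inverse almost everywhere.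
  obtain ⟨S, hS, hST⟩ := hemb.exists_measurable_extend measurable_id (fun x => ⟨x⟩)
  have hST' : ∀ x, S (T x) = x := fun x => congrFun hST x
  have hprob := isProbabilityMeasure_of_mem_couplings hγ.1
  have hTS : ∀ᵐ q ∂γ, T (S q.2) = q.2 := by
    have h1 : ∀ᵐ y ∂(γ.map Prod.snd), T (S y) = y := by
      rw [hγ.1.2, P2.meas_map]
      refine (ae_map_iff hT.aemeasurable
        (measurableSet_eq_fun (hTc.measurable.comp hS) measurable_id)).2 ?_
      exact Eventually.of_forall fun x => congrArg T (hST' x)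
    exact ae_of_ae_map measurable_snd.aemeasurable h1
  obtain ⟨Cφ, hCφ⟩ := hφ.2.exists_bound_of_continuous hφ.1.continuous
  obtain ⟨Cg, hCg⟩ := hφ.isTestField_gradient.exists_norm_le
  have hgc := hφ.contDiff_gradient.continuous
  have iφ1 : Integrable (fun q : E d × E d => φ q.1) γ :=
    .of_bound (hφ.1.continuous.comp continuous_fst).aestronglyMeasurable Cφ
      (Eventually.of_forall fun q => hCφ _)
  have iφ2 : Integrable (fun q : E d × E d => φ (S q.2)) γ :=
    .of_bound (hφ.1.continuous.measurable.comp (hS.comp measurable_snd)).aestronglyMeasurable Cφ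
      (Eventually.of_forall fun q => hCφ _)
  have ig : Integrable (fun q : E d × E d => ‖gradient φ (S q.2)‖ ^ 2) γ :=
    .of_bound ((hgc.norm.pow 2).measurable.comp (hS.comp measurable_snd)).aestronglyMeasurable
      (Cg ^ 2) (Eventually.of_forall fun q => by
        rw [Real.norm_of_nonneg (by positivity)]
        exact pow_le_pow_left₀ (norm_nonneg _) (hCg _) 2)
  have hcost := integrable_norm_sq_sub hγ.1
  have hle : ∀ᵐ q ∂γ, ‖q.1 - S q.2‖ ^ 2 ≤ 2 * ‖q.2 - q.1‖ ^ 2 + 4 * t * φ q.1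
      - 4 * t * φ (S q.2) - 2 * t ^ 2 * ‖gradient φ (S q.2)‖ ^ 2 := by
    filter_upwards [hTS] with q hq
    have := key q.1 (S q.2)
    rw [hq] at this
    linarith
  have e1 : ∫ q, φ q.1 ∂γ = ∫ x, φ x ∂m.meas :=
    integral_fst hγ.1 hφ.1.continuous.aestronglyMeasurable
  have e2 : ∫ q, φ (S q.2) ∂γ = ∫ x, φ x ∂m.meas := by
    have hm : Measurable fun y => φ (S y) := hφ.1.continuous.measurable.comp hS
    rw [integral_snd hγ.1 (f := fun y => φ (S y)) hm.aestronglyMeasurable, P2.meas_map,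
      integral_map hT.aemeasurable hm.aestronglyMeasurable]
    simp only [hST']
  have e3 : ∫ q, ‖gradient φ (S q.2)‖ ^ 2 ∂γ = ∫ x, ‖gradient φ x‖ ^ 2 ∂m.meas := by
    have hm : Measurable fun y => ‖gradient φ (S y)‖ ^ 2 := (hgc.norm.pow 2).measurable.comp hS
    rw [integral_snd hγ.1 (f := fun y => ‖gradient φ (S y)‖ ^ 2) hm.aestronglyMeasurable,
      P2.meas_map, integral_map hT.aemeasurable hm.aestronglyMeasurable]
    simp only [hST']
  have e4 : ∫ q, ‖q.2 - q.1‖ ^ 2 ∂γ ≤ t ^ 2 * ∫ x, ‖gradient φ x‖ ^ 2 ∂m.meas := by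
    rw [integral_eq_W2_sq hγ]
    refine (W2_sq_le (map_diag_mem_couplings m T hT (m.map T hT h) rfl)).trans_eq ?_
    rw [integral_map (by fun_prop) (by fun_prop), ← integral_const_mul]
    refine integral_congr_ae (Eventually.of_forall fun x => ?_)
    simp [hTdef, norm_smul, mul_pow]
  have i1 := ((hcost.const_mul 2).add (iφ1.const_mul (4 * t))).sub (iφ2.const_mul (4 * t))
  have i2 := i1.sub (ig.const_mul (2 * t ^ 2))
  have hSm : AEStronglyMeasurable (fun q : E d × E d => ‖q.1 - S q.2‖ ^ 2) γ :=
    (by fun_prop : Measurable fun q : E d × E d => ‖q.1 - S q.2‖ ^ 2).aestronglyMeasurable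
  have iS : Integrable (fun q : E d × E d => ‖q.1 - S q.2‖ ^ 2) γ := by
    refine i2.mono' hSm ?_
    filter_upwards [hle] with q hq
    rw [Real.norm_of_nonneg (by positivity)]
    exact hq
  -- Integrated against `γ`, the potentials depend only on the marginals, and the cost of `γ` is at
  -- most that of the map `T`. So the slack has integral zero, and `γ` sits on the graph of `T`.
  have hint : ∫ q, ‖q.1 - S q.2‖ ^ 2 ∂γ ≤ 0 := by
    refine (integral_mono_ae iS i2 hle).trans ?_
    have e5 : ∫ q, (2 * ‖q.2 - q.1‖ ^ 2 + 4 * t * φ q.1 - 4 * t * φ (S q.2)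
        - 2 * t ^ 2 * ‖gradient φ (S q.2)‖ ^ 2) ∂γ = 2 * ∫ q, ‖q.2 - q.1‖ ^ 2 ∂γ
          - 2 * (t ^ 2 * ∫ x, ‖gradient φ x‖ ^ 2 ∂m.meas) := by
      rw [integral_sub, integral_sub, integral_add, integral_const_mul, integral_const_mul,
        integral_const_mul, integral_const_mul, e1, e2, e3]
      · ring
      · exact hcost.const_mul 2
      · exact iφ1.const_mul _
      · exact (hcost.const_mul 2).add (iφ1.const_mul _)
      · exact iφ2.const_mul _
      · exact i1
      · exact ig.const_mul _
    exact e5.trans_le (by linarith)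
  have hzero : (fun q : E d × E d => ‖q.1 - S q.2‖ ^ 2) =ᵐ[γ] 0 :=
    (integral_eq_zero_iff_of_nonneg (fun _ => by positivity) iS).1
      (le_antisymm hint (integral_nonneg fun _ => by positivity))
  have hfin : ∀ᵐ q ∂γ, q = (q.1, T q.1) := by
    filter_upwards [hzero, hTS] with q h1 h2
    have h3 : q.1 = S q.2 := by
      simpa [sub_eq_zero] using h1
    rw [Prod.ext_iff]
    exact ⟨rfl, by rw [h3]; exact h2.symm⟩
  calc γ = γ.map id := Measure.map_id.symm
    _ = γ.map (fun q => (q.1, T q.1)) := Measure.map_congr hfin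
    _ = (γ.map Prod.fst).map (fun x => (x, T x)) := by
      rw [Measure.map_map (by fun_prop) measurable_fst]; rfl
    _ = _ := by rw [hγ.1.1]

/-! ### Fields orthogonal to the tangent space -/

/-- `h ∈ L²(m)` is orthogonal to the gradients of test functions. -/
structure IsDivFree (m : P2 d) (h : E d → E d) : Prop where
  memLp : MemLp h 2 m.meas
  integral_eq_zero : ∀ φ, IsTest φ → ∫ x, inner ℝ (h x) (gradient φ x) ∂m.meas = 0

lemma integrable_inner {Ω : Type*} [MeasurableSpace Ω] {μ : Measure Ω} {f g : Ω → E d}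
    (hf : MemLp f 2 μ) (hg : MemLp g 2 μ) : Integrable (fun x => inner ℝ (f x) (g x)) μ := by
  have h1 : Integrable (fun x => ‖f x‖ * ‖g x‖) μ := hf.norm.integrable_mul hg.norm
  refine h1.mono' (hf.1.inner hg.1) (Eventually.of_forall fun x => ?_)
  exact norm_inner_le_norm _ _

lemma normL2_sq (m : P2 d) (ζ : E d → E d) : normL2 m ζ ^ 2 = ∫ x, ‖ζ x‖ ^ 2 ∂m.meas :=
  Real.sq_sqrt (integral_nonneg fun _ => by positivity)

lemma normL2_nonneg (m : P2 d) (ζ : E d → E d) : 0 ≤ normL2 m ζ := Real.sqrt_nonneg _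

lemma integral_norm_le_normL2 {m : P2 d} {ζ : E d → E d} (h : MemLp ζ 2 m.meas) :
    ∫ x, ‖ζ x‖ ∂m.meas ≤ normL2 m ζ := by
  refine le_of_sq_le_sq ?_ (normL2_nonneg _ _)
  rw [normL2_sq]
  exact integral_norm_sq_sq_le h.norm

lemma integral_norm_mul_le {m : P2 d} {ζ η : E d → E d} (h : MemLp ζ 2 m.meas)
    (h' : MemLp η 2 m.meas) : ∫ x, ‖ζ x‖ * ‖η x‖ ∂m.meas ≤ normL2 m ζ * normL2 m η := by
  have := integral_mul_norm_le_Lp_mul_Lq (μ := m.meas) (p := 2) (q := 2) (f := ζ) (g := η)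
    (by constructor <;> norm_num) (by simpa using h) (by simpa using h')
  simpa [normL2, Real.sqrt_eq_rpow] using this

/-- A square integrable field orthogonal to all fields which are orthogonal to the gradients of
test functions is tangent. -/
theorem memTangent_of_orthogonal {m : P2 d} {ζ : E d → E d} (hζ : MemLp ζ 2 m.meas)
    (h : ∀ η, IsDivFree m η → ∫ x, inner ℝ (η x) (ζ x) ∂m.meas = 0) : MemTangent m ζ := by
  refine ⟨hζ, fun ε hε => ?_⟩
  let grad : {φ : E d → ℝ // IsTest φ} → Lp (E d) 2 m.meas :=
    fun φ => (φ.2.isTestField_gradient.memLp 2 m).toLp _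
  let S : Submodule ℝ (Lp (E d) 2 m.meas) :=
    { carrier := Set.range grad
      zero_mem' := by
        refine ⟨⟨fun _ => 0, contDiff_const, HasCompactSupport.zero⟩, ?_⟩
        rw [← MemLp.toLp_zero (E := E d) (p := 2) (μ := m.meas) MemLp.zero]
        refine MemLp.toLp_congr _ _ (Eventually.of_forall fun x => ?_)
        simp [gradient]
      add_mem' := by
        rintro _ _ ⟨φ, rfl⟩ ⟨ψ, rfl⟩
        refine ⟨⟨fun x => φ.1 x + ψ.1 x, φ.2.1.add ψ.2.1, φ.2.2.add ψ.2.2⟩, ?_⟩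
        rw [← MemLp.toLp_add]
        refine MemLp.toLp_congr _ _ (Eventually.of_forall fun x => ?_)
        have h1 : DifferentiableAt ℝ φ.1 x := φ.2.1.differentiable (by simp) x
        have h2 : DifferentiableAt ℝ ψ.1 x := ψ.2.1.differentiable (by simp) x
        simp only [gradient, Pi.add_apply]
        rw [fderiv_fun_add h1 h2, map_add]
      smul_mem' := by
        rintro c _ ⟨φ, rfl⟩
        refine ⟨⟨fun x => c * φ.1 x, contDiff_const.mul φ.2.1, φ.2.2.mul_left⟩, ?_⟩
        rw [← MemLp.toLp_const_smul]
        refine MemLp.toLp_congr _ _ (Eventually.of_forall fun x => ?_)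
        have h1 : DifferentiableAt ℝ φ.1 x := φ.2.1.differentiable (by simp) x
        simp only [gradient, Pi.smul_apply]
        rw [fderiv_const_mul h1, map_smul] }
  have hmem : hζ.toLp ζ ∈ S.topologicalClosure := by
    rw [← Submodule.orthogonal_orthogonal_eq_closure, Submodule.mem_orthogonal]
    intro η hη
    have hdiv : IsDivFree m η := by
      refine ⟨Lp.memLp η, fun φ hφ => ?_⟩
      have h1 := (Submodule.mem_orthogonal' _ _).1 hη (grad ⟨φ, hφ⟩) ⟨_, rfl⟩
      rw [MeasureTheory.L2.inner_def] at h1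
      rw [← h1]
      refine integral_congr_ae ?_
      filter_upwards [(hφ.isTestField_gradient.memLp 2 m).coeFn_toLp] with x hx
      simp only [grad]
      rw [hx]
    rw [MeasureTheory.L2.inner_def, ← h η hdiv]
    refine integral_congr_ae ?_
    filter_upwards [hζ.coeFn_toLp] with x hx
    rw [hx]
  obtain ⟨_, ⟨φ, rfl⟩, hφ⟩ := Metric.mem_closure_iff.1 hmem ε hε
  refine ⟨φ.1, φ.2, ?_⟩
  have hd : dist (hζ.toLp ζ) (grad φ) =
      (eLpNorm (fun x => ζ x - gradient φ.1 x) 2 m.meas).toReal := by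
    rw [dist_eq_norm, ← MemLp.toLp_sub, Lp.norm_toLp]
    rfl
  rw [hd] at hφ
  exact (ENNReal.lt_ofReal_iff_toReal_lt
    (hζ.sub (φ.2.isTestField_gradient.memLp 2 m)).eLpNorm_ne_top).2 hφ

/-! ### Gradients from first order expansions -/

/-- The infimum over optimal plans is at most the value at one of them, and the quadratic error is
`o(W₂)`. -/
lemma isSubgradient_of_expansion {U : P2 d → ℝ} {m : P2 d} {B : E d → E d} {K : ℝ}
    (hB : MemLp B 2 m.meas)
    (h : ∀ ν, ∀ γ ∈ optimalCouplings m ν,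
      |U ν - U m - ∫ p, inner ℝ (B p.1) (p.2 - p.1) ∂γ| ≤ K * W2 m ν ^ 2) :
    IsSubgradient U m B := by
  refine ⟨hB, fun ε hε => ⟨ε / (|K| + 1), by positivity, fun ν hν => ?_⟩⟩
  obtain ⟨γ, hγ⟩ := exists_mem_optimalCouplings m ν
  refine (iInf₂_le γ hγ).trans (EReal.coe_le_coe_iff.2 ?_)
  have h1 := (abs_le.1 (h ν γ hγ)).1
  rw [lt_div_iff₀ (by positivity)] at hν
  have h2 := W2_nonneg m ν
  have h3 : K * W2 m ν ^ 2 ≤ ε * W2 m ν := by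
    have : K ≤ |K| + 1 := (le_abs_self K).trans (by linarith)
    nlinarith [mul_le_mul_of_nonneg_right this h2]
  linarith

lemma wDifferentiableAt_of_expansion {U : P2 d → ℝ} {m : P2 d} {B : E d → E d} {K : ℝ}
    (hB : MemLp B 2 m.meas)
    (h : ∀ ν, ∀ γ ∈ optimalCouplings m ν,
      |U ν - U m - ∫ p, inner ℝ (B p.1) (p.2 - p.1) ∂γ| ≤ K * W2 m ν ^ 2) :
    WDifferentiableAt U m := by
  refine ⟨⟨B, isSubgradient_of_expansion hB h⟩, B, ?_⟩
  refine isSubgradient_of_expansion (K := K) hB.neg fun ν γ hγ => ?_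
  have h1 := h ν γ hγ
  rw [← abs_neg] at h1
  refine le_of_eq_of_le (congrArg _ ?_) h1
  simp only [inner_neg_left, integral_neg]
  ring

/-- For the image of `m` under `x ↦ x + t ∇φ(x)` with small `t` the optimal plan is unique, so the
infimum in the definition of a subgradient is the single number `t ∫ ⟨η, ∇φ⟩ dm`. Comparison with
the expansion through `B`, and division by `t`, gives the inequality up to any `ε`. -/
lemma integral_le_of_isSubgradient {U : P2 d → ℝ} {m : P2 d} {B η : E d → E d} {K : ℝ}
    (hB : MemLp B 2 m.meas)
    (h : ∀ ν, ∀ γ ∈ optimalCouplings m ν,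
      |U ν - U m - ∫ p, inner ℝ (B p.1) (p.2 - p.1) ∂γ| ≤ K * W2 m ν ^ 2)
    (hη : IsSubgradient U m η) {φ : E d → ℝ} (hφ : IsTest φ) :
    ∫ x, inner ℝ (η x - B x) (gradient φ x) ∂m.meas ≤ 0 := by
  obtain ⟨t₀, ht₀, huniq⟩ := eq_of_mem_optimalCouplings_map hφ
  have hgc := hφ.contDiff_gradient.continuous
  have hgL := hφ.isTestField_gradient.memLp 2 m
  set N := normL2 m (gradient φ)
  have hN : 0 ≤ N := normL2_nonneg _ _
  refine le_of_forall_pos_le_add fun ε hε => ?_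
  rw [zero_add]
  obtain ⟨r, hr, hsub⟩ := hη.2 (ε / (2 * (N + 1))) (by positivity)
  -- Three demands on `t`: uniqueness of the plan, `t * N < r` so that the subgradient inequality
  -- applies, and quadratic error at most `t * ε / 2`.
  set t := min t₀ (min (r / (2 * (N + 1))) (ε / (2 * (|K| + 1) * (N ^ 2 + 1))))
  have ht : 0 < t := by positivity
  have htr : t * N < r := by
    have h1 : t ≤ r / (2 * (N + 1)) := (min_le_right _ _).trans (min_le_left _ _)
    rw [le_div_iff₀ (by positivity)] at h1
    nlinarith
  have htε : |K| * (t * N ^ 2) ≤ ε / 2 := by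
    have h1 : t ≤ ε / (2 * (|K| + 1) * (N ^ 2 + 1)) := (min_le_right _ _).trans (min_le_right _ _)
    rw [le_div_iff₀ (by positivity)] at h1
    have h2 := abs_nonneg K
    have h3 : |K| * N ^ 2 ≤ (|K| + 1) * (N ^ 2 + 1) := by nlinarith [sq_nonneg N]
    nlinarith [mul_le_mul_of_nonneg_left h3 ht.le]
  have hTm : Measurable fun x => x + t • gradient φ x :=
    measurable_id.add (hgc.measurable.const_smul t)
  have hTL : MemLp (fun x => x + t • gradient φ x) 2 m.meas := m.memLp_id.add (hgL.const_smul t)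
  set ν := m.map _ hTm hTL
  obtain ⟨γ, hγ⟩ := exists_mem_optimalCouplings m ν
  have hγeq := huniq t ht.le (min_le_left _ _) m hTm hTL
  have hpm : Measurable fun x : E d => (x, x + t • gradient φ x) := measurable_id.prodMk hTm
  have hpair : ∀ ζ : E d → E d, MemLp ζ 2 m.meas → ∀ γ' ∈ optimalCouplings m ν,
      ∫ p, inner ℝ (ζ p.1) (p.2 - p.1) ∂γ' = t * ∫ x, inner ℝ (ζ x) (gradient φ x) ∂m.meas := by
    intro ζ hζ γ' hγ'
    have hm1 : AEStronglyMeasurable (fun p : E d × E d => inner ℝ (ζ p.1) (p.2 - p.1)) γ' :=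
      (memLp_fst hγ'.1 hζ).1.inner (memLp_sub hγ'.1).1
    rw [hγeq γ' hγ'] at hm1 ⊢
    rw [integral_map hpm.aemeasurable hm1, ← integral_const_mul]
    refine integral_congr_ae (Eventually.of_forall fun x => ?_)
    simp [inner_smul_right]
  have hW : W2 m ν = t * N := by
    have h1 := integral_eq_W2_sq hγ
    rw [hγeq γ hγ, integral_map hpm.aemeasurable (by fun_prop)] at h1
    have h2 : W2 m ν ^ 2 = (t * N) ^ 2 := by
      rw [← h1, mul_pow, normL2_sq, ← integral_const_mul]
      refine integral_congr_ae (Eventually.of_forall fun x => ?_)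
      simp [norm_smul, mul_pow]
    exact (sq_eq_sq₀ (W2_nonneg _ _) (by positivity)).1 h2
  have h1 := hsub ν (by rw [hW]; exact htr)
  have h2 : ((t * ∫ x, inner ℝ (η x) (gradient φ x) ∂m.meas : ℝ) : EReal) ≤
      ((U ν - U m + ε / (2 * (N + 1)) * W2 m ν : ℝ) : EReal) := by
    refine le_trans (le_iInf₂ fun γ' hγ' => ?_) h1
    rw [hpair η hη.1 γ' hγ']
  have h3 := EReal.coe_le_coe_iff.1 h2
  have h4 := (abs_le.1 (h ν γ hγ)).2
  rw [hpair B hB γ hγ] at h4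
  rw [hW] at h3 h4
  have h5 : ε / (2 * (N + 1)) * (t * N) ≤ t * (ε / 2) := by
    have : ε / (2 * (N + 1)) * N ≤ ε / 2 := by
      rw [div_mul_eq_mul_div, div_le_div_iff₀ (by positivity) (by positivity)]
      nlinarith
    nlinarith
  have h6 : K * (t * N) ^ 2 ≤ t * (ε / 2) := by
    have : K * (t * N ^ 2) ≤ ε / 2 :=
      (mul_le_mul_of_nonneg_right (le_abs_self K) (by positivity)).trans htε
    nlinarith
  have h7 : ∫ x, inner ℝ (η x - B x) (gradient φ x) ∂m.meas =
      ∫ x, inner ℝ (η x) (gradient φ x) ∂m.meas - ∫ x, inner ℝ (B x) (gradient φ x) ∂m.meas := by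
    simp only [inner_sub_left]
    exact integral_sub (integrable_inner hη.1 hgL) (integrable_inner hB hgL)
  have h8 : t * ∫ x, inner ℝ (η x - B x) (gradient φ x) ∂m.meas ≤ t * ε := by
    rw [h7]; linarith
  exact le_of_mul_le_mul_left h8 ht

/-- A field which gives a first order expansion of `U` at `m` with a quadratic error, and which is
orthogonal to the fields that are orthogonal to gradients, is the Wasserstein gradient. -/
theorem isWGradient_of_expansion {U : P2 d → ℝ} {m : P2 d} {B : E d → E d} {K : ℝ}
    (hB : MemLp B 2 m.meas)
    (h : ∀ ν, ∀ γ ∈ optimalCouplings m ν,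
      |U ν - U m - ∫ p, inner ℝ (B p.1) (p.2 - p.1) ∂γ| ≤ K * W2 m ν ^ 2)
    (horth : ∀ η, IsDivFree m η → ∫ x, inner ℝ (η x) (B x) ∂m.meas = 0) :
    IsWGradient U m B := by
  refine ⟨wDifferentiableAt_of_expansion hB h, isSubgradient_of_expansion hB h, fun η hη => ?_⟩
  -- The inequality for `φ` and for `-φ` makes the difference of two subgradients orthogonal to
  -- gradients.
  have hdiv : IsDivFree m fun x => η x - B x := by
    refine ⟨hη.1.sub hB, fun φ hφ => le_antisymm (integral_le_of_isSubgradient hB h hη hφ) ?_⟩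
    have hneg : IsTest fun x => -φ x := ⟨hφ.1.neg, hφ.2.neg⟩
    have h1 := integral_le_of_isSubgradient hB h hη hneg
    have h2 : gradient (fun x => -φ x) = fun x => -gradient φ x := by
      ext1 x
      simp only [gradient]
      rw [fderiv_fun_neg, map_neg]
    simp only [h2, inner_neg_right, integral_neg] at h1
    linarith
  have h0 := horth _ hdiv
  refine Real.sqrt_le_sqrt ?_
  -- Pythagoras: `η - B` is divergence free, hence orthogonal to `B`.
  have h1 : ∫ x, ‖η x‖ ^ 2 ∂m.meas = ∫ x, ‖η x - B x‖ ^ 2 ∂m.meas + ∫ x, ‖B x‖ ^ 2 ∂m.meas := by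
    have e : ∀ x, ‖η x‖ ^ 2 = ‖η x - B x‖ ^ 2 + 2 * inner ℝ (η x - B x) (B x) + ‖B x‖ ^ 2 := by
      intro x
      rw [← norm_add_sq_real, sub_add_cancel]
    have i1 : Integrable (fun x => ‖η x - B x‖ ^ 2) m.meas :=
      hdiv.memLp.integrable_norm_pow (by norm_num)
    have i2 := (integrable_inner hdiv.memLp hB).const_mul 2
    have i3 : Integrable (fun x => ‖B x‖ ^ 2) m.meas := hB.integrable_norm_pow (by norm_num)
    have i4 : Integrable (fun x => ‖η x - B x‖ ^ 2 + 2 * inner ℝ (η x - B x) (B x)) m.meas :=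
      i1.add i2
    simp only [e]
    rw [integral_add i4 i3, integral_add i1 i2, integral_const_mul, h0]
    ring
  rw [h1]
  have : 0 ≤ ∫ x, ‖η x - B x‖ ^ 2 ∂m.meas := integral_nonneg fun _ => by positivity
  linarith

/-! ### Gradients orthogonal to divergence free fields -/

/-- Orthogonality passes to bounded pointwise limits of test gradients by dominated convergence; `h`
is integrable because `m` is finite. -/
lemma IsDivFree.tendsto_integral {m : P2 d} {h : E d → E d} (hh : IsDivFree m h)
    {φ : ℕ → E d → ℝ} (hφ : ∀ n, IsTest (φ n)) {g : E d → E d} {C : ℝ}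
    (hC : ∀ n x, ‖gradient (φ n) x‖ ≤ C)
    (hlim : ∀ x, Tendsto (fun n => gradient (φ n) x) atTop (𝓝 (g x))) :
    ∫ x, inner ℝ (h x) (g x) ∂m.meas = 0 := by
  have h1 : Integrable h m.meas := hh.memLp.integrable (by norm_num)
  have h2 : Tendsto (fun n => ∫ x, inner ℝ (h x) (gradient (φ n) x) ∂m.meas) atTop
      (𝓝 (∫ x, inner ℝ (h x) (g x) ∂m.meas)) := by
    refine tendsto_integral_of_dominated_convergence (fun x => ‖h x‖ * C)
      (fun n => hh.memLp.1.inner (hφ n).contDiff_gradient.continuous.aestronglyMeasurable)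
      (h1.norm.mul_const C) (fun n => Eventually.of_forall fun x => ?_)
      (Eventually.of_forall fun x => (tendsto_const_nhds.inner (hlim x)))
    exact (norm_inner_le_norm _ _).trans (mul_le_mul_of_nonneg_left (hC n x) (norm_nonneg _))
  refine tendsto_nhds_unique h2 ?_
  simp only [hh.integral_eq_zero _ (hφ _)]
  exact tendsto_const_nhds

/-- The gradient of a smooth function with bounded gradient is orthogonal to divergence free
fields. -/
theorem IsDivFree.integral_gradient_eq_zero {m : P2 d} {h : E d → E d} (hh : IsDivFree m h)
    {u : E d → ℝ} (hu : ContDiff ℝ (⊤ : ℕ∞) u) {C : ℝ} (hC : ∀ x, ‖fderiv ℝ u x‖ ≤ C) :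
    ∫ x, inner ℝ (h x) (gradient u x) ∂m.meas = 0 := by
  let χ : ContDiffBump (0 : E d) := ⟨1, 2, one_pos, one_lt_two⟩
  have hχs : ContDiff ℝ (⊤ : ℕ∞) χ := χ.contDiff
  obtain ⟨Cχ, hCχ⟩ := (χ.hasCompactSupport.fderiv ℝ).exists_bound_of_continuous
    (hχs.continuous_fderiv (by simp))
  have hC0 : 0 ≤ C := (norm_nonneg _).trans (hC 0)
  have hCχ0 : 0 ≤ Cχ := (norm_nonneg _).trans (hCχ 0)
  have hud : Differentiable ℝ u := hu.differentiable (by simp)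
  have hχd : Differentiable ℝ χ := hχs.differentiable (by simp)
  have hgrow : ∀ x, |u x| ≤ |u 0| + C * ‖x‖ := by
    intro x
    have := convex_univ.norm_image_sub_le_of_norm_fderiv_le (𝕜 := ℝ) (f := u)
      (fun y _ => hud y) (fun y _ => hC y) (Set.mem_univ 0) (Set.mem_univ x)
    rw [sub_zero, Real.norm_eq_abs] at this
    have h2 := abs_sub_abs_le_abs_sub (u x) (u 0)
    linarith
  let R : ℕ → ℝ := fun n => n + 1
  have hR : ∀ n, 1 ≤ R n := fun n => by simp [R]
  -- Cut-off at scale `R n`. The gradient gains the term `u ∇χ(x/R)/R`. It stays bounded because `u`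
  -- grows at most linearly.
  let φ : ℕ → E d → ℝ := fun n x => χ ((R n)⁻¹ • x) * u x
  have hscale : ∀ n, ContDiff ℝ (⊤ : ℕ∞) fun x : E d => χ ((R n)⁻¹ • x) :=
    fun n => hχs.comp (contDiff_id.const_smul _)
  have hφ : ∀ n, IsTest (φ n) := fun n =>
    ⟨(hscale n).mul hu, (χ.hasCompactSupport.comp_smul
      (inv_ne_zero (by linarith [hR n] : R n ≠ 0))).mul_right⟩
  have hfd : ∀ n x, HasFDerivAt (φ n) (χ ((R n)⁻¹ • x) • fderiv ℝ u x +
      u x • ((R n)⁻¹ • fderiv ℝ χ ((R n)⁻¹ • x))) x := by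
    intro n x
    have h1 : HasFDerivAt (fun x : E d => χ ((R n)⁻¹ • x))
        ((R n)⁻¹ • fderiv ℝ χ ((R n)⁻¹ • x)) x := by
      have := (hχd ((R n)⁻¹ • x)).hasFDerivAt.comp x
        (((R n)⁻¹ • ContinuousLinearMap.id ℝ (E d)).hasFDerivAt)
      refine this.congr_fderiv ?_
      ext v
      simp
    exact h1.mul (hud x).hasFDerivAt
  -- `C` bounds `χ ∇u`. On the support of the cut-off `‖x‖ ≤ 2R`, so `|u| / R ≤ |u 0| + 2C`, and
  -- this multiplies the bound `Cχ` of `∇χ`.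
  refine hh.tendsto_integral hφ (C := C + (|u 0| + 2 * C) * Cχ) ?_ ?_
  · intro n x
    rw [norm_gradient, (hfd n x).fderiv]
    have hRp : 0 < R n := one_pos.trans_le (hR n)
    refine (norm_add_le _ _).trans (add_le_add ?_ ?_)
    · rw [norm_smul, Real.norm_of_nonneg χ.nonneg]
      exact (mul_le_of_le_one_left (norm_nonneg _) χ.le_one).trans (hC x)
    · rw [norm_smul, norm_smul, Real.norm_eq_abs, Real.norm_of_nonneg (by positivity)]
      rcases le_or_gt ‖x‖ (2 * R n) with hx | hx
      · rw [← mul_assoc]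
        refine mul_le_mul ?_ (hCχ _) (norm_nonneg _) (by positivity)
        rw [← div_eq_mul_inv, div_le_iff₀ hRp]
        have h1 := mul_le_mul_of_nonneg_left hx hC0
        have h2 := mul_le_mul_of_nonneg_left (hR n) (abs_nonneg (u 0))
        linarith [hgrow x]
      · have h0 : fderiv ℝ χ ((R n)⁻¹ • x) = 0 := by
          refine image_eq_zero_of_notMem_tsupport fun hmem => ?_
          have h1 := tsupport_fderiv_subset ℝ hmem
          rw [χ.tsupport_eq, mem_closedBall_zero_iff, norm_smul,
            Real.norm_of_nonneg (by positivity), inv_mul_le_iff₀ hRp] at h1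
          have h2 : ‖x‖ ≤ R n * 2 := h1
          linarith
        rw [h0, norm_zero, mul_zero, mul_zero]
        positivity
  · intro x
    -- At a fixed `x` the sequence is eventually constant: once `R n > ‖x‖`, the cut-off is 1 near
    -- `x`.
    refine tendsto_const_nhds.congr' ?_
    obtain ⟨N, hN⟩ := exists_nat_gt ‖x‖
    filter_upwards [eventually_ge_atTop N] with n hn
    have hRp : 0 < R n := one_pos.trans_le (hR n)
    have hx : ‖x‖ < R n := hN.trans (by simp only [R]; exact_mod_cast Nat.lt_succ_of_le hn)
    have h1 : φ n =ᶠ[𝓝 x] u := by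
      have h2 : ∀ᶠ y in 𝓝 x, ‖y‖ < R n := (continuous_norm.tendsto x).eventually_lt_const hx
      filter_upwards [h2] with y hy
      have h3 : χ ((R n)⁻¹ • y) = 1 := by
        refine χ.one_of_mem_closedBall ?_
        rw [mem_closedBall_zero_iff, norm_smul, Real.norm_of_nonneg (by positivity),
          inv_mul_le_iff₀ hRp]
        have : ‖y‖ ≤ R n * 1 := by linarith
        exact this
      simp only [φ, h3, one_mul]
    simp only [gradient]
    rw [h1.fderiv_eq]

/-- The gradient of a compactly supported function of class `C¹` is orthogonal to divergence free
fields. -/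
theorem IsDivFree.integral_gradient_eq_zero_of_contDiff_one {m : P2 d} {h : E d → E d}
    (hh : IsDivFree m h) {f : E d → ℝ} (hf : ContDiff ℝ 1 f) (hfc : HasCompactSupport f) :
    ∫ x, inner ℝ (h x) (gradient f x) ∂m.meas = 0 := by
  -- Mollification: the derivative of the convolution is the convolution of `fderiv ℝ f`, which is
  -- uniformly continuous, so the gradients converge uniformly.
  let ρ : ℕ → ContDiffBump (0 : E d) := fun n =>
    ⟨1 / (2 * ((n : ℝ) + 1)), 1 / ((n : ℝ) + 1), by positivity, by
      apply one_div_lt_one_div_of_lt (by positivity); linarith [(Nat.cast_nonneg n : (0:ℝ) ≤ n)]⟩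
  let φ : ℕ → E d → ℝ := fun n =>
    convolution ((ρ n).normed volume) f (ContinuousLinearMap.lsmul ℝ ℝ) volume
  have hρc : ∀ n, HasCompactSupport ((ρ n).normed (volume : Measure (E d))) :=
    fun n => (ρ n).hasCompactSupport_normed
  have hρi : ∀ n, LocallyIntegrable ((ρ n).normed (volume : Measure (E d))) volume :=
    fun n => (ρ n).continuous_normed.locallyIntegrable
  have hφ : ∀ n, IsTest (φ n) := fun n =>
    ⟨(hρc n).contDiff_convolution_left _ (ρ n).contDiff_normed hf.continuous.locallyIntegrable,
      (hρc n).convolution _ hfc⟩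
  have hf'c : Continuous (fderiv ℝ f) := hf.continuous_fderiv (by simp)
  have hf's : HasCompactSupport (fderiv ℝ f) := hfc.fderiv ℝ
  have hfd : ∀ n x, fderiv ℝ (φ n) x =
      convolution ((ρ n).normed volume) (fderiv ℝ f) (ContinuousLinearMap.lsmul ℝ ℝ) volume x := by
    intro n x
    rw [(hfc.hasFDerivAt_convolution_right (ContinuousLinearMap.lsmul ℝ ℝ) (hρi n) hf x).fderiv]
    rfl
  have hbound : ∀ ε > 0, ∃ N, ∀ n ≥ N, ∀ x, dist (fderiv ℝ (φ n) x) (fderiv ℝ f x) ≤ ε := by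
    intro ε hε
    have huc : UniformContinuous (fderiv ℝ f) := hf's.uniformContinuous_of_continuous hf'c
    obtain ⟨η, hη, hη'⟩ := Metric.uniformContinuous_iff.1 huc ε hε
    obtain ⟨N, hN⟩ := exists_nat_one_div_lt hη
    refine ⟨N, fun n hn x => ?_⟩
    rw [hfd]
    refine ContDiffBump.dist_normed_convolution_le hf'c.aestronglyMeasurable fun y hy => ?_
    refine (hη' ((Metric.mem_ball.1 hy).trans_le ?_)).le
    refine le_trans ?_ hN.le
    exact one_div_le_one_div_of_le (by positivity) (by
      have : (N : ℝ) ≤ n := by exact_mod_cast hn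
      linarith)
  obtain ⟨Cf, hCf⟩ := hf's.exists_bound_of_continuous hf'c
  obtain ⟨N, hN⟩ := hbound 1 one_pos
  -- Shifting the index by `N` makes the bound `Cf + 1` valid from the first term on.
  refine hh.tendsto_integral (φ := fun n => φ (n + N)) (fun n => hφ _) (C := Cf + 1) ?_ ?_
  · intro n x
    rw [norm_gradient]
    have h1 := hN (n + N) (Nat.le_add_left _ _) x
    rw [dist_eq_norm] at h1
    have h2 := norm_sub_norm_le (fderiv ℝ (φ (n + N)) x) (fderiv ℝ f x)
    linarith [hCf x]
  · intro x
    have h1 : Tendsto (fun n => fderiv ℝ (φ (n + N)) x) atTop (𝓝 (fderiv ℝ f x)) := by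
      rw [Metric.tendsto_atTop]
      intro ε hε
      obtain ⟨M, hM⟩ := hbound (ε / 2) (by positivity)
      exact ⟨M, fun n hn => (hM (n + N) (hn.trans (Nat.le_add_right _ _)) x).trans_lt
        (by linarith)⟩
    exact ((InnerProductSpace.toDual ℝ (E d)).symm.continuous.tendsto _).comp h1

/-! ### Quantitative first and second order expansions -/

lemma continuous_of_norm_sub_le {X G : Type*} [SeminormedAddCommGroup X]
    [NormedAddCommGroup G] {f : X → G} {K : ℝ}
    (h : ∀ x y, ‖f y - f x‖ ≤ K * ‖y - x‖) : Continuous f := by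
  refine (LipschitzWith.of_dist_le_mul (K := K.toNNReal) fun x y => ?_).continuous
  rw [dist_eq_norm, dist_eq_norm]
  exact (h y x).trans (mul_le_mul_of_nonneg_right (Real.le_coe_toNNReal K) (norm_nonneg _))

section Expansions

variable {G : Type*} [NormedAddCommGroup G] [NormedSpace ℝ G]

/-- `U` is bounded, and `A` is a bounded Lipschitz field of gradients of `U`, with a quadratic
error in the first order expansion. All constants are controlled by `K`. -/
structure FirstOrder (K : ℝ) (U : P2 d → G) (A : P2 d → E d → Fin d → G) : Prop where
  bound : ∀ m, ‖U m‖ ≤ K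
  grad_bound : ∀ m x i, ‖A m x i‖ ≤ K
  grad_lip : ∀ m ν x y i, ‖A ν y i - A m x i‖ ≤ K * (‖y - x‖ + W2 m ν)
  expand : ∀ m ν, ∀ γ ∈ optimalCouplings m ν,
    ‖U ν - U m - ∫ p, ∑ i, (p.2 - p.1) i • A m p.1 i ∂γ‖ ≤ K * W2 m ν ^ 2
  orth : ∀ m h, IsDivFree m h → ∫ x, ∑ i, h x i • A m x i ∂m.meas = 0

/-- `A` has bounded Lipschitz derivatives `A1` in space and `A2` in measure, with a quadratic error
in the first order expansion. All constants are controlled by `K`. -/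
structure SecondOrder (K : ℝ) (A : P2 d → E d → Fin d → G)
    (A1 : P2 d → E d → Matrix (Fin d) (Fin d) G) (A2 : P2 d → E d → E d → Matrix (Fin d) (Fin d) G) :
    Prop where
  bound₁ : ∀ m x i j, ‖A1 m x i j‖ ≤ K
  bound₂ : ∀ m x y i j, ‖A2 m x y i j‖ ≤ K
  lip₁ : ∀ m ν x y i j, ‖A1 ν y i j - A1 m x i j‖ ≤ K * (‖y - x‖ + W2 m ν)
  lip₂ : ∀ m ν x x' y y' i j,
    ‖A2 ν y y' i j - A2 m x x' i j‖ ≤ K * (‖y - x‖ + ‖y' - x'‖ + W2 m ν)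
  expand : ∀ m ν, ∀ γ ∈ optimalCouplings m ν, ∀ x y i,
    ‖A ν y i - A m x i - ∑ j, (y - x) j • A1 m x i j -
      ∫ p, ∑ j, (p.2 - p.1) j • A2 m x p.1 i j ∂γ‖ ≤ K * (‖y - x‖ ^ 2 + W2 m ν ^ 2)
  orth : ∀ m x i h, IsDivFree m h → ∫ y, ∑ j, h y j • A2 m x y i j ∂m.meas = 0

variable {K : ℝ} {U : P2 d → G} {A : P2 d → E d → Fin d → G}
  {A1 : P2 d → E d → Matrix (Fin d) (Fin d) G} {A2 : P2 d → E d → E d → Matrix (Fin d) (Fin d) G}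

lemma FirstOrder.continuous (h : FirstOrder K U A) (m : P2 d) (i : Fin d) :
    Continuous fun x => A m x i :=
  continuous_of_norm_sub_le (K := K) fun x y => by simpa [W2_self] using h.grad_lip m m x y i

lemma SecondOrder.continuous₁ (h : SecondOrder K A A1 A2) (m : P2 d) (i j : Fin d) :
    Continuous fun x => A1 m x i j :=
  continuous_of_norm_sub_le (K := K) fun x y => by simpa [W2_self] using h.lip₁ m m x y i j

/-- An index `i` is required: for `d = 0` every bound is vacuous and `K` may be negative. This is
why `|K|` or `|K'|` stands in several later constants. -/
lemma SecondOrder.nonneg (h : SecondOrder K A A1 A2) (m : P2 d) (i : Fin d) : 0 ≤ K :=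
  (norm_nonneg _).trans (h.bound₁ m 0 i i)

lemma SecondOrder.continuous₂ (h : SecondOrder K A A1 A2) (m : P2 d) (i j : Fin d) :
    Continuous fun p : E d × E d => A2 m p.1 p.2 i j :=
  continuous_of_norm_sub_le (K := K * 2) fun p q => by
    refine (h.lip₂ m m p.1 p.2 q.1 q.2 i j).trans ?_
    rw [W2_self, mul_assoc]
    refine mul_le_mul_of_nonneg_left ?_ (h.nonneg m i)
    have h1 : ‖q.1 - p.1‖ ≤ ‖q - p‖ := norm_fst_le (q - p)
    have h2 : ‖q.2 - p.2‖ ≤ ‖q - p‖ := norm_snd_le (q - p)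
    linarith

end Expansions

/-! ### Vectors and matrices given by their entries -/

lemma inner_toLp (v : E d) (a : Fin d → ℝ) :
    inner ℝ v (WithLp.toLp 2 a) = ∑ i, v i • a i := by
  simp [PiLp.inner_apply, mul_comm]

lemma toEuclideanLin_apply_apply (M : Matrix (Fin d) (Fin d) ℝ) (v : E d) (i : Fin d) :
    (Matrix.toEuclideanLin M v) i = ∑ j, v j • M i j := by
  simp [Matrix.toLpLin_apply, Matrix.mulVec, dotProduct, mul_comm]

lemma norm_le_mul_of_forall_abs_le {v : E d} {C : ℝ} (h : ∀ i, |v i| ≤ C) : ‖v‖ ≤ d * C := by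
  have h1 : ‖v‖ ≤ ∑ i, |v i| := by
    rw [EuclideanSpace.norm_eq]
    refine Real.sqrt_le_iff.2 ⟨Finset.sum_nonneg fun i _ => abs_nonneg _, ?_⟩
    simp only [Real.norm_eq_abs]
    exact Finset.sum_sq_le_sq_sum_of_nonneg fun i _ => abs_nonneg _
  refine h1.trans ((Finset.sum_le_sum fun i _ => h i).trans_eq ?_)
  simp

lemma norm_toEuclideanLin_le {M : Matrix (Fin d) (Fin d) ℝ} {K : ℝ} (h : ∀ i j, |M i j| ≤ K)
    (v : E d) : ‖Matrix.toEuclideanLin M v‖ ≤ d * (d * K) * ‖v‖ := by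
  rw [mul_assoc]
  refine norm_le_mul_of_forall_abs_le fun i => ?_
  rw [toEuclideanLin_apply_apply]
  refine (Finset.abs_sum_le_sum_abs _ _).trans ?_
  calc ∑ j, |v j • M i j| ≤ ∑ _j : Fin d, ‖v‖ * K := by
        refine Finset.sum_le_sum fun j _ => ?_
        rw [smul_eq_mul, abs_mul]
        exact mul_le_mul (PiLp.norm_apply_le v j) (h i j) (abs_nonneg _) (norm_nonneg _)
    _ = _ := by simp; ring

lemma continuous_toLp {X : Type*} [TopologicalSpace X] {f : X → Fin d → ℝ}
    (h : ∀ i, Continuous fun x => f x i) : Continuous fun x => (WithLp.toLp 2 (f x) : E d) :=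
  (PiLp.continuous_toLp 2 _).comp (continuous_pi h)

lemma continuous_toEuclideanLin {X : Type*} [TopologicalSpace X]
    {M : X → Matrix (Fin d) (Fin d) ℝ} {v : X → E d} (hM : ∀ i j, Continuous fun x => M x i j)
    (hv : Continuous v) : Continuous fun x => Matrix.toEuclideanLin (M x) (v x) := by
  simp only [Matrix.toLpLin_apply]
  refine continuous_toLp fun i => ?_
  simp only [Matrix.mulVec, dotProduct]
  exact continuous_finsetSum _ fun j _ => (hM i j).mul (by fun_prop)

/-! ### Consequences of real expansions -/

section Real

variable {K : ℝ} {U : P2 d → ℝ} {A : P2 d → E d → Fin d → ℝ}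
  {A1 : P2 d → E d → Matrix (Fin d) (Fin d) ℝ} {A2 : P2 d → E d → E d → Matrix (Fin d) (Fin d) ℝ}

lemma FirstOrder.continuous_vec (h : FirstOrder K U A) (m : P2 d) :
    Continuous fun x => (WithLp.toLp 2 (A m x) : E d) :=
  continuous_toLp fun i => h.continuous m i

lemma FirstOrder.norm_vec_le (h : FirstOrder K U A) (m : P2 d) (x : E d) :
    ‖(WithLp.toLp 2 (A m x) : E d)‖ ≤ d * K :=
  norm_le_mul_of_forall_abs_le fun i => h.grad_bound m x i

lemma FirstOrder.norm_vec_sub_le (h : FirstOrder K U A) (m ν : P2 d) (x y : E d) :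
    ‖(WithLp.toLp 2 (A ν y) : E d) - WithLp.toLp 2 (A m x)‖ ≤
      d * (K * (‖y - x‖ + W2 m ν)) :=
  norm_le_mul_of_forall_abs_le fun i => h.grad_lip m ν x y i

lemma FirstOrder.isWGradient (h : FirstOrder K U A) (m : P2 d) :
    IsWGradient U m fun x => WithLp.toLp 2 (A m x) := by
  refine isWGradient_of_expansion (K := K) ?_ ?_ ?_
  · exact MemLp.of_bound (h.continuous_vec m).aestronglyMeasurable _
      (Eventually.of_forall (h.norm_vec_le m))
  · intro ν γ hγ
    have := h.expand m ν γ hγ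
    simp only [← inner_toLp] at this
    simpa only [real_inner_comm, Real.norm_eq_abs] using this
  · intro η hη
    simpa only [inner_toLp] using h.orth m η hη

lemma jointlyContinuous_of_norm_sub_le {X Y : Type*} [PseudoMetricSpace X]
    [SeminormedAddCommGroup Y] {f : P2 d → X → Y} {C : ℝ} 
    (h : ∀ m ν x y, ‖f ν y - f m x‖ ≤ C * (dist y x + W2 m ν)) : JointlyContinuous f := by
  intro m x ε hε
  refine ⟨ε / (2 * (|C| + 1)), by positivity, fun ν y h1 h2 => ?_⟩
  rw [dist_eq_norm]
  refine (h m ν x y).trans_lt ?_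
  rw [lt_div_iff₀ (by positivity)] at h1 h2
  have h3 : 0 ≤ dist y x + W2 m ν := add_nonneg dist_nonneg (W2_nonneg _ _)
  have h4 : C ≤ |C| + 1 := (le_abs_self C).trans (by linarith)
  have h5 := mul_le_mul_of_nonneg_right h4 h3
  nlinarith

theorem FirstOrder.hasContinuousGradient (h : FirstOrder K U A) :
    HasContinuousGradient U fun m x => WithLp.toLp 2 (A m x) := by
  refine ⟨h.isWGradient, jointlyContinuous_of_norm_sub_le (C := d * K) fun m ν x y => ?_⟩
  rw [dist_eq_norm, mul_assoc]
  exact h.norm_vec_sub_le m ν x y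

lemma isConcaveModulus_mul {C : ℝ} (hC : 0 ≤ C) : IsConcaveModulus fun t => C * t where
  continuousOn := (continuous_const.mul continuous_id).continuousOn
  monotoneOn := fun _ _ _ _ h => mul_le_mul_of_nonneg_left h hC
  subadditive := fun s t _ _ => (mul_add C s t).le
  map_zero := mul_zero C
  concaveOn := ((LinearMap.mul ℝ ℝ C).concaveOn (convex_Ici 0))

lemma SecondOrder.norm_mat₁_le (h : SecondOrder K A A1 A2) (m : P2 d) (x v : E d) :
    ‖Matrix.toEuclideanLin (A1 m x) v‖ ≤ d * (d * K) * ‖v‖ :=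
  norm_toEuclideanLin_le (fun i j => h.bound₁ m x i j) v

lemma SecondOrder.norm_mat₂_le (h : SecondOrder K A A1 A2) (m : P2 d) (x y v : E d) :
    ‖Matrix.toEuclideanLin (A2 m x y) v‖ ≤ d * (d * K) * ‖v‖ :=
  norm_toEuclideanLin_le (fun i j => h.bound₂ m x y i j) v

lemma SecondOrder.continuous_mat₂ (h : SecondOrder K A A1 A2) (m : P2 d) :
    Continuous fun q : (E d × E d) × E d => Matrix.toEuclideanLin (A2 m q.1.1 q.1.2) q.2 :=
  continuous_toEuclideanLin (fun i j => (h.continuous₂ m i j).comp continuous_fst) continuous_snd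

lemma SecondOrder.integrable_mat₂ (h : SecondOrder K A A1 A2) {m ν : P2 d}
    {γ : Measure (E d × E d)} (hγ : γ ∈ couplings m ν) (x : E d) :
    Integrable (fun p => Matrix.toEuclideanLin (A2 m x p.1) (p.2 - p.1)) γ := by
  refine ((integrable_norm_sub hγ).const_mul (d * (d * K))).mono'
    (((h.continuous_mat₂ m).comp (by fun_prop : Continuous fun p : E d × E d =>
      ((x, p.1), p.2 - p.1))).aestronglyMeasurable)
    (Eventually.of_forall fun p => h.norm_mat₂_le m x p.1 _)

lemma SecondOrder.norm_expansion_le (h : SecondOrder K A A1 A2) {m ν : P2 d}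
    {γ : Measure (E d × E d)} (hγ : γ ∈ optimalCouplings m ν) (x y : E d) :
    ‖(WithLp.toLp 2 (A ν y) : E d) - WithLp.toLp 2 (A m x) -
      expansion (A1 m) (A2 m) γ x y‖ ≤ d * (K * (‖y - x‖ ^ 2 + W2 m ν ^ 2)) := by
  refine norm_le_mul_of_forall_abs_le fun i => ?_
  refine le_of_eq_of_le (congrArg _ ?_) (h.expand m ν γ hγ x y i)
  have hint : ∀ j, Integrable
      (fun p => (Matrix.toEuclideanLin (A2 m x p.1) (p.2 - p.1)) j) γ := fun j =>
    (EuclideanSpace.proj (𝕜 := ℝ) j : E d →L[ℝ] ℝ).integrable_comp (h.integrable_mat₂ hγ.1 x)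
  simp only [expansion, PiLp.sub_apply, PiLp.add_apply]
  rw [eval_integral_piLp hint]
  simp only [toEuclideanLin_apply_apply, PiLp.sub_apply]
  ring

lemma SecondOrder.isTwiceWDifferentiableAt (h : FirstOrder K U A)
    {K' : ℝ} (h' : SecondOrder K' A A1 A2) (m : P2 d) :
    IsTwiceWDifferentiableAt U m (fun m x => WithLp.toLp 2 (A m x)) (A1 m) (A2 m) where
  gradient := ⟨1, one_pos, d * K, fun ν _ => ⟨h.isWGradient ν, h.continuous_vec ν, fun x => by
    have hK : 0 ≤ K := (norm_nonneg _).trans (h.bound m)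
    refine (h.norm_vec_le ν x).trans (le_mul_of_one_le_right (by positivity) ?_)
    linarith [norm_nonneg x]⟩⟩
  measurable₁ i j := (h'.continuous₁ m i j).measurable
  measurable₂ i j := (h'.continuous₂ m i j).measurable
  bounded₁ := ⟨K', fun x i j => h'.bound₁ m x i j⟩
  bounded₂ := ⟨K', fun x y i j => h'.bound₂ m x y i j⟩
  tangent x i := by
    have hc : Continuous fun y => (WithLp.toLp 2 (A2 m x y i) : E d) :=
      continuous_toLp fun j => (h'.continuous₂ m i j).comp (by fun_prop : Continuous fun y => (x, y))
    refine memTangent_of_orthogonal (MemLp.of_bound hc.aestronglyMeasurable (d * K')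
      (Eventually.of_forall fun y => norm_le_mul_of_forall_abs_le fun j => h'.bound₂ m x y i j))
      fun η hη => ?_
    simpa only [inner_toLp] using h'.orth m x i η hη
  expand := by
    -- A quadratic error `d * K' * (r² + W²)` has the required form `r ρ(r) + W ε₂(W)` with linear
    -- `ρ` and `ε₂`.
    refine ⟨fun t => d * |K'| * t, fun t => d * |K'| * t, isConcaveModulus_mul (by positivity),
      fun t ht => by positivity, ?_, fun ν γ hγ x y => ?_⟩
    · have : Tendsto (fun t : ℝ => d * |K'| * t) (𝓝 0) (𝓝 (d * |K'| * 0)) :=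
        (continuous_const.mul continuous_id).tendsto 0
      rw [mul_zero] at this
      exact this.mono_left nhdsWithin_le_nhds
    · refine (h'.norm_expansion_le hγ x y).trans ?_
      rw [norm_sub_rev y x]
      have h1 : K' * (‖x - y‖ ^ 2 + W2 m ν ^ 2) ≤ |K'| * (‖x - y‖ ^ 2 + W2 m ν ^ 2) :=
        mul_le_mul_of_nonneg_right (le_abs_self _) (by positivity)
      have h2 := mul_le_mul_of_nonneg_left h1 (Nat.cast_nonneg (α := ℝ) d)
      linarith

/-- With `ν = m` and the diagonal plan the displacement vanishes, so the measure term and `W2` drop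
out; a quadratic remainder in `y - x` is left. -/
lemma SecondOrder.hasFDerivAt (h : SecondOrder K A A1 A2) (m : P2 d) (x : E d) :
    HasFDerivAt (fun x => (WithLp.toLp 2 (A m x) : E d))
      (LinearMap.toContinuousLinearMap (Matrix.toEuclideanLin (A1 m x))) x := by
  set T := LinearMap.toContinuousLinearMap (Matrix.toEuclideanLin (A1 m x))
  have h0 : ∀ y, ‖(WithLp.toLp 2 (A m y) : E d) - WithLp.toLp 2 (A m x) - T (y - x)‖ ≤
      d * K * ‖y - x‖ ^ 2 := by
    intro y
    have h1 := h.norm_expansion_le (diag_mem_optimalCouplings m) x y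
    have h2 : expansion (A1 m) (A2 m) (m.meas.map fun x => (x, x)) x y = T (y - x) := by
      have h3 := h.integrable_mat₂ (diag_mem_optimalCouplings m).1 x
      rw [expansion, integral_map (by fun_prop) h3.1]
      simp [T]
    rw [h2, W2_self] at h1
    calc _ ≤ _ := h1
      _ = _ := by ring
  have h1 : HasFDerivAt (𝕜 := ℝ) (fun y : E d => ((WithLp.toLp 2 (A m y) : E d) -
      WithLp.toLp 2 (A m x) - T (y - x) : E d)) 0 x := by
    refine Asymptotics.IsBigO.hasFDerivAt (n := 2) ?_ one_lt_two
    refine Asymptotics.IsBigO.of_bound (d * K) (Eventually.of_forall fun y => ?_)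
    rw [Real.norm_of_nonneg (by positivity)]
    exact h0 y
  have h2 : HasFDerivAt (fun y => T (y - x)) T x := by
    exact T.hasFDerivAt.comp x ((hasFDerivAt_id x).sub_const x)
  have h3 := (h1.add h2).add_const (WithLp.toLp 2 (A m x) : E d)
  rw [zero_add] at h3
  refine h3.congr_of_eventuallyEq (Eventually.of_forall fun y => ?_)
  simp

theorem SecondOrder.hasContinuousHessian (h : FirstOrder K U A)
    {K' : ℝ} (h' : SecondOrder K' A A1 A2) :
    HasContinuousHessian U (fun m x => WithLp.toLp 2 (A m x)) A1 A2 where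
  twice := SecondOrder.isTwiceWDifferentiableAt h h'
  jacobian := h'.hasFDerivAt
  continuous₁ i j := jointlyContinuous_of_norm_sub_le (C := K') fun m ν x y => by
    rw [dist_eq_norm]; exact h'.lip₁ m ν x y i j
  continuous₂ i j := jointlyContinuous_of_norm_sub_le (C := K' * 2) fun m ν x y => by
    refine (h'.lip₂ m ν x.1 x.2 y.1 y.2 i j).trans ?_
    rw [mul_assoc, dist_eq_norm]
    refine mul_le_mul_of_nonneg_left ?_ (h'.nonneg m i)
    have h1 : ‖y.1 - x.1‖ ≤ ‖y - x‖ := norm_fst_le (y - x)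
    have h2 : ‖y.2 - x.2‖ ≤ ‖y - x‖ := norm_snd_le (y - x)
    linarith [W2_nonneg m ν]

end Real

/-! ### The Hessian and the Laplacian -/

/-- The `ε`-Laplacian, in terms of the spatial and the measure derivative of the gradient. -/
def lap {G : Type*} [NormedAddCommGroup G] [NormedSpace ℝ G] (ε : ℝ)
    (A1 : P2 d → E d → Matrix (Fin d) (Fin d) G)
    (A2 : P2 d → E d → E d → Matrix (Fin d) (Fin d) G) (m : P2 d) : G :=
  ∑ i, (∫ x, A1 m x i i ∂m.meas + ∫ q : E d × E d, A2 m q.1 q.2 i i ∂(m.meas.prod m.meas) +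
    ε • ∫ x, A1 m x i i ∂m.meas)

/-- The Hessian form, in terms of the spatial and the measure derivative of the gradient. -/
def hessForm (A1 : P2 d → E d → Matrix (Fin d) (Fin d) ℝ)
    (A2 : P2 d → E d → E d → Matrix (Fin d) (Fin d) ℝ) (m : P2 d) (ζ η : E d → E d) : ℝ :=
  ∫ x, inner ℝ (Matrix.toEuclideanLin (A1 m x) (ζ x)) (η x) ∂m.meas +
    ∫ q : E d × E d, inner ℝ (Matrix.toEuclideanLin (A2 m q.1 q.2) (ζ q.2)) (η q.1)
      ∂(m.meas.prod m.meas)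

/-- The part of the gradient of `ν ↦ ∫ ⟨A ν, ζ⟩ dν` that comes from the dependence of `A ν`
on `ν`. -/
def measureGrad (A2 : P2 d → E d → E d → Matrix (Fin d) (Fin d) ℝ) (m : P2 d) (ζ : E d → E d)
    (x : E d) : E d :=
  ∫ z, Matrix.toEuclideanLin (A2 m z x)ᵀ (ζ z) ∂m.meas

/-- The gradient of `ν ↦ ∫ ⟨A ν, ζ⟩ dν`. -/
def lieGrad (A : P2 d → E d → Fin d → ℝ) (A2 : P2 d → E d → E d → Matrix (Fin d) (Fin d) ℝ)
    (m : P2 d) (ζ : E d → E d) (x : E d) : E d :=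
  gradient (fun x => inner ℝ (WithLp.toLp 2 (A m x) : E d) (ζ x)) x + measureGrad A2 m ζ x

lemma inner_toEuclideanLin_transpose (M : Matrix (Fin d) (Fin d) ℝ) (v w : E d) :
    inner ℝ (Matrix.toEuclideanLin Mᵀ v) w = inner ℝ v (Matrix.toEuclideanLin M w) := by
  simp only [PiLp.inner_apply, toEuclideanLin_apply_apply, Matrix.transpose_apply, smul_eq_mul,
    RCLike.inner_apply, conj_trivial, Finset.mul_sum, Finset.sum_mul]
  rw [Finset.sum_comm]
  exact Finset.sum_congr rfl fun i _ => Finset.sum_congr rfl fun j _ => by ring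

lemma aestronglyMeasurable_toEuclideanLin {Ω : Type*} [MeasurableSpace Ω] {μ : Measure Ω}
    {M : Ω → Matrix (Fin d) (Fin d) ℝ} {v : Ω → E d}
    (hM : ∀ i j, AEStronglyMeasurable (fun ω => M ω i j) μ) (hv : AEStronglyMeasurable v μ) :
    AEStronglyMeasurable (fun ω => Matrix.toEuclideanLin (M ω) (v ω)) μ := by
  have h1 : ∀ i, AEMeasurable (fun ω => ∑ j, v ω j • M ω i j) μ := fun i =>
    Finset.aemeasurable_fun_sum _ fun j _ => AEMeasurable.smul
      ((EuclideanSpace.proj (𝕜 := ℝ) j : E d →L[ℝ] ℝ).measurable.comp_aemeasurable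
        hv.aemeasurable) (hM i j).aemeasurable
  have h2 : (fun ω => Matrix.toEuclideanLin (M ω) (v ω)) =
      fun ω => (WithLp.toLp 2 fun i => ∑ j, v ω j • M ω i j : E d) := by
    ext ω i
    exact toEuclideanLin_apply_apply _ _ _
  rw [h2]
  exact ((PiLp.continuous_toLp 2 fun _ : Fin d => ℝ).measurable.comp_aemeasurable
    (aemeasurable_pi_lambda _ h1)).aestronglyMeasurable

section Real

variable {K K' : ℝ} {U : P2 d → ℝ} {A : P2 d → E d → Fin d → ℝ}
  {A1 : P2 d → E d → Matrix (Fin d) (Fin d) ℝ} {A2 : P2 d → E d → E d → Matrix (Fin d) (Fin d) ℝ}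

lemma SecondOrder.integrable_transpose (h : SecondOrder K A A1 A2) (m : P2 d) {ζ : E d → E d}
    (hζ : MemLp ζ 2 m.meas) (x : E d) :
    Integrable (fun z => Matrix.toEuclideanLin (A2 m z x)ᵀ (ζ z)) m.meas := by
  refine (((hζ.integrable (by norm_num)).norm).const_mul (d * (d * K))).mono' ?_
    (Eventually.of_forall fun z => norm_toEuclideanLin_le (fun i j => h.bound₂ m z x j i) _)
  exact aestronglyMeasurable_toEuclideanLin (fun i j => ((h.continuous₂ m j i).comp
    (by fun_prop : Continuous fun z => (z, x))).aestronglyMeasurable) hζ.1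

lemma SecondOrder.inner_measureGrad (h : SecondOrder K A A1 A2) (m : P2 d) {ζ : E d → E d}
    (hζ : MemLp ζ 2 m.meas) (x v : E d) :
    inner ℝ (measureGrad A2 m ζ x) v =
      ∫ z, inner ℝ (ζ z) (Matrix.toEuclideanLin (A2 m z x) v) ∂m.meas := by
  rw [real_inner_comm, measureGrad, ← integral_inner (h.integrable_transpose m hζ x)]
  refine integral_congr_ae (Eventually.of_forall fun z => ?_)
  simp only
  rw [real_inner_comm, inner_toEuclideanLin_transpose]

/-- Integrability of the pairing of `A2` with two square integrable fields. -/
lemma SecondOrder.integrable_pairing (h : SecondOrder K A A1 A2) (m : P2 d) {ζ : E d → E d}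
    (hζ : MemLp ζ 2 m.meas) {Ω : Type*} [MeasurableSpace Ω] {μ : Measure Ω} [SFinite μ]
    {X : Ω → E d} {Y : Ω → E d} (hX : AEStronglyMeasurable X μ) (hY : Integrable Y μ) :
    Integrable (fun q : E d × Ω =>
      inner ℝ (ζ q.1) (Matrix.toEuclideanLin (A2 m q.1 (X q.2)) (Y q.2))) (m.meas.prod μ) := by
  have h1 : Integrable (fun q : E d × Ω => ‖ζ q.1‖ * ‖Y q.2‖) (m.meas.prod μ) :=
    (hζ.integrable (by norm_num)).norm.mul_prod hY.norm
  refine (h1.const_mul (d * (d * K))).mono' ?_ (Eventually.of_forall fun q => ?_)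
  · have h2 : AEStronglyMeasurable (fun q : E d × Ω =>
        Matrix.toEuclideanLin (A2 m q.1 (X q.2)) (Y q.2)) (m.meas.prod μ) :=
      aestronglyMeasurable_toEuclideanLin (fun i j =>
        (h.continuous₂ m i j).comp_aestronglyMeasurable
          (aestronglyMeasurable_id.comp_fst.prodMk hX.comp_snd)) hY.1.comp_snd
    exact hζ.1.comp_fst.inner h2
  · refine (norm_inner_le_norm _ _).trans ?_
    have := mul_le_mul_of_nonneg_left (h.norm_mat₂_le m q.1 (X q.2) (Y q.2)) (norm_nonneg (ζ q.1))
    linarith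

/-- Fubini. The auxiliary space is a coupling, with `Y` the displacement, in the expansion of the
Lie derivative; it is `m` itself in the orthogonality and in the Hessian. -/
lemma SecondOrder.integral_inner_measureGrad (h : SecondOrder K A A1 A2) (m : P2 d)
    {ζ : E d → E d} (hζ : MemLp ζ 2 m.meas) {Ω : Type*} [MeasurableSpace Ω] {μ : Measure Ω}
    [SFinite μ] {X : Ω → E d} {Y : Ω → E d} (hX : AEStronglyMeasurable X μ)
    (hY : Integrable Y μ) :
    ∫ ω, inner ℝ (measureGrad A2 m ζ (X ω)) (Y ω) ∂μ =
      ∫ q : E d × Ω, inner ℝ (ζ q.1) (Matrix.toEuclideanLin (A2 m q.1 (X q.2)) (Y q.2))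
        ∂(m.meas.prod μ) := by
  rw [integral_prod_symm _ (h.integrable_pairing m hζ hX hY)]
  exact integral_congr_ae (Eventually.of_forall fun ω => h.inner_measureGrad m hζ _ _)

lemma SecondOrder.norm_measureGrad_le (h : SecondOrder K A A1 A2) (m : P2 d) {ζ : E d → E d}
    {C : ℝ} (hC : ∀ x, ‖ζ x‖ ≤ C) (x : E d) :
    ‖measureGrad A2 m ζ x‖ ≤ d * (d * |K|) * C := by
  refine (norm_integral_le_of_norm_le_const (C := d * (d * |K|) * C)
    (Eventually.of_forall fun z => ?_)).trans (by simp)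
  refine (norm_toEuclideanLin_le (fun i j => (h.bound₂ m z x j i).trans (le_abs_self K)) _).trans ?_
  exact mul_le_mul_of_nonneg_left (hC z) (by positivity)

lemma SecondOrder.aestronglyMeasurable_measureGrad (h : SecondOrder K A A1 A2) (m : P2 d)
    {ζ : E d → E d} (hζ : Continuous ζ) (μ : Measure (E d)) :
    AEStronglyMeasurable (measureGrad A2 m ζ) μ := by
  have h1 : Continuous fun q : E d × E d => Matrix.toEuclideanLin (A2 m q.2 q.1)ᵀ (ζ q.2) :=
    continuous_toEuclideanLin (fun i j => (h.continuous₂ m j i).comp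
      (by fun_prop : Continuous fun q : E d × E d => (q.2, q.1))) (hζ.comp continuous_snd)
  exact (h1.stronglyMeasurable.integral_prod_right (ν := m.meas)).aestronglyMeasurable

/-- The measure part of the gradient of a Lie derivative is orthogonal to divergence free
fields. -/
lemma SecondOrder.integral_inner_measureGrad_eq_zero (h : SecondOrder K A A1 A2) (m : P2 d)
    {ζ : E d → E d} (hζ : MemLp ζ 2 m.meas) {η : E d → E d} (hη : IsDivFree m η) :
    ∫ x, inner ℝ (measureGrad A2 m ζ x) (η x) ∂m.meas = 0 := by
  have hY : Integrable η m.meas := hη.memLp.integrable (by norm_num)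
  have h0 := h.integral_inner_measureGrad m hζ (X := fun x => x) (Y := η)
    aestronglyMeasurable_id hY
  rw [h0, integral_prod _ (h.integrable_pairing m hζ (X := fun x => x) aestronglyMeasurable_id hY)]
  -- For fixed `z` the integral in `x` vanishes, because the rows of `A2 m z ·` are orthogonal to
  -- divergence free fields.
  refine integral_eq_zero_of_ae (Eventually.of_forall fun z => ?_)
  have hint : Integrable (fun x => Matrix.toEuclideanLin (A2 m z x) (η x)) m.meas := by
    refine (hY.norm.const_mul (d * (d * K))).mono' ?_
      (Eventually.of_forall fun x => h.norm_mat₂_le m z x _)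
    exact aestronglyMeasurable_toEuclideanLin (fun i j => ((h.continuous₂ m i j).comp
      (by fun_prop : Continuous fun x => (z, x))).aestronglyMeasurable) hη.memLp.1
  simp only
  rw [integral_inner hint]
  have h1 : ∫ x, Matrix.toEuclideanLin (A2 m z x) (η x) ∂m.meas = 0 := by
    ext i
    have hi : ∀ j, Integrable (fun x => (Matrix.toEuclideanLin (A2 m z x) (η x)) j) m.meas :=
      fun j => (EuclideanSpace.proj (𝕜 := ℝ) j : E d →L[ℝ] ℝ).integrable_comp hint
    rw [eval_integral_piLp hi]
    simp only [toEuclideanLin_apply_apply]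
    exact h.orth m z i η hη
  rw [h1, inner_zero_right]
  rfl

lemma SecondOrder.hasFDerivAt_inner (h : SecondOrder K A A1 A2) (m : P2 d) {ζ : E d → E d}
    (hζ : IsTestField ζ) (x : E d) :
    HasFDerivAt (fun x => inner ℝ (WithLp.toLp 2 (A m x) : E d) (ζ x))
      ((innerSL ℝ (WithLp.toLp 2 (A m x) : E d)).comp (fderiv ℝ ζ x) + (innerSL ℝ (ζ x)).comp
        (LinearMap.toContinuousLinearMap (Matrix.toEuclideanLin (A1 m x)))) x := by
  refine ((h.hasFDerivAt m x).inner ℝ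
    (hζ.1.differentiable (by simp) x).hasFDerivAt).congr_fderiv ?_
  ext v
  simp [real_inner_comm]

lemma SecondOrder.fderiv_inner (h : SecondOrder K A A1 A2) (m : P2 d) {ζ : E d → E d}
    (hζ : IsTestField ζ) (x v : E d) :
    fderiv ℝ (fun x => inner ℝ (WithLp.toLp 2 (A m x) : E d) (ζ x)) x v =
      inner ℝ (WithLp.toLp 2 (A m x) : E d) (fderiv ℝ ζ x v) +
        inner ℝ (ζ x) (Matrix.toEuclideanLin (A1 m x) v) := by
  rw [(h.hasFDerivAt_inner m hζ x).fderiv]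
  simp

/-- Only one continuous derivative is available, since `A1 m` is merely Lipschitz. Orthogonality of
this gradient therefore needs `IsDivFree.integral_gradient_eq_zero_of_contDiff_one`. -/
lemma FirstOrder.contDiff_inner (h : FirstOrder K U A) (h' : SecondOrder K' A A1 A2) (m : P2 d)
    {ζ : E d → E d} (hζ : IsTestField ζ) :
    ContDiff ℝ 1 fun x => inner ℝ (WithLp.toLp 2 (A m x) : E d) (ζ x) := by
  rw [contDiff_one_iff_fderiv]
  refine ⟨fun x => (h'.hasFDerivAt_inner m hζ x).differentiableAt, ?_⟩
  refine continuous_clm_apply.2 fun v => ?_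
  simp only [h'.fderiv_inner m hζ]
  have h1 : Continuous fun x => fderiv ℝ ζ x v :=
    (hζ.1.continuous_fderiv (by simp)).clm_apply continuous_const
  have h2 : Continuous fun x => Matrix.toEuclideanLin (A1 m x) v :=
    continuous_toEuclideanLin (h'.continuous₁ m) continuous_const
  exact ((h.continuous_vec m).inner h1).add (hζ.1.continuous.inner h2)

lemma hasCompactSupport_inner {A : E d → E d} {ζ : E d → E d} (hζ : IsTestField ζ) :
    HasCompactSupport fun x => inner ℝ (A x) (ζ x) := by
  refine hζ.2.mono fun x hx hx' => hx ?_
  simp only [hx', inner_zero_right]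

lemma FirstOrder.memLp_gradient_inner (h : FirstOrder K U A) (h' : SecondOrder K' A A1 A2)
    (m : P2 d) {ζ : E d → E d} (hζ : IsTestField ζ) :
    MemLp (gradient fun x => inner ℝ (WithLp.toLp 2 (A m x) : E d) (ζ x)) 2 m.meas := by
  have hc := (h.contDiff_inner h' m hζ).continuous_fderiv (by simp)
  obtain ⟨C, hC⟩ := ((hasCompactSupport_inner (A := fun x => WithLp.toLp 2 (A m x))
    hζ).fderiv ℝ).exists_bound_of_continuous hc
  refine MemLp.of_bound ?_ C (Eventually.of_forall fun x => ?_)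
  · exact ((InnerProductSpace.toDual ℝ (E d)).symm.continuous.comp hc).aestronglyMeasurable
  · rw [norm_gradient]; exact hC x

lemma FirstOrder.memLp_lieGrad (h : FirstOrder K U A) (h' : SecondOrder K' A A1 A2) (m : P2 d)
    {ζ : E d → E d} (hζ : IsTestField ζ) : MemLp (lieGrad A A2 m ζ) 2 m.meas := by
  obtain ⟨C, hC⟩ := hζ.exists_norm_le
  exact (h.memLp_gradient_inner h' m hζ).add (MemLp.of_bound
    (h'.aestronglyMeasurable_measureGrad m hζ.1.continuous _) _
    (Eventually.of_forall (h'.norm_measureGrad_le m hC)))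

lemma FirstOrder.integral_inner_lieGrad_eq_zero (h : FirstOrder K U A)
    (h' : SecondOrder K' A A1 A2) (m : P2 d) {ζ : E d → E d} (hζ : IsTestField ζ)
    {η : E d → E d} (hη : IsDivFree m η) :
    ∫ x, inner ℝ (η x) (lieGrad A A2 m ζ x) ∂m.meas = 0 := by
  obtain ⟨C, hC⟩ := hζ.exists_norm_le
  have h1 := h.memLp_gradient_inner h' m hζ
  have h2 : MemLp (measureGrad A2 m ζ) 2 m.meas := MemLp.of_bound
    (h'.aestronglyMeasurable_measureGrad m hζ.1.continuous _) _
    (Eventually.of_forall (h'.norm_measureGrad_le m hC))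
  simp only [lieGrad, inner_add_right]
  rw [integral_add (integrable_inner hη.memLp h1) (integrable_inner hη.memLp h2),
    hη.integral_gradient_eq_zero_of_contDiff_one (h.contDiff_inner h' m hζ)
      (hasCompactSupport_inner hζ), zero_add]
  rw [← h'.integral_inner_measureGrad_eq_zero m (hζ.memLp 2 m) hη]
  exact integral_congr_ae (Eventually.of_forall fun x => real_inner_comm _ _)

lemma SecondOrder.inner_lieGrad (h : SecondOrder K A A1 A2) (m : P2 d) {ζ : E d → E d}
    (hζ : IsTestField ζ) (x v : E d) :
    inner ℝ (lieGrad A A2 m ζ x) v = inner ℝ (WithLp.toLp 2 (A m x) : E d) (fderiv ℝ ζ x v) +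
        inner ℝ (ζ x) (Matrix.toEuclideanLin (A1 m x) v) + inner ℝ (measureGrad A2 m ζ x) v := by
  rw [lieGrad, inner_add_left, inner_gradient, h.fderiv_inner m hζ]

end Real

lemma abs_integral_le_of_abs_le {Ω : Type*} [MeasurableSpace Ω] {μ : Measure Ω} {f g : Ω → ℝ}
    (hg : Integrable g μ) (h : ∀ x, |f x| ≤ g x) : |∫ x, f x ∂μ| ≤ ∫ x, g x ∂μ :=
  (Real.norm_eq_abs _).symm.trans_le (norm_integral_le_of_norm_le hg (Eventually.of_forall h))

/-! ### Expansion of Lie derivatives, and the Hessian form -/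

section Real

variable {K K' : ℝ} {U : P2 d → ℝ} {A : P2 d → E d → Fin d → ℝ}
  {A1 : P2 d → E d → Matrix (Fin d) (Fin d) ℝ} {A2 : P2 d → E d → E d → Matrix (Fin d) (Fin d) ℝ}

lemma FirstOrder.nonneg (h : FirstOrder K U A) (m : P2 d) : 0 ≤ K :=
  (norm_nonneg _).trans (h.bound m)

/-- Pointwise remainder in the expansion of `⟨A ν y, ζ y⟩ - ⟨A m x, ζ x⟩`. -/
lemma FirstOrder.abs_inner_expansion_le (h : FirstOrder K U A) (h' : SecondOrder K' A A1 A2)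
    {ζ : E d → E d} {C L L' : ℝ} (hC : ∀ x, ‖ζ x‖ ≤ C) (hL : ∀ x y, ‖ζ y - ζ x‖ ≤ L * ‖y - x‖)
    (hL0 : 0 ≤ L)
    (hL' : ∀ x y, ‖ζ y - ζ x - fderiv ℝ ζ x (y - x)‖ ≤ L' * ‖y - x‖ ^ 2) {m ν : P2 d}
    {γ : Measure (E d × E d)} (hγ : γ ∈ optimalCouplings m ν) (x y : E d) :
    |inner ℝ (WithLp.toLp 2 (A ν y) : E d) (ζ y) - inner ℝ (WithLp.toLp 2 (A m x) : E d) (ζ x)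
      - inner ℝ (WithLp.toLp 2 (A m x) : E d) (fderiv ℝ ζ x (y - x))
      - inner ℝ (ζ x) (expansion (A1 m) (A2 m) γ x y)| ≤
      (C * (d * |K'|) + d * K * |L'| + 2 * d * K * L) * (‖y - x‖ ^ 2 + W2 m ν ^ 2) := by
  have hK := h.nonneg m
  have hC0 : 0 ≤ C := (norm_nonneg _).trans (hC 0)
  set a : E d := WithLp.toLp 2 (A m x)
  set b : E d := WithLp.toLp 2 (A ν y)
  set P := expansion (A1 m) (A2 m) γ x y
  set r := ‖y - x‖
  set w := W2 m ν
  have hw : 0 ≤ w := W2_nonneg _ _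
  have hr : 0 ≤ r := norm_nonneg _
  -- Leibniz rule with remainder: the second order remainder of `A`, the Taylor remainder of `ζ`,
  -- and the product of the two increments, each quadratic in `(r, w)`.
  have e : inner ℝ b (ζ y) - inner ℝ a (ζ x) - inner ℝ a (fderiv ℝ ζ x (y - x)) - inner ℝ (ζ x) P
      = inner ℝ (ζ x) (b - a - P) + inner ℝ a (ζ y - ζ x - fderiv ℝ ζ x (y - x)) +
        inner ℝ (b - a) (ζ y - ζ x) := by
    simp only [inner_sub_left, inner_sub_right]
    rw [real_inner_comm b (ζ x), real_inner_comm a (ζ x)]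
    ring
  rw [e]
  have h1 : |inner ℝ (ζ x) (b - a - P)| ≤ C * (d * |K'|) * (r ^ 2 + w ^ 2) := by
    refine (abs_real_inner_le_norm _ _).trans ?_
    have hp := h'.norm_expansion_le hγ x y
    have hp' : (d : ℝ) * (K' * (r ^ 2 + w ^ 2)) ≤ d * |K'| * (r ^ 2 + w ^ 2) := by
      rw [mul_assoc]
      exact mul_le_mul_of_nonneg_left (mul_le_mul_of_nonneg_right (le_abs_self _) (by positivity))
        (Nat.cast_nonneg _)
    calc _ ≤ C * (d * |K'| * (r ^ 2 + w ^ 2)) :=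
          mul_le_mul (hC x) (hp.trans hp') (norm_nonneg _) hC0
      _ = _ := by ring
  have h2 : |inner ℝ a (ζ y - ζ x - fderiv ℝ ζ x (y - x))| ≤ d * K * |L'| * (r ^ 2 + w ^ 2) := by
    refine (abs_real_inner_le_norm _ _).trans ?_
    have hp : L' * r ^ 2 ≤ |L'| * (r ^ 2 + w ^ 2) :=
      mul_le_mul (le_abs_self _) (by nlinarith) (by positivity) (abs_nonneg _)
    calc _ ≤ d * K * (|L'| * (r ^ 2 + w ^ 2)) :=
          mul_le_mul (h.norm_vec_le m x) ((hL' x y).trans hp) (norm_nonneg _) (by positivity)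
      _ = _ := by ring
  have h3 : |inner ℝ (b - a) (ζ y - ζ x)| ≤ 2 * d * K * L * (r ^ 2 + w ^ 2) := by
    refine (abs_real_inner_le_norm _ _).trans ?_
    calc _ ≤ d * (K * (r + w)) * (L * r) :=
          mul_le_mul (h.norm_vec_sub_le m ν x y) (hL x y) (norm_nonneg _) (by positivity)
      _ = d * K * L * ((r + w) * r) := by ring
      _ ≤ d * K * L * (2 * (r ^ 2 + w ^ 2)) :=
          mul_le_mul_of_nonneg_left (by nlinarith [sq_nonneg (r - w)]) (by positivity)
      _ = _ := by ring
  calc _ ≤ _ := (abs_add_le _ _).trans (add_le_add (abs_add_le _ _) le_rfl)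
    _ ≤ _ := add_le_add (add_le_add h1 h2) h3
    _ = _ := by ring

/-- First order expansion of `ν ↦ ∫ ⟨A ν, ζ⟩ dν`. -/
theorem FirstOrder.exists_lieDeriv_expansion (h : FirstOrder K U A)
    (h' : SecondOrder K' A A1 A2) (m : P2 d) {ζ : E d → E d} (hζ : IsTestField ζ) :
    ∃ C, ∀ ν, ∀ γ ∈ optimalCouplings m ν,
      |lieDeriv (fun m x => WithLp.toLp 2 (A m x)) ζ ν -
        lieDeriv (fun m x => WithLp.toLp 2 (A m x)) ζ m -
        ∫ p, inner ℝ (lieGrad A A2 m ζ p.1) (p.2 - p.1) ∂γ| ≤ C * W2 m ν ^ 2 := by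
  obtain ⟨C, hC⟩ := hζ.exists_norm_le
  obtain ⟨L, hL⟩ := hζ.exists_lipschitz
  have hL1 : ∀ x y, ‖ζ y - ζ x‖ ≤ L * ‖y - x‖ := fun x y => by
    simpa [dist_eq_norm] using hL.dist_le_mul y x
  obtain ⟨L', hL'⟩ : ∃ L' : NNReal, LipschitzWith L' (fderiv ℝ ζ) :=
    (hζ.1.fderiv_right (m := (⊤ : ℕ∞)) (by simp)).lipschitzWith_of_hasCompactSupport
      (hζ.2.fderiv ℝ) (by simp)
  have hL2 := norm_sub_sub_fderiv_le (hζ.1.differentiable (by simp)) (L := L') fun x y => by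
    simpa [dist_eq_norm] using hL'.dist_le_mul y x
  set D := C * (d * |K'|) + d * K * |(L' : ℝ)| + 2 * d * K * L
  -- The factor 2 comes from `∫ (|y - x|² + W₂²) dγ = 2 W₂²` for an optimal plan.
  refine ⟨D * 2, fun ν γ hγ => ?_⟩
  have hprob := isProbabilityMeasure_of_mem_couplings hγ.1
  have key := h.abs_inner_expansion_le h' hC hL1 L.coe_nonneg hL2 hγ
  have hbdd : ∀ ν' : P2 d, MemLp (fun x => inner ℝ (WithLp.toLp 2 (A ν' x) : E d) (ζ x)) 1 ν'.meas :=
    fun ν' => MemLp.of_bound ((h.continuous_vec ν').inner hζ.1.continuous).aestronglyMeasurable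
      (d * K * C) (Eventually.of_forall fun x => (norm_inner_le_norm _ _).trans
        (mul_le_mul (h.norm_vec_le ν' x) (hC x) (norm_nonneg _)
          (mul_nonneg (Nat.cast_nonneg _) (h.nonneg m))))
  have i1 := memLp_one_iff_integrable.1 (memLp_snd hγ.1 (hbdd ν))
  have i2 := memLp_one_iff_integrable.1 (memLp_fst hγ.1 (hbdd m))
  have i3 := integrable_inner (memLp_fst hγ.1 (h.memLp_lieGrad h' m hζ)) (memLp_sub hγ.1)
  have hY : Integrable (fun p : E d × E d => p.2 - p.1) γ :=
    (memLp_sub hγ.1).integrable (by norm_num)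
  have hX : AEStronglyMeasurable (fun p : E d × E d => p.1) γ := by fun_prop
  have hζm := hζ.memLp 2 m
  have i4' := h'.integrable_pairing m hζm hX hY
  have hsymm : ∀ x, ∫ q : E d × E d, inner ℝ (ζ x)
      (Matrix.toEuclideanLin (A2 m x q.1) (q.2 - q.1)) ∂γ =
      inner ℝ (ζ x) (∫ q, Matrix.toEuclideanLin (A2 m x q.1) (q.2 - q.1) ∂γ) := fun x =>
    integral_inner (h'.integrable_mat₂ hγ.1 x) _
  have i4 : Integrable (fun x => inner ℝ (ζ x)
      (∫ q, Matrix.toEuclideanLin (A2 m x q.1) (q.2 - q.1) ∂γ)) m.meas := by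
    refine i4'.integral_prod_left.congr (Eventually.of_forall fun x => ?_)
    exact hsymm x
  have i4'' := memLp_one_iff_integrable.1 (memLp_fst hγ.1 (memLp_one_iff_integrable.2 i4))
  have i5 : Integrable (fun p : E d × E d =>
      inner ℝ (measureGrad A2 m ζ p.1) (p.2 - p.1)) γ := by
    refine i4'.integral_prod_right.congr (Eventually.of_forall fun p => ?_)
    exact (h'.inner_measureGrad m hζm p.1 (p.2 - p.1)).symm
  -- Fubini exchanges the point where `ζ` is evaluated with the point that is displaced, turning the
  -- measure term of the expansion into a pairing with `measureGrad`.
  have e4 : ∫ p : E d × E d, inner ℝ (ζ p.1)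
      (∫ q, Matrix.toEuclideanLin (A2 m p.1 q.1) (q.2 - q.1) ∂γ) ∂γ =
      ∫ p, inner ℝ (measureGrad A2 m ζ p.1) (p.2 - p.1) ∂γ := by
    rw [integral_fst hγ.1 i4.1, h'.integral_inner_measureGrad m hζm hX hY, integral_prod _ i4']
    exact integral_congr_ae (Eventually.of_forall fun x => (hsymm x).symm)
  -- The spatial part of the expansion is the pairing with `lieGrad` less its `measureGrad` part.
  -- That part is restored by `e4` after integration.
  have hrem : ∀ p : E d × E d,
      inner ℝ (WithLp.toLp 2 (A ν p.2) : E d) (ζ p.2) -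
        inner ℝ (WithLp.toLp 2 (A m p.1) : E d) (ζ p.1) -
        inner ℝ (WithLp.toLp 2 (A m p.1) : E d) (fderiv ℝ ζ p.1 (p.2 - p.1)) -
        inner ℝ (ζ p.1) (expansion (A1 m) (A2 m) γ p.1 p.2) =
      inner ℝ (WithLp.toLp 2 (A ν p.2) : E d) (ζ p.2) -
        inner ℝ (WithLp.toLp 2 (A m p.1) : E d) (ζ p.1) -
        (inner ℝ (lieGrad A A2 m ζ p.1) (p.2 - p.1) -
          inner ℝ (measureGrad A2 m ζ p.1) (p.2 - p.1)) -
        inner ℝ (ζ p.1) (∫ q, Matrix.toEuclideanLin (A2 m p.1 q.1) (q.2 - q.1) ∂γ) := by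
    intro p
    rw [h'.inner_lieGrad m hζ, expansion, inner_add_right]
    ring
  have eI : ∫ p : E d × E d, (inner ℝ (WithLp.toLp 2 (A ν p.2) : E d) (ζ p.2) -
        inner ℝ (WithLp.toLp 2 (A m p.1) : E d) (ζ p.1) -
        inner ℝ (WithLp.toLp 2 (A m p.1) : E d) (fderiv ℝ ζ p.1 (p.2 - p.1)) -
        inner ℝ (ζ p.1) (expansion (A1 m) (A2 m) γ p.1 p.2)) ∂γ =
      lieDeriv (fun m x => WithLp.toLp 2 (A m x)) ζ ν -
        lieDeriv (fun m x => WithLp.toLp 2 (A m x)) ζ m -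
        ∫ p, inner ℝ (lieGrad A A2 m ζ p.1) (p.2 - p.1) ∂γ := by
    simp only [hrem]
    have j1 : Integrable (fun p : E d × E d => inner ℝ (WithLp.toLp 2 (A ν p.2) : E d) (ζ p.2) -
        inner ℝ (WithLp.toLp 2 (A m p.1) : E d) (ζ p.1)) γ := i1.sub i2
    have j2 : Integrable (fun p : E d × E d => inner ℝ (lieGrad A A2 m ζ p.1) (p.2 - p.1) -
        inner ℝ (measureGrad A2 m ζ p.1) (p.2 - p.1)) γ := i3.sub i5
    have j3 : Integrable (fun p : E d × E d => inner ℝ (WithLp.toLp 2 (A ν p.2) : E d) (ζ p.2) -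
        inner ℝ (WithLp.toLp 2 (A m p.1) : E d) (ζ p.1) -
        (inner ℝ (lieGrad A A2 m ζ p.1) (p.2 - p.1) -
          inner ℝ (measureGrad A2 m ζ p.1) (p.2 - p.1))) γ := j1.sub j2
    rw [integral_sub j3 i4'', integral_sub j1 j2, integral_sub i1 i2,
      integral_sub i3 i5, e4, integral_snd hγ.1 (hbdd ν).1, integral_fst hγ.1 (hbdd m).1]
    simp only [lieDeriv]
    ring
  rw [← eI]
  have hsq : Integrable (fun p : E d × E d => D * (‖p.2 - p.1‖ ^ 2 + W2 m ν ^ 2)) γ :=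
    ((integrable_norm_sq_sub hγ.1).add (integrable_const (W2 m ν ^ 2))).const_mul D
  refine (abs_integral_le_of_abs_le hsq fun p => key p.1 p.2).trans_eq ?_
  rw [integral_const_mul, integral_add (integrable_norm_sq_sub hγ.1) (integrable_const _),
    integral_eq_W2_sq hγ]
  simp
  ring

lemma SecondOrder.memLp_mat₁ (h : SecondOrder K A A1 A2) {m : P2 d} {ζ : E d → E d}
    (hζ : MemLp ζ 2 m.meas) : MemLp (fun x => Matrix.toEuclideanLin (A1 m x) (ζ x)) 2 m.meas :=
  hζ.of_le_mul (aestronglyMeasurable_toEuclideanLin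
    (fun i j => (h.continuous₁ m i j).aestronglyMeasurable) hζ.1)
    (Eventually.of_forall fun x => h.norm_mat₁_le m x (ζ x))

lemma SecondOrder.integrable_hess₂ (h : SecondOrder K A A1 A2) {m : P2 d} {ζ η : E d → E d}
    (hζ : MemLp ζ 2 m.meas) (hη : MemLp η 2 m.meas) :
    Integrable (fun q : E d × E d =>
      inner ℝ (Matrix.toEuclideanLin (A2 m q.1 q.2) (ζ q.2)) (η q.1)) (m.meas.prod m.meas) := by
  refine (h.integrable_pairing m hη (X := fun x => x) aestronglyMeasurable_id
    (hζ.integrable (by norm_num))).congr (Eventually.of_forall fun q => ?_)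
  exact real_inner_comm _ _

lemma SecondOrder.hessForm_add_left (h : SecondOrder K A A1 A2) {m : P2 d} {ζ ζ' η : E d → E d}
    (c : ℝ) (hζ : MemLp ζ 2 m.meas) (hζ' : MemLp ζ' 2 m.meas) (hη : MemLp η 2 m.meas) :
    hessForm A1 A2 m (c • ζ + ζ') η = c * hessForm A1 A2 m ζ η + hessForm A1 A2 m ζ' η := by
  simp only [hessForm, Pi.add_apply, Pi.smul_apply, map_add, map_smul, inner_add_left,
    inner_smul_left, conj_trivial]
  rw [integral_add ((integrable_inner (h.memLp_mat₁ hζ) hη).const_mul c)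
      (integrable_inner (h.memLp_mat₁ hζ') hη), integral_const_mul,
    integral_add ((h.integrable_hess₂ hζ hη).const_mul c) (h.integrable_hess₂ hζ' hη),
    integral_const_mul]
  ring

lemma SecondOrder.hessForm_add_right (h : SecondOrder K A A1 A2) {m : P2 d} {ζ ζ' η : E d → E d}
    (c : ℝ) (hζ : MemLp ζ 2 m.meas) (hζ' : MemLp ζ' 2 m.meas) (hη : MemLp η 2 m.meas) :
    hessForm A1 A2 m η (c • ζ + ζ') = c * hessForm A1 A2 m η ζ + hessForm A1 A2 m η ζ' := by
  simp only [hessForm, Pi.add_apply, Pi.smul_apply, inner_add_right, inner_smul_right]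
  rw [integral_add ((integrable_inner (h.memLp_mat₁ hη) hζ).const_mul c)
      (integrable_inner (h.memLp_mat₁ hη) hζ'), integral_const_mul,
    integral_add ((h.integrable_hess₂ hη hζ).const_mul c) (h.integrable_hess₂ hη hζ'),
    integral_const_mul]
  ring

lemma SecondOrder.abs_hessForm_le (h : SecondOrder K A A1 A2) {m : P2 d} {ζ η : E d → E d}
    (hζ : MemLp ζ 2 m.meas) (hη : MemLp η 2 m.meas) :
    |hessForm A1 A2 m ζ η| ≤ 2 * (d * (d * |K|)) * normL2 m ζ * normL2 m η := by
  have hm := h.bound₁ m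
  have hM : ∀ (M : Matrix (Fin d) (Fin d) ℝ) (v w : E d), (∀ i j, |M i j| ≤ K) →
      |inner ℝ (Matrix.toEuclideanLin M v) w| ≤ d * (d * |K|) * (‖v‖ * ‖w‖) := by
    intro M v w hM
    refine (abs_real_inner_le_norm _ _).trans ?_
    rw [← mul_assoc]
    exact mul_le_mul_of_nonneg_right
      (norm_toEuclideanLin_le (fun i j => (hM i j).trans (le_abs_self K)) v) (norm_nonneg _)
  have h1 : |∫ x, inner ℝ (Matrix.toEuclideanLin (A1 m x) (ζ x)) (η x) ∂m.meas| ≤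
      d * (d * |K|) * (normL2 m ζ * normL2 m η) := by
    have i0 : Integrable (fun x => d * (d * |K|) * (‖ζ x‖ * ‖η x‖)) m.meas :=
      (hζ.norm.integrable_mul hη.norm).const_mul _
    refine (abs_integral_le_of_abs_le i0 fun x =>
      hM (A1 m x) (ζ x) (η x) (h.bound₁ m x)).trans ?_
    rw [integral_const_mul]
    exact mul_le_mul_of_nonneg_left (integral_norm_mul_le hζ hη) (by positivity)
  have h2 : |∫ q : E d × E d, inner ℝ (Matrix.toEuclideanLin (A2 m q.1 q.2) (ζ q.2)) (η q.1)
      ∂(m.meas.prod m.meas)| ≤ d * (d * |K|) * (normL2 m ζ * normL2 m η) := by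
    have i1 : Integrable (fun q : E d × E d => ‖ζ q.2‖ * ‖η q.1‖) (m.meas.prod m.meas) :=
      ((hη.integrable (by norm_num)).norm.mul_prod (hζ.integrable (by norm_num)).norm).congr
        (Eventually.of_forall fun q => mul_comm _ _)
    refine (abs_integral_le_of_abs_le (i1.const_mul (d * (d * |K|))) fun q =>
      hM (A2 m q.1 q.2) (ζ q.2) (η q.1) (h.bound₂ m q.1 q.2)).trans ?_
    rw [integral_const_mul]
    refine mul_le_mul_of_nonneg_left ?_ (by positivity)
    have e : ∫ q : E d × E d, ‖ζ q.2‖ * ‖η q.1‖ ∂(m.meas.prod m.meas) =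
        (∫ x, ‖η x‖ ∂m.meas) * ∫ x, ‖ζ x‖ ∂m.meas := by
      rw [← integral_prod_mul]
      exact integral_congr_ae (Eventually.of_forall fun q => mul_comm _ _)
    rw [e, mul_comm]
    exact mul_le_mul (integral_norm_le_normL2 hζ) (integral_norm_le_normL2 hη)
      (integral_nonneg fun _ => norm_nonneg _) (normL2_nonneg _ _)
  calc _ ≤ _ := abs_add_le _ _
    _ ≤ _ := add_le_add h1 h2
    _ = _ := by ring

/-- In `⟨lieGrad, ∇φ₁⟩` the Leibniz rule produces `⟨A m, D(∇φ₂) ∇φ₁⟩`, exactly the connection term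
that is subtracted. No derivative of the fields remains, so the form extends to `L²(m)`. -/
theorem FirstOrder.isHessianAt (h : FirstOrder K U A) (h' : SecondOrder K' A A1 A2) (m : P2 d) :
    IsHessianAt U m (hessForm A1 A2 m) := by
  refine ⟨⟨fun m x => WithLp.toLp 2 (A m x), ⟨1, one_pos, fun ν _ => h.isWGradient ν⟩,
    fun ζ hζ => ?_, fun φ₁ φ₂ hφ₁ hφ₂ => ?_⟩, fun ζ ζ' η c hζ hζ' hη =>
      ⟨h'.hessForm_add_left c hζ.1 hζ'.1 hη.1, h'.hessForm_add_right c hζ.1 hζ'.1 hη.1⟩,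
    2 * (d * (d * |K'|)), fun ζ η hζ hη => h'.abs_hessForm_le hζ.1 hη.1⟩
  · obtain ⟨C, hC⟩ := h.exists_lieDeriv_expansion h' m hζ
    exact wDifferentiableAt_of_expansion (h.memLp_lieGrad h' m hζ) hC
  · have hζ := hφ₂.isTestField_gradient
    have hζ1 := hφ₁.isTestField_gradient
    obtain ⟨C, hC⟩ := h.exists_lieDeriv_expansion h' m hζ
    refine ⟨lieGrad A A2 m (gradient φ₂), isWGradient_of_expansion (h.memLp_lieGrad h' m hζ) hC
      fun η hη => h.integral_inner_lieGrad_eq_zero h' m hζ hη, ?_⟩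
    have i0 := integrable_inner (h.memLp_lieGrad h' m hζ) (hζ1.memLp 2 m)
    have hfc : Continuous fun x => fderiv ℝ (gradient φ₂) x (gradient φ₁ x) :=
      (hζ.1.continuous_fderiv (by simp)).clm_apply hζ1.1.continuous
    have i1 : Integrable (fun x => inner ℝ (WithLp.toLp 2 (A m x) : E d)
        (fderiv ℝ (gradient φ₂) x (gradient φ₁ x))) m.meas := by
      have hs : HasCompactSupport fun x => inner ℝ (WithLp.toLp 2 (A m x) : E d)
          (fderiv ℝ (gradient φ₂) x (gradient φ₁ x)) := by
        refine hζ1.2.mono fun x hx hx' => hx ?_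
        simp only [hx', map_zero, inner_zero_right]
      exact ((h.continuous_vec m).inner hfc).integrable_of_hasCompactSupport hs
    rw [← integral_sub i0 i1]
    have hY := (hζ1.memLp 2 m).integrable (by norm_num : (1 : ℝ≥0∞) ≤ 2)
    have e2 := h'.integral_inner_measureGrad m (hζ.memLp 2 m) (X := fun x => x)
      (Y := gradient φ₁) aestronglyMeasurable_id hY
    have i2 := (h'.integrable_pairing m (hζ.memLp 2 m) (X := fun x => x)
      (Y := gradient φ₁) aestronglyMeasurable_id hY).integral_prod_right
    have i3 : Integrable (fun x => inner ℝ (measureGrad A2 m (gradient φ₂) x) (gradient φ₁ x))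
        m.meas := i2.congr (Eventually.of_forall fun x =>
          (h'.inner_measureGrad m (hζ.memLp 2 m) x (gradient φ₁ x)).symm)
    have i4 := integrable_inner (h'.memLp_mat₁ (hζ1.memLp 2 m)) (hζ.memLp 2 m)
    have e : ∀ x, inner ℝ (lieGrad A A2 m (gradient φ₂) x) (gradient φ₁ x) -
        inner ℝ (WithLp.toLp 2 (A m x) : E d) (fderiv ℝ (gradient φ₂) x (gradient φ₁ x)) =
        inner ℝ (Matrix.toEuclideanLin (A1 m x) (gradient φ₁ x)) (gradient φ₂ x) +
          inner ℝ (measureGrad A2 m (gradient φ₂) x) (gradient φ₁ x) := by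
      intro x
      rw [h'.inner_lieGrad m hζ, real_inner_comm (gradient φ₂ x)]
      ring
    simp only [e]
    rw [integral_add i4 i3, e2, hessForm]
    congr 1
    exact integral_congr_ae (Eventually.of_forall fun q => real_inner_comm _ _)

/-- The Wasserstein gradient of the `i`-th moment is the constant field `eᵢ`. -/
lemma isWGradient_moment (m : P2 d) (i : Fin d) :
    IsWGradient (fun ν : P2 d => ∫ x, x i ∂ν.meas) m (fun _ => EuclideanSpace.single i 1) ∧
      MemTangent m (fun _ => EuclideanSpace.single i 1) := by
  have hB : MemLp (fun _ : E d => (EuclideanSpace.single i 1 : E d)) 2 m.meas := memLp_const _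
  have hgrad : (fun _ : E d => (EuclideanSpace.single i 1 : E d)) =
      gradient (EuclideanSpace.proj (𝕜 := ℝ) i : E d →L[ℝ] ℝ) := by
    ext1 x
    refine ext_inner_right ℝ fun v => ?_
    rw [inner_gradient, ContinuousLinearMap.fderiv, EuclideanSpace.inner_single_left]
    simp
  have horth : ∀ η, IsDivFree m η →
      ∫ x, inner ℝ (η x) (EuclideanSpace.single i 1 : E d) ∂m.meas = 0 := by
    intro η hη
    have h1 := hη.integral_gradient_eq_zero
      (u := (EuclideanSpace.proj (𝕜 := ℝ) i : E d →L[ℝ] ℝ)) (ContinuousLinearMap.contDiff _)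
      (C := ‖(EuclideanSpace.proj (𝕜 := ℝ) i : E d →L[ℝ] ℝ)‖)
      (fun x => by rw [ContinuousLinearMap.fderiv])
    rw [← hgrad] at h1
    exact h1
  -- The moment is linear in the measure, so its expansion is exact.
  refine ⟨isWGradient_of_expansion (K := 0) hB (fun ν γ hγ => ?_) horth,
    memTangent_of_orthogonal hB horth⟩
  have hi : ∀ ν' : P2 d, MemLp (fun x : E d => x i) 2 ν'.meas := fun ν' =>
    (EuclideanSpace.proj (𝕜 := ℝ) i : E d →L[ℝ] ℝ).comp_memLp' ν'.memLp_id
  have hprob := isProbabilityMeasure_of_mem_couplings hγ.1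
  have e : ∀ p : E d × E d, inner ℝ (EuclideanSpace.single i (1 : ℝ) : E d) (p.2 - p.1) =
      p.2 i - p.1 i := fun p => by rw [EuclideanSpace.inner_single_left]; simp
  simp only [e]
  rw [integral_sub ((memLp_snd hγ.1 (hi ν)).integrable (by norm_num))
    ((memLp_fst hγ.1 (hi m)).integrable (by norm_num)),
    integral_snd hγ.1 (f := fun x => x i) (hi ν).1, integral_fst hγ.1 (f := fun x => x i) (hi m).1]
  simp

/-- On the constant fields `eᵢ` the Hessian form only sees the diagonal entries of `A1` and `A2`. -/
theorem FirstOrder.isWLaplacianAt (h : FirstOrder K U A) (h' : SecondOrder K' A A1 A2) (ε : ℝ)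
    (m : P2 d) : IsWLaplacianAt ε U m (lap ε A1 A2 m) := by
  refine ⟨fun m x => WithLp.toLp 2 (A m x), A1 m, A2 m, hessForm A1 A2 m,
    fun i _ => EuclideanSpace.single i 1, SecondOrder.isTwiceWDifferentiableAt h h' m,
    h.isHessianAt h' m, isWGradient_moment m, ?_⟩
  have e : ∀ (M : Matrix (Fin d) (Fin d) ℝ) (i : Fin d),
      inner ℝ (Matrix.toEuclideanLin M (EuclideanSpace.single i 1)) (EuclideanSpace.single i 1) =
        M i i := by
    intro M i
    rw [EuclideanSpace.inner_single_right, toEuclideanLin_apply_apply,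
      Finset.sum_eq_single i (fun j _ hj => by simp [hj]) (by simp)]
    simp
  simp only [hessForm, e, lap, smul_eq_mul]

end Real

/-! ### Stability under continuous linear maps and integrals -/

set_option linter.unusedSectionVars false

section Stability

variable {G G' : Type*} [NormedAddCommGroup G] [NormedSpace ℝ G] [CompleteSpace G]
  [NormedAddCommGroup G'] [NormedSpace ℝ G'] [CompleteSpace G']
  {K : ℝ} {U : P2 d → G} {A : P2 d → E d → Fin d → G}
  {A1 : P2 d → E d → Matrix (Fin d) (Fin d) G} {A2 : P2 d → E d → E d → Matrix (Fin d) (Fin d) G}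

lemma integrable_sum_smul {Ω : Type*} [MeasurableSpace Ω] {μ : Measure Ω} {v : Ω → E d}
    {f : Ω → Fin d → G} {C : ℝ} (hv : Integrable v μ)
    (hf : ∀ i, AEStronglyMeasurable (fun ω => f ω i) μ) (hC : ∀ ω i, ‖f ω i‖ ≤ C) :
    Integrable (fun ω => ∑ i, v ω i • f ω i) μ := by
  refine integrable_finsetSum _ fun i _ => ?_
  have hvi : Integrable (fun ω => v ω i) μ :=
    (EuclideanSpace.proj (𝕜 := ℝ) i : E d →L[ℝ] ℝ).integrable_comp hv
  refine (hvi.norm.mul_const C).mono' (hvi.1.smul (hf i)) (Eventually.of_forall fun ω => ?_)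
  rw [norm_smul]
  exact mul_le_mul_of_nonneg_left (hC ω i) (norm_nonneg _)

lemma norm_sum_smul_le {v : E d} {f : Fin d → G} {C : ℝ} (hC : ∀ i, ‖f i‖ ≤ C) :
    ‖∑ i, v i • f i‖ ≤ d * (‖v‖ * C) := by
  refine (norm_sum_le _ _).trans ?_
  calc ∑ i, ‖v i • f i‖ ≤ ∑ _i : Fin d, ‖v‖ * C := by
        refine Finset.sum_le_sum fun i _ => ?_
        rw [norm_smul]
        exact mul_le_mul (PiLp.norm_apply_le v i) (hC i) (norm_nonneg _) (norm_nonneg _)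
    _ = _ := by simp

lemma FirstOrder.integrable_expand (h : FirstOrder K U A) {m ν : P2 d}
    {γ : Measure (E d × E d)} (hγ : γ ∈ couplings m ν) :
    Integrable (fun p : E d × E d => ∑ i, (p.2 - p.1) i • A m p.1 i) γ := by
  have := isProbabilityMeasure_of_mem_couplings hγ
  exact integrable_sum_smul ((memLp_sub hγ).integrable (by norm_num))
    (fun i => ((h.continuous m i).comp continuous_fst).aestronglyMeasurable)
    fun p i => h.grad_bound m p.1 i

lemma FirstOrder.integrable_orth (h : FirstOrder K U A) {m : P2 d} {η : E d → E d}
    (hη : MemLp η 2 m.meas) : Integrable (fun x => ∑ i, η x i • A m x i) m.meas :=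
  integrable_sum_smul (hη.integrable (by norm_num))
    (fun i => (h.continuous m i).aestronglyMeasurable) fun x i => h.grad_bound m x i

lemma SecondOrder.integrable_expand (h : SecondOrder K A A1 A2) {m ν : P2 d}
    {γ : Measure (E d × E d)} (hγ : γ ∈ couplings m ν) (x : E d) (i : Fin d) :
    Integrable (fun p : E d × E d => ∑ j, (p.2 - p.1) j • A2 m x p.1 i j) γ := by
  have := isProbabilityMeasure_of_mem_couplings hγ
  exact integrable_sum_smul ((memLp_sub hγ).integrable (by norm_num))
    (fun j => ((h.continuous₂ m i j).comp
      (by fun_prop : Continuous fun p : E d × E d => (x, p.1))).aestronglyMeasurable)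
    fun p j => h.bound₂ m x p.1 i j

lemma SecondOrder.integrable_orth (h : SecondOrder K A A1 A2) {m : P2 d} {η : E d → E d}
    (hη : MemLp η 2 m.meas) (x : E d) (i : Fin d) :
    Integrable (fun y => ∑ j, η y j • A2 m x y i j) m.meas :=
  integrable_sum_smul (hη.integrable (by norm_num))
    (fun j => ((h.continuous₂ m i j).comp
      (by fun_prop : Continuous fun y : E d => (x, y))).aestronglyMeasurable)
    fun y j => h.bound₂ m x y i j

/-- Every clause is linear, so it passes through `T` at the cost of `‖T‖`. The maps used are real
part, imaginary part and multiplication by a coefficient. -/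
theorem FirstOrder.comp_clm (h : FirstOrder K U A) (T : G →L[ℝ] G') :
    FirstOrder (‖T‖ * K) (fun m => T (U m)) (fun m x i => T (A m x i)) where
  bound m := T.le_opNorm_of_le (h.bound m)
  grad_bound m x i := T.le_opNorm_of_le (h.grad_bound m x i)
  grad_lip m ν x y i := by
    rw [← map_sub, mul_assoc]; exact T.le_opNorm_of_le (h.grad_lip m ν x y i)
  expand m ν γ hγ := by
    have e : ∫ p : E d × E d, ∑ i, (p.2 - p.1) i • T (A m p.1 i) ∂γ =
        T (∫ p : E d × E d, ∑ i, (p.2 - p.1) i • A m p.1 i ∂γ) := by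
      rw [← T.integral_comp_comm (h.integrable_expand hγ.1)]
      simp only [map_sum, map_smul]
    rw [e, ← map_sub, ← map_sub, mul_assoc]
    exact T.le_opNorm_of_le (h.expand m ν γ hγ)
  orth m η hη := by
    have e : ∫ x, ∑ i, η x i • T (A m x i) ∂m.meas = T (∫ x, ∑ i, η x i • A m x i ∂m.meas) := by
      rw [← T.integral_comp_comm (h.integrable_orth hη.memLp)]
      simp only [map_sum, map_smul]
    rw [e, h.orth m η hη, map_zero]

theorem SecondOrder.comp_clm (h : SecondOrder K A A1 A2) (T : G →L[ℝ] G') :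
    SecondOrder (‖T‖ * K) (fun m x i => T (A m x i)) (fun m x => (A1 m x).map T)
      (fun m x y => (A2 m x y).map T) where
  bound₁ m x i j := T.le_opNorm_of_le (h.bound₁ m x i j)
  bound₂ m x y i j := T.le_opNorm_of_le (h.bound₂ m x y i j)
  lip₁ m ν x y i j := by
    simp only [Matrix.map_apply]
    rw [← map_sub, mul_assoc]; exact T.le_opNorm_of_le (h.lip₁ m ν x y i j)
  lip₂ m ν x x' y y' i j := by
    simp only [Matrix.map_apply]
    rw [← map_sub, mul_assoc]; exact T.le_opNorm_of_le (h.lip₂ m ν x x' y y' i j)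
  expand m ν γ hγ x y i := by
    have e : ∫ p : E d × E d, ∑ j, (p.2 - p.1) j • T (A2 m x p.1 i j) ∂γ =
        T (∫ p : E d × E d, ∑ j, (p.2 - p.1) j • A2 m x p.1 i j ∂γ) := by
      rw [← T.integral_comp_comm (h.integrable_expand hγ.1 x i)]
      simp only [map_sum, map_smul]
    have e' : ∑ j, (y - x) j • T (A1 m x i j) = T (∑ j, (y - x) j • A1 m x i j) := by
      simp only [map_sum, map_smul]
    simp only [Matrix.map_apply]
    rw [e, e', ← map_sub, ← map_sub, ← map_sub, mul_assoc]
    exact T.le_opNorm_of_le (h.expand m ν γ hγ x y i)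
  orth m x i η hη := by
    have e : ∫ y, ∑ j, η y j • T (A2 m x y i j) ∂m.meas =
        T (∫ y, ∑ j, η y j • A2 m x y i j ∂m.meas) := by
      rw [← T.integral_comp_comm (h.integrable_orth hη.memLp x i)]
      simp only [map_sum, map_smul]
    simp only [Matrix.map_apply]
    rw [e, h.orth m x i η hη, map_zero]

lemma SecondOrder.integrable_diag₁ (h : SecondOrder K A A1 A2) (m : P2 d) (i j : Fin d) :
    Integrable (fun x => A1 m x i j) m.meas :=
  .of_bound (h.continuous₁ m i j).aestronglyMeasurable K
    (Eventually.of_forall fun x => h.bound₁ m x i j)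

lemma SecondOrder.integrable_diag₂ (h : SecondOrder K A A1 A2) (m : P2 d) (i j : Fin d) :
    Integrable (fun q : E d × E d => A2 m q.1 q.2 i j) (m.meas.prod m.meas) :=
  .of_bound (h.continuous₂ m i j).aestronglyMeasurable K
    (Eventually.of_forall fun q => h.bound₂ m q.1 q.2 i j)

lemma SecondOrder.lap_comp_clm (h : SecondOrder K A A1 A2) (T : G →L[ℝ] G') (ε : ℝ) (m : P2 d) :
    lap ε (fun m x => (A1 m x).map T) (fun m x y => (A2 m x y).map T) m = T (lap ε A1 A2 m) := by
  simp only [lap, map_sum, map_add, map_smul, Matrix.map_apply]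
  refine Finset.sum_congr rfl fun i _ => ?_
  rw [T.integral_comp_comm (h.integrable_diag₁ m i i),
    T.integral_comp_comm (h.integrable_diag₂ m i i)]

/-! ### Integrals of families of expansions -/

section Integral

variable {Ω : Type*} [MeasurableSpace Ω] {μ : Measure Ω} [SFinite μ] {k : Ω → ℝ}
  {V : Ω → P2 d → G} {B : Ω → P2 d → E d → Fin d → G}
  {B1 : Ω → P2 d → E d → Matrix (Fin d) (Fin d) G}
  {B2 : Ω → P2 d → E d → E d → Matrix (Fin d) (Fin d) G}

lemma integrable_sum_smul_prod {X : Type*} [MeasurableSpace X] {γ : Measure X} [SFinite γ]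
    {v : X → E d} {f : Ω → X → Fin d → G} (hk : Integrable k μ) (hv : Integrable v γ)
    (hf : ∀ i, AEStronglyMeasurable (fun q : Ω × X => f q.1 q.2 i) (μ.prod γ))
    (hC : ∀ ω x i, ‖f ω x i‖ ≤ k ω) :
    Integrable (fun q : Ω × X => ∑ i, v q.2 i • f q.1 q.2 i) (μ.prod γ) := by
  have h1 : Integrable (fun q : Ω × X => d * (k q.1 * ‖v q.2‖)) (μ.prod γ) :=
    (hk.mul_prod hv.norm).const_mul _
  refine h1.mono' ?_ (Eventually.of_forall fun q => ?_)
  · refine Finset.aestronglyMeasurable_fun_sum _ fun i _ => ?_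
    have hvi : Integrable (fun x => v x i) γ :=
      (EuclideanSpace.proj (𝕜 := ℝ) i : E d →L[ℝ] ℝ).integrable_comp hv
    exact hvi.1.comp_snd.smul (hf i)
  · refine (norm_sum_smul_le (hC q.1 q.2)).trans_eq ?_
    ring

/-- Fubini with dominating function `d * (k ω * ‖v x‖)`. It carries both the measure terms of the
expansions and the orthogonality conditions through the integral. -/
lemma integral_sum_smul_swap {X : Type*} [MeasurableSpace X] {γ : Measure X} [SFinite γ]
    {v : X → E d} {f : Ω → X → Fin d → G} (hk : Integrable k μ) (hv : Integrable v γ)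
    (hf : ∀ i, AEStronglyMeasurable (fun q : Ω × X => f q.1 q.2 i) (μ.prod γ))
    (hf' : ∀ x i, AEStronglyMeasurable (fun ω => f ω x i) μ)
    (hC : ∀ ω x i, ‖f ω x i‖ ≤ k ω) :
    ∫ x, ∑ i, v x i • ∫ ω, f ω x i ∂μ ∂γ = ∫ ω, ∫ x, ∑ i, v x i • f ω x i ∂γ ∂μ := by
  rw [integral_integral_swap (f := fun ω x => ∑ i, v x i • f ω x i)
    (integrable_sum_smul_prod hk hv hf hC)]
  refine integral_congr_ae (Eventually.of_forall fun x => ?_)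
  have hint : ∀ i, Integrable (fun ω => f ω x i) μ := fun i =>
    hk.mono' (hf' x i) (Eventually.of_forall fun ω => hC ω x i)
  have hint' : ∀ i, Integrable (fun ω => v x i • f ω x i) μ := fun i => (hint i).smul (v x i)
  simp only
  rw [integral_finsetSum _ fun i _ => hint' i]
  simp only [integral_smul]

/-- Integrating functions with uniformly controlled first order expansions. -/
theorem FirstOrder.integral (hk : Integrable k μ) (h : ∀ ω, FirstOrder (k ω) (V ω) (B ω))
    (hV : ∀ m, AEStronglyMeasurable (fun ω => V ω m) μ)
    (hB : ∀ m i, StronglyMeasurable fun q : Ω × E d => B q.1 m q.2 i) :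
    FirstOrder (∫ ω, k ω ∂μ) (fun m => ∫ ω, V ω m ∂μ) (fun m x i => ∫ ω, B ω m x i ∂μ) := by
  have hB' : ∀ m x i, StronglyMeasurable fun ω => B ω m x i := fun m x i =>
    (hB m i).comp_measurable (by fun_prop : Measurable fun ω => (ω, x))
  have iV : ∀ m, Integrable (fun ω => V ω m) μ := fun m =>
    hk.mono' (hV m) (Eventually.of_forall fun ω => (h ω).bound m)
  have iB : ∀ m x i, Integrable (fun ω => B ω m x i) μ := fun m x i =>
    hk.mono' (hB' m x i).aestronglyMeasurable (Eventually.of_forall fun ω => (h ω).grad_bound m x i)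
  constructor
  · exact fun m => norm_integral_le_of_norm_le hk (Eventually.of_forall fun ω => (h ω).bound m)
  · exact fun m x i => norm_integral_le_of_norm_le hk
      (Eventually.of_forall fun ω => (h ω).grad_bound m x i)
  · intro m ν x y i
    rw [← integral_sub (iB ν y i) (iB m x i), ← integral_mul_const]
    exact norm_integral_le_of_norm_le (hk.mul_const _)
      (Eventually.of_forall fun ω => (h ω).grad_lip m ν x y i)
  · intro m ν γ hγ
    have := isProbabilityMeasure_of_mem_couplings hγ.1
    have hv : Integrable (fun p : E d × E d => p.2 - p.1) γ :=
      (memLp_sub hγ.1).integrable (by norm_num)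
    have hf : ∀ i, AEStronglyMeasurable (fun q : Ω × (E d × E d) => B q.1 m q.2.1 i) (μ.prod γ) :=
      fun i => ((hB m i).comp_measurable (by fun_prop :
        Measurable fun q : Ω × (E d × E d) => (q.1, q.2.1))).aestronglyMeasurable
    have hC : ∀ ω (p : E d × E d) i, ‖B ω m p.1 i‖ ≤ k ω := fun ω p i => (h ω).grad_bound m p.1 i
    have e := integral_sum_smul_swap (f := fun ω (p : E d × E d) i => B ω m p.1 i) hk hv hf
      (fun p i => (hB' m p.1 i).aestronglyMeasurable) hC
    have i1 := (integrable_sum_smul_prod (f := fun ω (p : E d × E d) i => B ω m p.1 i)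
      hk hv hf hC).integral_prod_left
    have i2 : Integrable (fun ω => V ω ν - V ω m) μ := (iV ν).sub (iV m)
    rw [e, ← integral_sub (iV ν) (iV m), ← integral_sub i2 i1, ← integral_mul_const]
    exact norm_integral_le_of_norm_le (hk.mul_const _)
      (Eventually.of_forall fun ω => (h ω).expand m ν γ hγ)
  · intro m η hη
    rw [integral_sum_smul_swap (f := fun ω x i => B ω m x i) hk
      (hη.memLp.integrable (by norm_num)) (fun i => (hB m i).aestronglyMeasurable)
      (fun x i => (hB' m x i).aestronglyMeasurable) fun ω x i => (h ω).grad_bound m x i]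
    simp only [(h _).orth m η hη, integral_zero]

/-- Integrating functions with uniformly controlled second order expansions. -/
theorem SecondOrder.integral {k₀ : Ω → ℝ} (hk₀ : Integrable k₀ μ)
    (h₀ : ∀ ω m x i, ‖B ω m x i‖ ≤ k₀ ω) (hk : Integrable k μ)
    (h : ∀ ω, SecondOrder (k ω) (B ω) (B1 ω) (B2 ω))
    (hB : ∀ m x i, AEStronglyMeasurable (fun ω => B ω m x i) μ)
    (hB1 : ∀ m x i j, AEStronglyMeasurable (fun ω => B1 ω m x i j) μ)
    (hB2 : ∀ m i j, StronglyMeasurable fun q : Ω × (E d × E d) => B2 q.1 m q.2.1 q.2.2 i j) :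
    SecondOrder (∫ ω, k ω ∂μ) (fun m x i => ∫ ω, B ω m x i ∂μ)
      (fun m x => Matrix.of fun i j => ∫ ω, B1 ω m x i j ∂μ)
      (fun m x y => Matrix.of fun i j => ∫ ω, B2 ω m x y i j ∂μ) := by
  have hB2' : ∀ m x y i j, StronglyMeasurable fun ω => B2 ω m x y i j := fun m x y i j =>
    (hB2 m i j).comp_measurable (by fun_prop : Measurable fun ω => (ω, (x, y)))
  -- `SecondOrder` does not bound the gradient itself, so its integrability rests on the separate
  -- weight `k₀`.
  have iB : ∀ m x i, Integrable (fun ω => B ω m x i) μ := fun m x i =>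
    hk₀.mono' (hB m x i) (Eventually.of_forall fun ω => h₀ ω m x i)
  have iB1 : ∀ m x i j, Integrable (fun ω => B1 ω m x i j) μ := fun m x i j =>
    hk.mono' (hB1 m x i j) (Eventually.of_forall fun ω => (h ω).bound₁ m x i j)
  have iB2 : ∀ m x y i j, Integrable (fun ω => B2 ω m x y i j) μ := fun m x y i j =>
    hk.mono' (hB2' m x y i j).aestronglyMeasurable
      (Eventually.of_forall fun ω => (h ω).bound₂ m x y i j)
  constructor <;> simp only [Matrix.of_apply]
  · exact fun m x i j => norm_integral_le_of_norm_le hk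
      (Eventually.of_forall fun ω => (h ω).bound₁ m x i j)
  · exact fun m x y i j => norm_integral_le_of_norm_le hk
      (Eventually.of_forall fun ω => (h ω).bound₂ m x y i j)
  · intro m ν x y i j
    rw [← integral_sub (iB1 ν y i j) (iB1 m x i j), ← integral_mul_const]
    exact norm_integral_le_of_norm_le (hk.mul_const _)
      (Eventually.of_forall fun ω => (h ω).lip₁ m ν x y i j)
  · intro m ν x x' y y' i j
    rw [← integral_sub (iB2 ν y y' i j) (iB2 m x x' i j), ← integral_mul_const]
    exact norm_integral_le_of_norm_le (hk.mul_const _)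
      (Eventually.of_forall fun ω => (h ω).lip₂ m ν x x' y y' i j)
  · intro m ν γ hγ x y i
    have := isProbabilityMeasure_of_mem_couplings hγ.1
    have hv : Integrable (fun p : E d × E d => p.2 - p.1) γ :=
      (memLp_sub hγ.1).integrable (by norm_num)
    have hf : ∀ j, AEStronglyMeasurable
        (fun q : Ω × (E d × E d) => B2 q.1 m x q.2.1 i j) (μ.prod γ) :=
      fun j => ((hB2 m i j).comp_measurable (by fun_prop :
        Measurable fun q : Ω × (E d × E d) => (q.1, (x, q.2.1)))).aestronglyMeasurable
    have hC : ∀ ω (p : E d × E d) j, ‖B2 ω m x p.1 i j‖ ≤ k ω :=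
      fun ω p j => (h ω).bound₂ m x p.1 i j
    have e := integral_sum_smul_swap (f := fun ω (p : E d × E d) j => B2 ω m x p.1 i j) hk hv hf
      (fun p j => (hB2' m x p.1 i j).aestronglyMeasurable) hC
    have i1 := (integrable_sum_smul_prod (f := fun ω (p : E d × E d) j => B2 ω m x p.1 i j)
      hk hv hf hC).integral_prod_left
    have i2 : Integrable (fun ω => B ω ν y i - B ω m x i) μ := (iB ν y i).sub (iB m x i)
    have iB1' : ∀ j, Integrable (fun ω => (y - x) j • B1 ω m x i j) μ := fun j =>
      (iB1 m x i j).smul ((y - x) j)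
    have i3 : Integrable (fun ω => ∑ j, (y - x) j • B1 ω m x i j) μ :=
      integrable_finsetSum _ fun j _ => iB1' j
    have e' : ∑ j, (y - x) j • ∫ ω, B1 ω m x i j ∂μ =
        ∫ ω, ∑ j, (y - x) j • B1 ω m x i j ∂μ := by
      rw [integral_finsetSum _ fun j _ => iB1' j]
      simp only [integral_smul]
    have i4 : Integrable (fun ω => B ω ν y i - B ω m x i - ∑ j, (y - x) j • B1 ω m x i j) μ :=
      i2.sub i3
    rw [e, e', ← integral_sub (iB ν y i) (iB m x i), ← integral_sub i2 i3, ← integral_sub i4 i1,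
      ← integral_mul_const]
    exact norm_integral_le_of_norm_le (hk.mul_const _)
      (Eventually.of_forall fun ω => (h ω).expand m ν γ hγ x y i)
  · intro m x i η hη
    rw [integral_sum_smul_swap (f := fun ω y j => B2 ω m x y i j) hk
      (hη.memLp.integrable (by norm_num)) (fun j => ((hB2 m i j).comp_measurable (by fun_prop :
        Measurable fun q : Ω × E d => (q.1, (x, q.2)))).aestronglyMeasurable)
      (fun y j => (hB2' m x y i j).aestronglyMeasurable) fun ω y j => (h ω).bound₂ m x y i j]
    simp only [(h _).orth m x i η hη, integral_zero]

lemma integrable_prod_of_norm_le {X : Type*} [MeasurableSpace X] {γ : Measure X}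
    [IsFiniteMeasure γ] {f : Ω → X → G} (hk : Integrable k μ)
    (hf : AEStronglyMeasurable (fun q : Ω × X => f q.1 q.2) (μ.prod γ))
    (hC : ∀ ω x, ‖f ω x‖ ≤ k ω) : Integrable (fun q : Ω × X => f q.1 q.2) (μ.prod γ) := by
  refine (hk.mul_prod (integrable_const (1 : ℝ))).mono' hf (Eventually.of_forall fun q => ?_)
  rw [mul_one]
  exact hC q.1 q.2

/-- The Laplacian commutes with integration. -/
theorem integrable_lap_and_lap_integral (hk : Integrable k μ)
    (h : ∀ ω, SecondOrder (k ω) (B ω) (B1 ω) (B2 ω))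
    (hB1 : ∀ m i j, StronglyMeasurable fun q : Ω × E d => B1 q.1 m q.2 i j)
    (hB2 : ∀ m i j, StronglyMeasurable fun q : Ω × (E d × E d) => B2 q.1 m q.2.1 q.2.2 i j)
    (ε : ℝ) (m : P2 d) :
    Integrable (fun ω => lap ε (B1 ω) (B2 ω) m) μ ∧
    lap ε (fun m x => Matrix.of fun i j => ∫ ω, B1 ω m x i j ∂μ)
      (fun m x y => Matrix.of fun i j => ∫ ω, B2 ω m x y i j ∂μ) m =
      ∫ ω, lap ε (B1 ω) (B2 ω) m ∂μ := by
  have j1 : ∀ i, Integrable (fun q : Ω × E d => B1 q.1 m q.2 i i) (μ.prod m.meas) := fun i =>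
    integrable_prod_of_norm_le (f := fun ω x => B1 ω m x i i) hk (hB1 m i i).aestronglyMeasurable
      fun ω x => (h ω).bound₁ m x i i
  have j2 : ∀ i, Integrable (fun q : Ω × (E d × E d) => B2 q.1 m q.2.1 q.2.2 i i)
      (μ.prod (m.meas.prod m.meas)) := fun i =>
    integrable_prod_of_norm_le (f := fun ω (p : E d × E d) => B2 ω m p.1 p.2 i i) hk
      (hB2 m i i).aestronglyMeasurable fun ω p => (h ω).bound₂ m p.1 p.2 i i
  have i1 := fun i => (j1 i).integral_prod_left
  have i2 := fun i => (j2 i).integral_prod_left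
  have i1' : ∀ i, Integrable (fun ω => ε • ∫ x, B1 ω m x i i ∂m.meas) μ := fun i => (i1 i).smul ε
  have i3 : ∀ i, Integrable (fun ω => ∫ x, B1 ω m x i i ∂m.meas +
      ∫ q : E d × E d, B2 ω m q.1 q.2 i i ∂(m.meas.prod m.meas)) μ := fun i => (i1 i).add (i2 i)
  have i4 : ∀ i, Integrable (fun ω => ∫ x, B1 ω m x i i ∂m.meas +
      ∫ q : E d × E d, B2 ω m q.1 q.2 i i ∂(m.meas.prod m.meas) +
      ε • ∫ x, B1 ω m x i i ∂m.meas) μ := fun i => (i3 i).add (i1' i)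
  refine ⟨integrable_finsetSum _ fun i _ => i4 i, ?_⟩
  simp only [lap, Matrix.of_apply]
  rw [integral_finsetSum _ fun i _ => i4 i]
  refine Finset.sum_congr rfl fun i _ => ?_
  rw [integral_add (i3 i) (i1' i), integral_add (i1 i) (i2 i), integral_smul,
    integral_integral_swap (f := fun ω x => B1 ω m x i i) (j1 i),
    integral_integral_swap (f := fun ω (q : E d × E d) => B2 ω m q.1 q.2 i i) (j2 i)]

end Integral

end Stability

/-! ### Plane waves and the Fourier transform -/

/-- The plane wave `e^{-2πi⟨ξ, x⟩}`. -/
def wave (ξ x : E d) : ℂ :=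
  Complex.exp (-2 * Real.pi * Complex.I * ((inner ℝ ξ x : ℝ) : ℂ))

/-- The derivative of a plane wave at `x` in the direction `v`. -/
def waveDeriv (ξ v x : E d) : ℂ :=
  -2 * Real.pi * Complex.I * ((inner ℝ ξ v : ℝ) : ℂ) * wave ξ x

/-- The Fourier symbol `-2πi ξᵢ`. -/
def freq (ξ : E d) (i : Fin d) : ℂ := -2 * Real.pi * Complex.I * (ξ i : ℂ)

/-- The Fourier transform of the measure `m`. -/
def hat (m : P2 d) (ξ : E d) : ℂ := ∫ x, wave ξ x ∂m.meas

lemma continuous_wave : Continuous fun p : E d × E d => wave p.1 p.2 := by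
  unfold wave; fun_prop

lemma continuous_wave_right (ξ : E d) : Continuous (wave ξ) := by
  unfold wave; fun_prop

lemma wave_eq (ξ x : E d) :
    wave ξ x = Complex.exp (((-(2 * Real.pi) * inner ℝ ξ x : ℝ) : ℂ) * Complex.I) := by
  rw [wave]; congr 1; push_cast; ring

lemma norm_wave (ξ x : E d) : ‖wave ξ x‖ = 1 := by
  rw [wave_eq, Complex.norm_exp_ofReal_mul_I]

lemma norm_freq_le (ξ : E d) (i : Fin d) : ‖freq ξ i‖ ≤ 2 * Real.pi * ‖ξ‖ := by
  have h := PiLp.norm_apply_le ξ i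
  rw [freq]
  simp only [norm_mul, norm_neg, Complex.norm_I, Complex.norm_real, Complex.norm_ofNat, mul_one]
  rw [Real.norm_of_nonneg Real.pi_pos.le]
  exact mul_le_mul_of_nonneg_left h (by positivity)

lemma sum_smul_freq (ξ v : E d) :
    ∑ i, (v i : ℂ) * freq ξ i = -2 * Real.pi * Complex.I * ((inner ℝ ξ v : ℝ) : ℂ) := by
  simp only [freq, PiLp.inner_apply, RCLike.inner_apply, conj_trivial]
  push_cast
  rw [Finset.mul_sum]
  exact Finset.sum_congr rfl fun i _ => by ring

lemma wave_sub_eq (ξ x y : E d) : wave ξ y - wave ξ x =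
    wave ξ x * (Complex.exp (((-(2 * Real.pi) * inner ℝ ξ (y - x) : ℝ) : ℂ) * Complex.I) - 1) := by
  rw [wave_eq, wave_eq, mul_sub, ← Complex.exp_add, inner_sub_right, mul_one]
  congr 2
  push_cast
  ring

lemma norm_exp_mul_I_sub_one_le (t : ℝ) : ‖Complex.exp ((t : ℂ) * Complex.I) - 1‖ ≤ |t| := by
  rw [mul_comm]
  exact Real.norm_exp_I_mul_ofReal_sub_one_le

/-- For `|t| ≤ 1` this is the power series estimate. For larger `t` the crude bound `2|t|` is at
most `2t²`. -/
lemma norm_exp_mul_I_sub_sub_le (t : ℝ) :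
    ‖Complex.exp ((t : ℂ) * Complex.I) - 1 - t * Complex.I‖ ≤ 2 * t ^ 2 := by
  have hn : ‖(t : ℂ) * Complex.I‖ = |t| := by simp
  rcases le_or_gt |t| 1 with h | h
  · have := Complex.norm_exp_sub_one_sub_id_le (x := (t : ℂ) * Complex.I) (hn.trans_le h)
    rw [hn, sq_abs] at this
    linarith [sq_nonneg t]
  · refine (norm_sub_le _ _).trans ?_
    rw [hn]
    have h1 := norm_exp_mul_I_sub_one_le t
    have h2 : |t| ≤ t ^ 2 := by rw [← sq_abs]; nlinarith
    linarith

lemma abs_phase_le (ξ v : E d) :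
    |-(2 * Real.pi) * inner ℝ ξ v| ≤ 2 * Real.pi * (‖ξ‖ * ‖v‖) := by
  rw [abs_mul, abs_neg, abs_of_nonneg (by positivity)]
  exact mul_le_mul_of_nonneg_left (abs_real_inner_le_norm _ _) (by positivity)

lemma norm_wave_sub_le (ξ x y : E d) :
    ‖wave ξ y - wave ξ x‖ ≤ 2 * Real.pi * ‖ξ‖ * ‖y - x‖ := by
  rw [wave_sub_eq, norm_mul, norm_wave, one_mul, mul_assoc]
  exact (norm_exp_mul_I_sub_one_le _).trans (abs_phase_le _ _)

lemma norm_wave_sub_sub_le (ξ x y : E d) :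
    ‖wave ξ y - wave ξ x - waveDeriv ξ (y - x) x‖ ≤
      8 * Real.pi ^ 2 * ‖ξ‖ ^ 2 * ‖y - x‖ ^ 2 := by
  have e : wave ξ y - wave ξ x - waveDeriv ξ (y - x) x = wave ξ x *
      (Complex.exp (((-(2 * Real.pi) * inner ℝ ξ (y - x) : ℝ) : ℂ) * Complex.I) - 1 -
        ((-(2 * Real.pi) * inner ℝ ξ (y - x) : ℝ) : ℂ) * Complex.I) := by
    rw [wave_sub_eq, waveDeriv]
    push_cast
    ring
  rw [e, norm_mul, norm_wave, one_mul]
  refine (norm_exp_mul_I_sub_sub_le _).trans ?_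
  have h := pow_le_pow_left₀ (abs_nonneg _) (abs_phase_le ξ (y - x)) 2
  rw [sq_abs] at h
  calc _ ≤ _ := mul_le_mul_of_nonneg_left h zero_le_two
    _ = _ := by ring

lemma continuous_waveDeriv (ξ : E d) : Continuous fun p : E d × E d => waveDeriv ξ p.1 p.2 := by
  unfold waveDeriv wave; fun_prop

lemma norm_waveDeriv_le (ξ v x : E d) : ‖waveDeriv ξ v x‖ ≤ 2 * Real.pi * ‖ξ‖ * ‖v‖ := by
  rw [waveDeriv, norm_mul, norm_wave, mul_one]
  simp only [norm_mul, norm_neg, Complex.norm_I, Complex.norm_real, Complex.norm_ofNat, mul_one]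
  rw [Real.norm_of_nonneg Real.pi_pos.le, mul_assoc (2 * Real.pi)]
  exact mul_le_mul_of_nonneg_left (norm_inner_le_norm _ _) (by positivity)

lemma hasFDerivAt_wave (ξ x : E d) : HasFDerivAt (wave ξ)
    (wave ξ x • ((-2 * Real.pi * Complex.I : ℂ) •
      (Complex.ofRealCLM.comp (innerSL ℝ ξ) : E d →L[ℝ] ℂ))) x := by
  have h1 : HasFDerivAt (fun x : E d => (-2 * Real.pi * Complex.I : ℂ) * ((inner ℝ ξ x : ℝ) : ℂ))
      ((-2 * Real.pi * Complex.I : ℂ) • (Complex.ofRealCLM.comp (innerSL ℝ ξ) : E d →L[ℝ] ℂ)) x :=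
    (Complex.ofRealCLM.comp (innerSL ℝ ξ)).hasFDerivAt.const_mul _
  exact h1.cexp

lemma fderiv_wave (ξ x v : E d) : fderiv ℝ (wave ξ) x v = waveDeriv ξ v x := by
  rw [(hasFDerivAt_wave ξ x).fderiv, waveDeriv]
  simp
  ring

lemma contDiff_wave (ξ : E d) : ContDiff ℝ (⊤ : ℕ∞) (wave ξ) := by
  have h1 : ContDiff ℝ (⊤ : ℕ∞) fun x : E d =>
      (-2 * Real.pi * Complex.I : ℂ) * ((inner ℝ ξ x : ℝ) : ℂ) :=
    contDiff_const.mul (Complex.ofRealCLM.comp (innerSL ℝ ξ)).contDiff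
  exact h1.cexp

lemma integrable_waveDeriv {Ω : Type*} [MeasurableSpace Ω] {μ : Measure Ω} (ξ : E d)
    {v : Ω → E d} {x : Ω → E d} (hv : Integrable v μ) (hx : AEStronglyMeasurable x μ) :
    Integrable (fun ω => waveDeriv ξ (v ω) (x ω)) μ := by
  have h1 : AEStronglyMeasurable (fun ω => waveDeriv ξ (v ω) (x ω)) μ :=
    (continuous_waveDeriv ξ).comp_aestronglyMeasurable (f := fun ω => (v ω, x ω)) (hv.1.prodMk hx)
  exact (hv.norm.const_mul (2 * Real.pi * ‖ξ‖)).mono' h1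
    (Eventually.of_forall fun ω => norm_waveDeriv_le ξ (v ω) (x ω))

/-- Plane waves are gradients, hence orthogonal to divergence free fields. -/
theorem IsDivFree.integral_waveDeriv_eq_zero {m : P2 d} {h : E d → E d} (hh : IsDivFree m h)
    (ξ : E d) : ∫ x, waveDeriv ξ (h x) x ∂m.meas = 0 := by
  -- A plane wave is complex and not compactly supported. Its image under a real functional `T` is
  -- smooth with bounded gradient, which suffices; real and imaginary parts then give the claim.
  have key : ∀ T : ℂ →L[ℝ] ℝ, T (∫ x, waveDeriv ξ (h x) x ∂m.meas) = 0 := by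
    intro T
    have hi : Integrable (fun x => waveDeriv ξ (h x) x) m.meas :=
      integrable_waveDeriv ξ (hh.memLp.integrable (by norm_num)) aestronglyMeasurable_id
    have hf : ∀ x, HasFDerivAt (fun x => T (wave ξ x)) (T.comp (fderiv ℝ (wave ξ) x)) x := fun x =>
      T.hasFDerivAt.comp x (hasFDerivAt_wave ξ x).differentiableAt.hasFDerivAt
    have h1 := hh.integral_gradient_eq_zero (u := fun x => T (wave ξ x))
      (T.contDiff.comp (contDiff_wave ξ)) (C := ‖T‖ * (2 * Real.pi * ‖ξ‖)) (fun x => by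
        rw [(hf x).fderiv]
        refine (T.opNorm_comp_le _).trans (mul_le_mul_of_nonneg_left ?_ (norm_nonneg _))
        refine ContinuousLinearMap.opNorm_le_bound _ (by positivity) fun v => ?_
        rw [fderiv_wave]
        exact norm_waveDeriv_le _ _ _)
    rw [← T.integral_comp_comm hi, ← h1]
    refine integral_congr_ae (Eventually.of_forall fun x => ?_)
    simp only
    rw [real_inner_comm, inner_gradient, (hf x).fderiv, ContinuousLinearMap.comp_apply, fderiv_wave]
  exact Complex.ext (key Complex.reCLM) (key Complex.imCLM)

lemma integrable_wave (m : P2 d) (ξ : E d) : Integrable (wave ξ) m.meas :=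
  .of_bound (continuous_wave_right ξ).aestronglyMeasurable 1
    (Eventually.of_forall fun x => (norm_wave ξ x).le)

lemma norm_hat_le (m : P2 d) (ξ : E d) : ‖hat m ξ‖ ≤ 1 := by
  refine (norm_integral_le_of_norm_le_const (C := 1)
    (Eventually.of_forall fun x => (norm_wave ξ x).le)).trans ?_
  simp

lemma continuous_hat (m : P2 d) : Continuous (hat m) := by
  refine continuous_of_dominated (bound := fun _ => 1)
    (fun ξ => (continuous_wave_right ξ).aestronglyMeasurable)
    (fun ξ => Eventually.of_forall fun x => (norm_wave ξ x).le) (integrable_const _)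
    (Eventually.of_forall fun x => ?_)
  exact continuous_wave.comp (by fun_prop : Continuous fun ξ : E d => (ξ, x))

/-- Linearity in the measure turns increments of `hat` into increments of plane waves along any
coupling. -/
lemma hat_sub_eq {m ν : P2 d} {γ : Measure (E d × E d)} (hγ : γ ∈ couplings m ν) (ξ : E d) :
    hat ν ξ - hat m ξ = ∫ p, (wave ξ p.2 - wave ξ p.1) ∂γ := by
  have i1 := memLp_one_iff_integrable.1
    (memLp_snd hγ (memLp_one_iff_integrable.2 (integrable_wave ν ξ)))
  have i2 := memLp_one_iff_integrable.1
    (memLp_fst hγ (memLp_one_iff_integrable.2 (integrable_wave m ξ)))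
  rw [integral_sub i1 i2, integral_snd hγ (integrable_wave ν ξ).1,
    integral_fst hγ (integrable_wave m ξ).1, hat, hat]

lemma norm_hat_sub_le (m ν : P2 d) (ξ : E d) :
    ‖hat ν ξ - hat m ξ‖ ≤ 2 * Real.pi * ‖ξ‖ * W2 m ν := by
  obtain ⟨γ, hγ⟩ := exists_mem_optimalCouplings m ν
  rw [hat_sub_eq hγ.1]
  refine (norm_integral_le_of_norm_le ((integrable_norm_sub hγ.1).const_mul (2 * Real.pi * ‖ξ‖))
    (Eventually.of_forall fun p => norm_wave_sub_le _ _ _)).trans ?_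
  rw [integral_const_mul]
  exact mul_le_mul_of_nonneg_left (integral_norm_le_W2 hγ) (by positivity)

lemma integrable_waveDeriv_sub {m ν : P2 d} {γ : Measure (E d × E d)} (hγ : γ ∈ couplings m ν)
    (ξ : E d) : Integrable (fun p : E d × E d => waveDeriv ξ (p.2 - p.1) p.1) γ := by
  have := isProbabilityMeasure_of_mem_couplings hγ
  exact integrable_waveDeriv ξ ((memLp_sub hγ).integrable (by norm_num)) (by fun_prop)

lemma norm_hat_sub_sub_le {m ν : P2 d} {γ : Measure (E d × E d)} (hγ : γ ∈ optimalCouplings m ν)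
    (ξ : E d) : ‖hat ν ξ - hat m ξ - ∫ p, waveDeriv ξ (p.2 - p.1) p.1 ∂γ‖ ≤
      8 * Real.pi ^ 2 * ‖ξ‖ ^ 2 * W2 m ν ^ 2 := by
  have i1 := memLp_one_iff_integrable.1
    (memLp_snd hγ.1 (memLp_one_iff_integrable.2 (integrable_wave ν ξ)))
  have i2 := memLp_one_iff_integrable.1
    (memLp_fst hγ.1 (memLp_one_iff_integrable.2 (integrable_wave m ξ)))
  have i3 : Integrable (fun p : E d × E d => wave ξ p.2 - wave ξ p.1) γ := i1.sub i2
  rw [hat_sub_eq hγ.1, ← integral_sub i3 (integrable_waveDeriv_sub hγ.1 ξ)]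
  refine (norm_integral_le_of_norm_le
    ((integrable_norm_sq_sub hγ.1).const_mul (8 * Real.pi ^ 2 * ‖ξ‖ ^ 2))
    (Eventually.of_forall fun p => norm_wave_sub_sub_le _ _ _)).trans_eq ?_
  rw [integral_const_mul, integral_eq_W2_sq hγ]

/-! ### Products of numbers in the unit disc -/

lemma norm_prod_le_one {ι : Type*} (s : Finset ι) {z : ι → ℂ} (hz : ∀ i, ‖z i‖ ≤ 1) :
    ‖∏ i ∈ s, z i‖ ≤ 1 := by
  rw [norm_prod]
  exact Finset.prod_le_one (fun _ _ => norm_nonneg _) fun i _ => hz i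

/-- Telescoping: factors are exchanged one at a time, and all the others lie in the unit disc. The
number of factors enters only through the sum of increments. -/
lemma norm_prod_sub_prod_le {ι : Type*} [DecidableEq ι] (s : Finset ι) {z w : ι → ℂ}
    (hz : ∀ i, ‖z i‖ ≤ 1) (hw : ∀ i, ‖w i‖ ≤ 1) :
    ‖∏ i ∈ s, w i - ∏ i ∈ s, z i‖ ≤ ∑ i ∈ s, ‖w i - z i‖ := by
  induction s using Finset.induction_on with
  | empty => simp
  | insert a s ha ih =>
    rw [Finset.prod_insert ha, Finset.prod_insert ha, Finset.sum_insert ha]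
    have e : w a * ∏ i ∈ s, w i - z a * ∏ i ∈ s, z i =
        (w a - z a) * ∏ i ∈ s, w i + z a * (∏ i ∈ s, w i - ∏ i ∈ s, z i) := by ring
    rw [e]
    refine (norm_add_le _ _).trans (add_le_add ?_ ?_)
    · rw [norm_mul]
      exact mul_le_of_le_one_right (norm_nonneg _) (norm_prod_le_one s hw)
    · rw [norm_mul]
      exact (mul_le_of_le_one_left (norm_nonneg _) (hz a)).trans ih

/-- In the induction the new error is the old one times `z a`, plus the cross term `(w a - z a)(∏ w
- ∏ z)`; with `s` the old sum and `t = ‖w a - z a‖`, this uses `s² + t s ≤ (s + t)²`. -/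
lemma norm_prod_sub_prod_sub_le {ι : Type*} [DecidableEq ι] (s : Finset ι) {z w : ι → ℂ}
    (hz : ∀ i, ‖z i‖ ≤ 1) (hw : ∀ i, ‖w i‖ ≤ 1) :
    ‖∏ i ∈ s, w i - ∏ i ∈ s, z i - ∑ i ∈ s, (w i - z i) * ∏ l ∈ s.erase i, z l‖ ≤
      (∑ i ∈ s, ‖w i - z i‖) ^ 2 := by
  induction s using Finset.induction_on with
  | empty => simp
  | insert a s ha ih =>
    rw [Finset.prod_insert ha, Finset.prod_insert ha, Finset.sum_insert ha, Finset.sum_insert ha,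
      Finset.erase_insert ha]
    have e1 : ∑ i ∈ s, (w i - z i) * ∏ l ∈ (insert a s).erase i, z l =
        z a * ∑ i ∈ s, (w i - z i) * ∏ l ∈ s.erase i, z l := by
      rw [Finset.mul_sum]
      refine Finset.sum_congr rfl fun i hi => ?_
      have hia : i ≠ a := fun h => ha (h ▸ hi)
      rw [Finset.erase_insert_of_ne hia.symm, Finset.prod_insert (by simp [ha])]
      ring
    rw [e1]
    have e2 : w a * ∏ i ∈ s, w i - z a * ∏ i ∈ s, z i - ((w a - z a) * ∏ i ∈ s, z i +
        z a * ∑ i ∈ s, (w i - z i) * ∏ l ∈ s.erase i, z l) =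
        z a * (∏ i ∈ s, w i - ∏ i ∈ s, z i - ∑ i ∈ s, (w i - z i) * ∏ l ∈ s.erase i, z l) +
          (w a - z a) * (∏ i ∈ s, w i - ∏ i ∈ s, z i) := by ring
    rw [e2]
    have h1 : ‖z a * (∏ i ∈ s, w i - ∏ i ∈ s, z i -
        ∑ i ∈ s, (w i - z i) * ∏ l ∈ s.erase i, z l)‖ ≤ (∑ i ∈ s, ‖w i - z i‖) ^ 2 := by
      rw [norm_mul]
      exact (mul_le_of_le_one_left (norm_nonneg _) (hz a)).trans ih
    have h2 : ‖(w a - z a) * (∏ i ∈ s, w i - ∏ i ∈ s, z i)‖ ≤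
        ‖w a - z a‖ * ∑ i ∈ s, ‖w i - z i‖ := by
      rw [norm_mul]
      exact mul_le_mul_of_nonneg_left (norm_prod_sub_prod_le s hz hw) (norm_nonneg _)
    refine (norm_add_le _ _).trans ((add_le_add h1 h2).trans ?_)
    have h3 : 0 ≤ ∑ i ∈ s, ‖w i - z i‖ := Finset.sum_nonneg fun _ _ => norm_nonneg _
    nlinarith [norm_nonneg (w a - z a), mul_nonneg (norm_nonneg (w a - z a)) h3]

/-! ### Expansion of a single Fourier coefficient -/

section Modes

variable {k : ℕ} (ξ : Fin k → E d)

/-- `∑ⱼ |ξⱼ|`. -/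
def freqSize : ℝ := ∑ j, ‖ξ j‖

/-- A combination of frequencies. -/
def freqSum (i : Fin d) (X : Fin k → ℂ) : ℂ := 1 / (k : ℂ) * ∑ j, freq (ξ j) i * X j

/-- Products of Fourier transforms. -/
def hatProd (s : Finset (Fin k)) (m : P2 d) : ℂ := ∏ j ∈ s, hat m (ξ j)

/-- The derivative of `hatProd` in the direction of a displacement `v` of the mass at `x`. -/
def hatProdDeriv (s : Finset (Fin k)) (m : P2 d) (v x : E d) : ℂ :=
  ∑ l ∈ s, waveDeriv (ξ l) v x * hatProd ξ (s.erase l) m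

/-- The Fourier coefficient `F^k_ξ`. -/
def modeU (m : P2 d) : ℂ := 1 / (k : ℂ) * hatProd ξ Finset.univ m

/-- The gradient of `F^k_ξ`. -/
def modeA (m : P2 d) (x : E d) (i : Fin d) : ℂ :=
  freqSum ξ i fun j => wave (ξ j) x * hatProd ξ (Finset.univ.erase j) m

/-- The spatial derivative of the gradient of `F^k_ξ`. -/
def modeA1 (m : P2 d) (x : E d) : Matrix (Fin d) (Fin d) ℂ :=
  Matrix.of fun i i' => freqSum ξ i fun j =>
    freq (ξ j) i' * (wave (ξ j) x * hatProd ξ (Finset.univ.erase j) m)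

/-- The measure derivative of the gradient of `F^k_ξ`. -/
def modeA2 (m : P2 d) (x y : E d) : Matrix (Fin d) (Fin d) ℂ :=
  Matrix.of fun i i' => freqSum ξ i fun j => wave (ξ j) x *
    ∑ l ∈ Finset.univ.erase j, freq (ξ l) i' *
      (wave (ξ l) y * hatProd ξ ((Finset.univ.erase j).erase l) m)

lemma freqSize_nonneg : 0 ≤ freqSize ξ := Finset.sum_nonneg fun _ _ => norm_nonneg _

lemma norm_le_freqSize (j : Fin k) : ‖ξ j‖ ≤ freqSize ξ :=
  Finset.single_le_sum (f := fun j => ‖ξ j‖) (fun _ _ => norm_nonneg _) (Finset.mem_univ j)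

lemma sum_norm_le_freqSize (s : Finset (Fin k)) : ∑ j ∈ s, ‖ξ j‖ ≤ freqSize ξ :=
  Finset.sum_le_sum_of_subset_of_nonneg (Finset.subset_univ s) fun _ _ _ => norm_nonneg _

lemma sum_norm_sq_le_freqSize (s : Finset (Fin k)) : ∑ j ∈ s, ‖ξ j‖ ^ 2 ≤ freqSize ξ ^ 2 :=
  (Finset.sum_sq_le_sq_sum_of_nonneg fun _ _ => norm_nonneg _).trans
    (pow_le_pow_left₀ (Finset.sum_nonneg fun _ _ => norm_nonneg _) (sum_norm_le_freqSize ξ s) 2)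

lemma freqSum_sub (i : Fin d) (X Y : Fin k → ℂ) :
    freqSum ξ i X - freqSum ξ i Y = freqSum ξ i fun j => X j - Y j := by
  simp only [freqSum, mul_sub, Finset.sum_sub_distrib]

lemma norm_freqSum_le {i : Fin d} {X : Fin k → ℂ} {B : ℝ} (h : ∀ j, ‖X j‖ ≤ B) (hB : 0 ≤ B) :
    ‖freqSum ξ i X‖ ≤ 1 / (k : ℝ) * (2 * Real.pi * freqSize ξ * B) := by
  rw [freqSum, norm_mul, norm_div, norm_one, Complex.norm_natCast]
  refine mul_le_mul_of_nonneg_left ((norm_sum_le _ _).trans ?_) (by positivity)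
  rw [freqSize, Finset.mul_sum, Finset.sum_mul]
  refine Finset.sum_le_sum fun j _ => ?_
  rw [norm_mul]
  exact mul_le_mul (norm_freq_le _ _) (h j) (norm_nonneg _) (by positivity)

lemma norm_sum_freq_mul_le {i : Fin d} (s : Finset (Fin k)) {X : Fin k → ℂ} {B : ℝ}
    (h : ∀ j, ‖X j‖ ≤ B) (hB : 0 ≤ B) :
    ‖∑ j ∈ s, freq (ξ j) i * X j‖ ≤ 2 * Real.pi * freqSize ξ * B := by
  refine (norm_sum_le _ _).trans ?_
  calc ∑ j ∈ s, ‖freq (ξ j) i * X j‖ ≤ ∑ j ∈ s, 2 * Real.pi * ‖ξ j‖ * B := by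
        refine Finset.sum_le_sum fun j _ => ?_
        rw [norm_mul]
        exact mul_le_mul (norm_freq_le _ _) (h j) (norm_nonneg _) (by positivity)
    _ = 2 * Real.pi * (∑ j ∈ s, ‖ξ j‖) * B := by rw [Finset.mul_sum, Finset.sum_mul]
    _ ≤ _ := by
      have := sum_norm_le_freqSize ξ s
      gcongr

lemma norm_freq_le_freqSize (j : Fin k) (i : Fin d) :
    ‖freq (ξ j) i‖ ≤ 2 * Real.pi * freqSize ξ :=
  (norm_freq_le _ _).trans (mul_le_mul_of_nonneg_left (norm_le_freqSize ξ j) (by positivity))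

lemma norm_hatProd_le (s : Finset (Fin k)) (m : P2 d) : ‖hatProd ξ s m‖ ≤ 1 :=
  norm_prod_le_one s fun _ => norm_hat_le m _

lemma norm_wave_mul_hatProd_le (η : E d) (s : Finset (Fin k)) (m : P2 d) (x : E d) :
    ‖wave η x * hatProd ξ s m‖ ≤ 1 := by
  rw [norm_mul, norm_wave, one_mul]; exact norm_hatProd_le ξ s m

lemma sum_norm_hat_sub_le (s : Finset (Fin k)) (m ν : P2 d) :
    ∑ j ∈ s, ‖hat ν (ξ j) - hat m (ξ j)‖ ≤ 2 * Real.pi * freqSize ξ * W2 m ν := by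
  have hW := W2_nonneg m ν
  calc _ ≤ ∑ j ∈ s, 2 * Real.pi * ‖ξ j‖ * W2 m ν :=
        Finset.sum_le_sum fun j _ => norm_hat_sub_le m ν _
    _ = 2 * Real.pi * (∑ j ∈ s, ‖ξ j‖) * W2 m ν := by rw [Finset.mul_sum, Finset.sum_mul]
    _ ≤ _ := by
      have := sum_norm_le_freqSize ξ s
      gcongr

lemma norm_hatProd_sub_le (s : Finset (Fin k)) (m ν : P2 d) :
    ‖hatProd ξ s ν - hatProd ξ s m‖ ≤ 2 * Real.pi * freqSize ξ * W2 m ν :=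
  (norm_prod_sub_prod_le s (fun _ => norm_hat_le m _) fun _ => norm_hat_le ν _).trans
    (sum_norm_hat_sub_le ξ s m ν)

lemma integrable_hatProdDeriv {m ν : P2 d} {γ : Measure (E d × E d)} (hγ : γ ∈ couplings m ν)
    (s : Finset (Fin k)) :
    Integrable (fun p : E d × E d => hatProdDeriv ξ s m (p.2 - p.1) p.1) γ :=
  integrable_finsetSum _ fun l _ => (integrable_waveDeriv_sub hγ (ξ l)).mul_const _

lemma norm_hatProd_sub_sub_le {m ν : P2 d} {γ : Measure (E d × E d)}
    (hγ : γ ∈ optimalCouplings m ν) (s : Finset (Fin k)) :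
    ‖hatProd ξ s ν - hatProd ξ s m - ∫ p, hatProdDeriv ξ s m (p.2 - p.1) p.1 ∂γ‖ ≤
      12 * Real.pi ^ 2 * freqSize ξ ^ 2 * W2 m ν ^ 2 := by
  have hW := W2_nonneg m ν
  have hS := freqSize_nonneg ξ
  have e : ∫ p, hatProdDeriv ξ s m (p.2 - p.1) p.1 ∂γ =
      ∑ l ∈ s, (∫ p, waveDeriv (ξ l) (p.2 - p.1) p.1 ∂γ) * hatProd ξ (s.erase l) m := by
    simp only [hatProdDeriv]
    rw [integral_finsetSum _ fun l _ => (integrable_waveDeriv_sub hγ.1 (ξ l)).mul_const _]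
    exact Finset.sum_congr rfl fun l _ => integral_mul_const _ _
  -- Two errors: linearizing the product in its factors costs `(2π S W)²`, with `S = freqSize ξ` and
  -- `W = W2 m ν`, and linearizing each factor in the measure costs `8π² S² W²` in total. Together
  -- they give 12.
  have e2 : hatProd ξ s ν - hatProd ξ s m - ∫ p, hatProdDeriv ξ s m (p.2 - p.1) p.1 ∂γ =
      (hatProd ξ s ν - hatProd ξ s m -
        ∑ l ∈ s, (hat ν (ξ l) - hat m (ξ l)) * hatProd ξ (s.erase l) m) +
      ∑ l ∈ s, (hat ν (ξ l) - hat m (ξ l) - ∫ p, waveDeriv (ξ l) (p.2 - p.1) p.1 ∂γ) *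
        hatProd ξ (s.erase l) m := by
    rw [e]
    simp only [sub_mul _ (∫ p, waveDeriv _ _ _ ∂γ), Finset.sum_sub_distrib]
    ring
  have h1 : ‖hatProd ξ s ν - hatProd ξ s m -
      ∑ l ∈ s, (hat ν (ξ l) - hat m (ξ l)) * hatProd ξ (s.erase l) m‖ ≤
      (2 * Real.pi * freqSize ξ * W2 m ν) ^ 2 :=
    (norm_prod_sub_prod_sub_le s (fun _ => norm_hat_le m _) fun _ => norm_hat_le ν _).trans
      (pow_le_pow_left₀ (Finset.sum_nonneg fun _ _ => norm_nonneg _)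
        (sum_norm_hat_sub_le ξ s m ν) 2)
  have h2 : ‖∑ l ∈ s, (hat ν (ξ l) - hat m (ξ l) - ∫ p, waveDeriv (ξ l) (p.2 - p.1) p.1 ∂γ) *
        hatProd ξ (s.erase l) m‖ ≤ 8 * Real.pi ^ 2 * freqSize ξ ^ 2 * W2 m ν ^ 2 := by
    refine (norm_sum_le _ _).trans ?_
    calc _ ≤ ∑ l ∈ s, 8 * Real.pi ^ 2 * ‖ξ l‖ ^ 2 * W2 m ν ^ 2 := by
          refine Finset.sum_le_sum fun l _ => ?_
          rw [norm_mul]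
          exact (mul_le_of_le_one_right (norm_nonneg _) (norm_hatProd_le ξ _ m)).trans
            (norm_hat_sub_sub_le hγ (ξ l))
      _ = 8 * Real.pi ^ 2 * (∑ l ∈ s, ‖ξ l‖ ^ 2) * W2 m ν ^ 2 := by
          rw [Finset.mul_sum, Finset.sum_mul]
      _ ≤ _ := by
        have := sum_norm_sq_le_freqSize ξ s
        gcongr
  rw [e2]
  refine (norm_add_le _ _).trans ((add_le_add h1 h2).trans_eq ?_)
  ring

lemma norm_wave_mul_hatProd_sub_le (j : Fin k) (s : Finset (Fin k)) (m ν : P2 d) (x y : E d) :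
    ‖wave (ξ j) y * hatProd ξ s ν - wave (ξ j) x * hatProd ξ s m‖ ≤
      2 * Real.pi * freqSize ξ * (‖y - x‖ + W2 m ν) := by
  have e : wave (ξ j) y * hatProd ξ s ν - wave (ξ j) x * hatProd ξ s m =
      (wave (ξ j) y - wave (ξ j) x) * hatProd ξ s ν +
        wave (ξ j) x * (hatProd ξ s ν - hatProd ξ s m) := by ring
  rw [e, mul_add]
  refine (norm_add_le _ _).trans (add_le_add ?_ ?_)
  · rw [norm_mul]
    refine (mul_le_of_le_one_right (norm_nonneg _) (norm_hatProd_le ξ _ ν)).trans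
      ((norm_wave_sub_le _ _ _).trans ?_)
    have := norm_le_freqSize ξ j
    gcongr
  · rw [norm_mul, norm_wave, one_mul]
    exact norm_hatProd_sub_le ξ s m ν

/-- Contraction with a displacement brings the coordinate form used in `FirstOrder` and
`SecondOrder` back to directional derivatives, to which the product estimates apply. -/
lemma sum_smul_modeA (m : P2 d) (x v : E d) :
    ∑ i, v i • modeA ξ m x i = 1 / (k : ℂ) * hatProdDeriv ξ Finset.univ m v x := by
  simp only [modeA, freqSum, hatProdDeriv, Complex.real_smul, Finset.mul_sum]
  rw [Finset.sum_comm]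
  refine Finset.sum_congr rfl fun j _ => ?_
  rw [waveDeriv, ← sum_smul_freq, Finset.sum_mul, Finset.sum_mul, Finset.mul_sum]
  exact Finset.sum_congr rfl fun i _ => by ring

lemma sum_smul_modeA1 (m : P2 d) (x v : E d) (i : Fin d) :
    ∑ i', v i' • modeA1 ξ m x i i' = freqSum ξ i fun j =>
      waveDeriv (ξ j) v x * hatProd ξ (Finset.univ.erase j) m := by
  simp only [modeA1, Matrix.of_apply, freqSum, Complex.real_smul, Finset.mul_sum]
  rw [Finset.sum_comm]
  refine Finset.sum_congr rfl fun j _ => ?_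
  rw [waveDeriv, ← sum_smul_freq, Finset.sum_mul, Finset.sum_mul, Finset.mul_sum, Finset.mul_sum]
  exact Finset.sum_congr rfl fun i _ => by ring

lemma sum_smul_modeA2 (m : P2 d) (x y v : E d) (i : Fin d) :
    ∑ i', v i' • modeA2 ξ m x y i i' = freqSum ξ i fun j =>
      wave (ξ j) x * hatProdDeriv ξ (Finset.univ.erase j) m v y := by
  simp only [modeA2, Matrix.of_apply, freqSum, hatProdDeriv, Complex.real_smul, Finset.mul_sum]
  rw [Finset.sum_comm]
  refine Finset.sum_congr rfl fun j _ => ?_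
  rw [Finset.sum_comm]
  refine Finset.sum_congr rfl fun l _ => ?_
  rw [waveDeriv, ← sum_smul_freq]
  simp only [Finset.sum_mul, Finset.mul_sum]
  exact Finset.sum_congr rfl fun i _ => by ring

/-- Size of the first order expansion of `F^k_ξ`. -/
def modeK1 : ℝ := 1 / (k : ℝ) *
  (1 + 2 * Real.pi * freqSize ξ + 12 * Real.pi ^ 2 * freqSize ξ ^ 2)

/-- Size of the second order expansion of `F^k_ξ`. -/
def modeK2 : ℝ := 1 / (k : ℝ) *
  (4 * Real.pi ^ 2 * freqSize ξ ^ 2 + 28 * Real.pi ^ 3 * freqSize ξ ^ 3)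

lemma integral_hatProdDeriv_eq_zero {m : P2 d} {h : E d → E d} (hh : IsDivFree m h)
    (s : Finset (Fin k)) : ∫ x, hatProdDeriv ξ s m (h x) x ∂m.meas = 0 := by
  have hi : ∀ l ∈ s, Integrable
      (fun x => waveDeriv (ξ l) (h x) x * hatProd ξ (s.erase l) m) m.meas := fun l _ =>
    (integrable_waveDeriv (ξ l) (hh.memLp.integrable (by norm_num))
      aestronglyMeasurable_id).mul_const _
  simp only [hatProdDeriv]
  rw [integral_finsetSum _ hi]
  refine Finset.sum_eq_zero fun l _ => ?_
  rw [integral_mul_const, hh.integral_waveDeriv_eq_zero, zero_mul]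

theorem firstOrder_mode : FirstOrder (modeK1 ξ) (modeU ξ) (modeA ξ) := by
  have hS := freqSize_nonneg ξ
  have hpi := Real.pi_pos
  have hk : (0 : ℝ) ≤ 1 / (k : ℝ) := by positivity
  have hnorm : ‖(1 / (k : ℂ))‖ = 1 / (k : ℝ) := by
    rw [norm_div, norm_one, Complex.norm_natCast]
  constructor
  · intro m
    rw [modeU, norm_mul, hnorm]
    refine mul_le_mul_of_nonneg_left ((norm_hatProd_le ξ _ m).trans ?_) hk
    have : 0 ≤ 2 * Real.pi * freqSize ξ + 12 * Real.pi ^ 2 * freqSize ξ ^ 2 := by positivity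
    linarith
  · intro m x i
    refine (norm_freqSum_le ξ (fun j => norm_wave_mul_hatProd_le ξ _ _ m x) zero_le_one).trans ?_
    refine mul_le_mul_of_nonneg_left ?_ hk
    have : 0 ≤ 12 * Real.pi ^ 2 * freqSize ξ ^ 2 := by positivity
    linarith
  · intro m ν x y i
    have hW := W2_nonneg m ν
    rw [modeA, modeA, freqSum_sub]
    refine (norm_freqSum_le ξ (fun j => norm_wave_mul_hatProd_sub_le ξ j _ m ν x y)
      (by positivity)).trans ?_
    rw [modeK1, mul_assoc (1 / (k : ℝ)) (1 + _ + _)]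
    refine mul_le_mul_of_nonneg_left ?_ hk
    have h1 : 0 ≤ ‖y - x‖ + W2 m ν := by positivity
    have h2 : 2 * Real.pi * freqSize ξ * (2 * Real.pi * freqSize ξ) ≤
        1 + 2 * Real.pi * freqSize ξ + 12 * Real.pi ^ 2 * freqSize ξ ^ 2 := by
      have h3 : 0 ≤ Real.pi * freqSize ξ := by positivity
      have h4 : 0 ≤ Real.pi ^ 2 * freqSize ξ ^ 2 := by positivity
      nlinarith
    calc _ = 2 * Real.pi * freqSize ξ * (2 * Real.pi * freqSize ξ) * (‖y - x‖ + W2 m ν) := by ring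
      _ ≤ _ := mul_le_mul_of_nonneg_right h2 h1
  · intro m ν γ hγ
    simp only [sum_smul_modeA]
    rw [integral_const_mul, modeU, modeU, ← mul_sub, ← mul_sub, norm_mul, hnorm, modeK1, mul_assoc]
    refine mul_le_mul_of_nonneg_left ((norm_hatProd_sub_sub_le ξ hγ _).trans ?_) hk
    refine mul_le_mul_of_nonneg_right ?_ (sq_nonneg _)
    have h3 : 0 ≤ 2 * Real.pi * freqSize ξ := by positivity
    linarith
  · intro m h hh
    simp only [sum_smul_modeA]
    rw [integral_const_mul, integral_hatProdDeriv_eq_zero ξ hh, mul_zero]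

lemma norm_sum_freq_wave_sub_le (i : Fin d) (j : Fin k) (m ν : P2 d) (x x' y y' : E d) :
    ‖wave (ξ j) y * ∑ l ∈ Finset.univ.erase j, freq (ξ l) i *
        (wave (ξ l) y' * hatProd ξ ((Finset.univ.erase j).erase l) ν) -
      wave (ξ j) x * ∑ l ∈ Finset.univ.erase j, freq (ξ l) i *
        (wave (ξ l) x' * hatProd ξ ((Finset.univ.erase j).erase l) m)‖ ≤
      4 * Real.pi ^ 2 * freqSize ξ ^ 2 * (‖y - x‖ + ‖y' - x'‖ + W2 m ν) := by
  have hS := freqSize_nonneg ξ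
  have hW := W2_nonneg m ν
  set Q : P2 d → E d → ℂ := fun m x' => ∑ l ∈ Finset.univ.erase j, freq (ξ l) i *
        (wave (ξ l) x' * hatProd ξ ((Finset.univ.erase j).erase l) m)
  have hQ : ‖Q ν y'‖ ≤ 2 * Real.pi * freqSize ξ * 1 := norm_sum_freq_mul_le ξ _
    (fun l => norm_wave_mul_hatProd_le ξ _ _ ν y') zero_le_one
  have hQ' : ‖Q ν y' - Q m x'‖ ≤
      2 * Real.pi * freqSize ξ * (2 * Real.pi * freqSize ξ * (‖y' - x'‖ + W2 m ν)) := by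
    simp only [Q]
    rw [← Finset.sum_sub_distrib]
    simp only [← mul_sub]
    exact norm_sum_freq_mul_le ξ _
      (fun l => norm_wave_mul_hatProd_sub_le ξ l _ m ν x' y') (by positivity)
  have e : wave (ξ j) y * Q ν y' - wave (ξ j) x * Q m x' =
      (wave (ξ j) y - wave (ξ j) x) * Q ν y' + wave (ξ j) x * (Q ν y' - Q m x') := by ring
  change ‖wave (ξ j) y * Q ν y' - wave (ξ j) x * Q m x'‖ ≤ _
  rw [e]
  have h1 : ‖(wave (ξ j) y - wave (ξ j) x) * Q ν y'‖ ≤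
      2 * Real.pi * freqSize ξ * ‖y - x‖ * (2 * Real.pi * freqSize ξ * 1) := by
    rw [norm_mul]
    refine mul_le_mul ((norm_wave_sub_le _ _ _).trans ?_) hQ (norm_nonneg _) (by positivity)
    have := norm_le_freqSize ξ j
    gcongr
  have h2 : ‖wave (ξ j) x * (Q ν y' - Q m x')‖ ≤
      2 * Real.pi * freqSize ξ * (2 * Real.pi * freqSize ξ * (‖y' - x'‖ + W2 m ν)) := by
    rw [norm_mul, norm_wave, one_mul]
    exact hQ'
  refine (norm_add_le _ _).trans ((add_le_add h1 h2).trans_eq ?_)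
  ring

lemma norm_wave_mul_hatProd_sub_sub_le {m ν : P2 d} {γ : Measure (E d × E d)}
    (hγ : γ ∈ optimalCouplings m ν) (j : Fin k) (s : Finset (Fin k)) (x y : E d) :
    ‖wave (ξ j) y * hatProd ξ s ν - wave (ξ j) x * hatProd ξ s m -
        waveDeriv (ξ j) (y - x) x * hatProd ξ s m -
        wave (ξ j) x * ∫ p, hatProdDeriv ξ s m (p.2 - p.1) p.1 ∂γ‖ ≤
      14 * Real.pi ^ 2 * freqSize ξ ^ 2 * (‖y - x‖ ^ 2 + W2 m ν ^ 2) := by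
  have hS := freqSize_nonneg ξ
  have hW := W2_nonneg m ν
  have hj := norm_le_freqSize ξ j
  set D := ∫ p, hatProdDeriv ξ s m (p.2 - p.1) p.1 ∂γ
  -- Product rule with remainder. The cross term is at most `4π² S² ‖y - x‖ W ≤ 2π² S² (‖y - x‖² +
  -- W²)`, with `S = freqSize ξ` and `W = W2 m ν`; added to the constants 8 and 12 of the other two
  -- it stays below 14.
  have e : wave (ξ j) y * hatProd ξ s ν - wave (ξ j) x * hatProd ξ s m -
        waveDeriv (ξ j) (y - x) x * hatProd ξ s m - wave (ξ j) x * D =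
      (wave (ξ j) y - wave (ξ j) x - waveDeriv (ξ j) (y - x) x) * hatProd ξ s m +
        wave (ξ j) x * (hatProd ξ s ν - hatProd ξ s m - D) +
        (wave (ξ j) y - wave (ξ j) x) * (hatProd ξ s ν - hatProd ξ s m) := by ring
  have h1 : ‖(wave (ξ j) y - wave (ξ j) x - waveDeriv (ξ j) (y - x) x) * hatProd ξ s m‖ ≤
      8 * Real.pi ^ 2 * freqSize ξ ^ 2 * ‖y - x‖ ^ 2 := by
    rw [norm_mul]
    refine (mul_le_of_le_one_right (norm_nonneg _) (norm_hatProd_le ξ _ m)).trans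
      ((norm_wave_sub_sub_le _ _ _).trans ?_)
    gcongr
  have h2 : ‖wave (ξ j) x * (hatProd ξ s ν - hatProd ξ s m - D)‖ ≤
      12 * Real.pi ^ 2 * freqSize ξ ^ 2 * W2 m ν ^ 2 := by
    rw [norm_mul, norm_wave, one_mul]
    exact norm_hatProd_sub_sub_le ξ hγ s
  have h3 : ‖(wave (ξ j) y - wave (ξ j) x) * (hatProd ξ s ν - hatProd ξ s m)‖ ≤
      2 * Real.pi * freqSize ξ * ‖y - x‖ * (2 * Real.pi * freqSize ξ * W2 m ν) := by
    rw [norm_mul]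
    refine mul_le_mul ((norm_wave_sub_le _ _ _).trans ?_) (norm_hatProd_sub_le ξ s m ν)
      (norm_nonneg _) (by positivity)
    gcongr
  have h4 : 0 ≤ Real.pi ^ 2 * freqSize ξ ^ 2 * (‖y - x‖ - W2 m ν) ^ 2 := by positivity
  have h5 : 0 ≤ Real.pi ^ 2 * freqSize ξ ^ 2 * ‖y - x‖ ^ 2 := by positivity
  rw [e]
  refine (norm_add_le _ _).trans ((add_le_add (norm_add_le _ _) le_rfl).trans
    ((add_le_add (add_le_add h1 h2) h3).trans ?_))
  nlinarith

theorem secondOrder_mode : SecondOrder (modeK2 ξ) (modeA ξ) (modeA1 ξ) (modeA2 ξ) := by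
  have hS := freqSize_nonneg ξ
  have hpi := Real.pi_pos
  have hk : (0 : ℝ) ≤ 1 / (k : ℝ) := by positivity
  have h2 : 0 ≤ Real.pi ^ 2 * freqSize ξ ^ 2 := by positivity
  have h3 : 0 ≤ Real.pi ^ 3 * freqSize ξ ^ 3 := by positivity
  have hb : 1 / (k : ℝ) * (2 * Real.pi * freqSize ξ * (2 * Real.pi * freqSize ξ * 1)) ≤
      modeK2 ξ := mul_le_mul_of_nonneg_left (by nlinarith) hk
  have hl : ∀ t : ℝ, 0 ≤ t → 1 / (k : ℝ) * (2 * Real.pi * freqSize ξ *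
      (4 * Real.pi ^ 2 * freqSize ξ ^ 2 * t)) ≤ modeK2 ξ * t := by
    intro t ht
    have := mul_le_mul_of_nonneg_left (mul_le_mul_of_nonneg_right (by nlinarith :
      8 * (Real.pi ^ 3 * freqSize ξ ^ 3) ≤
        4 * Real.pi ^ 2 * freqSize ξ ^ 2 + 28 * Real.pi ^ 3 * freqSize ξ ^ 3) ht) hk
    rw [modeK2, mul_assoc (1 / (k : ℝ)) (_ + _)]
    refine le_trans (le_of_eq ?_) this
    ring
  constructor
  · intro m x i i'
    refine (norm_freqSum_le ξ (B := 2 * Real.pi * freqSize ξ * 1) (fun j => ?_)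
      (by positivity)).trans hb
    rw [norm_mul]
    exact mul_le_mul (norm_freq_le_freqSize ξ j i') (norm_wave_mul_hatProd_le ξ _ _ m x)
      (norm_nonneg _) (by positivity)
  · intro m x y i i'
    refine (norm_freqSum_le ξ (B := 2 * Real.pi * freqSize ξ * 1) (fun j => ?_)
      (by positivity)).trans hb
    rw [norm_mul, norm_wave, one_mul]
    exact norm_sum_freq_mul_le ξ _ (fun l => norm_wave_mul_hatProd_le ξ _ _ m y) zero_le_one
  · intro m ν x y i i'
    have hW := W2_nonneg m ν
    simp only [modeA1, Matrix.of_apply]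
    rw [freqSum_sub]
    simp only [← mul_sub]
    refine (norm_freqSum_le ξ (B := 4 * Real.pi ^ 2 * freqSize ξ ^ 2 * (‖y - x‖ + W2 m ν))
      (fun j => ?_) (by positivity)).trans (hl _ (by positivity))
    rw [norm_mul]
    refine (mul_le_mul (norm_freq_le_freqSize ξ j i')
      (norm_wave_mul_hatProd_sub_le ξ j _ m ν x y) (norm_nonneg _) (by positivity)).trans_eq ?_
    ring
  · intro m ν x x' y y' i i'
    have hW := W2_nonneg m ν
    simp only [modeA2, Matrix.of_apply]
    rw [freqSum_sub]
    exact (norm_freqSum_le ξ (fun j => norm_sum_freq_wave_sub_le ξ i' j m ν x x' y y')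
      (by positivity)).trans (hl _ (by positivity))
  · intro m ν γ hγ x y i
    simp only [sum_smul_modeA1, sum_smul_modeA2]
    have e : ∫ p : E d × E d, freqSum ξ i (fun j => wave (ξ j) x *
          hatProdDeriv ξ (Finset.univ.erase j) m (p.2 - p.1) p.1) ∂γ =
        freqSum ξ i fun j => wave (ξ j) x *
          ∫ p, hatProdDeriv ξ (Finset.univ.erase j) m (p.2 - p.1) p.1 ∂γ := by
      simp only [freqSum]
      rw [integral_const_mul, integral_finsetSum _ fun j _ =>
        ((integrable_hatProdDeriv ξ hγ.1 _).const_mul _).const_mul _]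
      simp only [integral_const_mul]
    rw [e, modeA, modeA, freqSum_sub, freqSum_sub, freqSum_sub]
    -- The outer frequency contributes `2π * freqSize ξ` and each factor `14π² * freqSize ξ ^ 2`,
    -- whence the 28 in `modeK2`.
    refine (norm_freqSum_le ξ (fun j => norm_wave_mul_hatProd_sub_sub_le ξ hγ j _ x y)
      (by positivity)).trans ?_
    rw [modeK2, mul_assoc (1 / (k : ℝ)) (_ + _)]
    refine mul_le_mul_of_nonneg_left ?_ hk
    have h4 : 0 ≤ ‖y - x‖ ^ 2 + W2 m ν ^ 2 := by positivity
    have h5 := mul_le_mul_of_nonneg_right (by nlinarith : 28 * (Real.pi ^ 3 * freqSize ξ ^ 3) ≤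
        4 * Real.pi ^ 2 * freqSize ξ ^ 2 + 28 * Real.pi ^ 3 * freqSize ξ ^ 3) h4
    refine le_trans (le_of_eq ?_) h5
    ring
  · intro m x i h hh
    simp only [sum_smul_modeA2]
    have hi : ∀ j, Integrable
        (fun y => hatProdDeriv ξ (Finset.univ.erase j) m (h y) y) m.meas := fun j =>
      integrable_finsetSum _ fun l _ => (integrable_waveDeriv (ξ l)
        (hh.memLp.integrable (by norm_num)) aestronglyMeasurable_id).mul_const _
    simp only [freqSum]
    rw [integral_const_mul, integral_finsetSum _ fun j _ => ((hi j).const_mul _).const_mul _]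
    simp only [integral_const_mul, integral_hatProdDeriv_eq_zero ξ hh, mul_zero,
      Finset.sum_const_zero]

end Modes

/-! ### Weighted moments -/

/-- `w g` is integrable, with integral at most `B`. -/
structure MomentLE {Ω : Type*} [MeasurableSpace Ω] (μ : Measure Ω) (w g : Ω → ℝ) (B : ℝ) :
    Prop where
  integrable : Integrable (fun ω => w ω * g ω) μ
  integral_le : ∫ ω, w ω * g ω ∂μ ≤ B

lemma momentLE_iff {Ω : Type*} [MeasurableSpace Ω] {μ : Measure Ω} {w g : Ω → ℝ} {B : ℝ} :
    MomentLE μ w g B ↔ Integrable (fun ω => w ω * g ω) μ ∧ ∫ ω, w ω * g ω ∂μ ≤ B :=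
  ⟨fun h => ⟨h.1, h.2⟩, fun h => ⟨h.1, h.2⟩⟩

namespace MomentLE

variable {Ω : Type*} [MeasurableSpace Ω] {μ : Measure Ω} {w g g' : Ω → ℝ} {B B' c : ℝ}

lemma mono_right (h : MomentLE μ w g B) (hB : B ≤ B') : MomentLE μ w g B' :=
  ⟨h.integrable, h.integral_le.trans hB⟩

lemma add (h : MomentLE μ w g B) (h' : MomentLE μ w g' B') :
    MomentLE μ w (fun ω => g ω + g' ω) (B + B') := by
  simp only [momentLE_iff, mul_add]
  exact ⟨h.integrable.add h'.integrable,
    (integral_add h.integrable h'.integrable).trans_le (add_le_add h.integral_le h'.integral_le)⟩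

lemma const_mul (h : MomentLE μ w g B) (hc : 0 ≤ c) :
    MomentLE μ w (fun ω => c * g ω) (c * B) := by
  simp only [momentLE_iff, mul_left_comm _ c]
  exact ⟨h.integrable.const_mul c,
    (integral_const_mul _ _).trans_le (mul_le_mul_of_nonneg_left h.integral_le hc)⟩

lemma sum {ι : Type*} {s : Finset ι} {f : ι → Ω → ℝ} {b : ι → ℝ}
    (h : ∀ i ∈ s, MomentLE μ w (f i) (b i)) :
    MomentLE μ w (fun ω => ∑ i ∈ s, f i ω) (∑ i ∈ s, b i) := by
  simp only [momentLE_iff, Finset.mul_sum]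
  refine ⟨integrable_finsetSum _ fun i hi => (h i hi).integrable, ?_⟩
  rw [integral_finsetSum _ fun i hi => (h i hi).integrable]
  exact Finset.sum_le_sum fun i hi => (h i hi).integral_le

lemma mono_left (h : MomentLE μ w g B) (hw : ∀ ω, 0 ≤ w ω)
    (hm : AEStronglyMeasurable (fun ω => w ω * g' ω) μ) (h0 : ∀ ω, 0 ≤ g' ω)
    (hg : ∀ ω, g' ω ≤ g ω) : MomentLE μ w g' B := by
  have hi : Integrable (fun ω => w ω * g' ω) μ := by
    refine h.integrable.mono' hm (Eventually.of_forall fun ω => ?_)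
    rw [Real.norm_of_nonneg (mul_nonneg (hw ω) (h0 ω))]
    exact mul_le_mul_of_nonneg_left (hg ω) (hw ω)
  exact ⟨hi, (integral_mono hi h.integrable fun ω =>
    mul_le_mul_of_nonneg_left (hg ω) (hw ω)).trans h.integral_le⟩

lemma of_lintegral (hw : ∀ ω, 0 ≤ w ω) (hg : ∀ ω, 0 ≤ g ω) (hB : 0 ≤ B)
    (hm : AEStronglyMeasurable (fun ω => w ω * g ω) μ)
    (h : ∫⁻ ω, ‖w ω‖ₑ * ‖g ω‖ₑ ∂μ ≤ ENNReal.ofReal B) : MomentLE μ w g B := by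
  simp only [← enorm_mul] at h
  refine ⟨⟨hm, h.trans_lt ENNReal.ofReal_lt_top⟩, ?_⟩
  rw [integral_eq_lintegral_of_nonneg_ae
    (Eventually.of_forall fun ω => mul_nonneg (hw ω) (hg ω)) hm]
  refine ENNReal.toReal_le_of_le_ofReal hB (le_trans (le_of_eq ?_) h)
  exact lintegral_congr fun ω => (Real.enorm_of_nonneg (mul_nonneg (hw ω) (hg ω))).symm

end MomentLE

/-! ### Symmetric weights -/

section Symmetric

variable {k : ℕ} {G : Type*} [NormedAddCommGroup G]

lemma measurePreserving_perm (σ : Equiv.Perm (Fin k)) :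
    MeasurePreserving (fun (ξ : Fin k → E d) j => ξ (σ j)) :=
  volume_preserving_arrowCongr' σ.symm (MeasurableEquiv.refl (E d)) (MeasurePreserving.id _)

lemma measurableEmbedding_perm (σ : Equiv.Perm (Fin k)) :
    MeasurableEmbedding (fun (ξ : Fin k → E d) j => ξ (σ j)) :=
  (MeasurableEquiv.arrowCongr' σ.symm (MeasurableEquiv.refl (E d))).measurableEmbedding

lemma integral_perm [NormedSpace ℝ G] (σ : Equiv.Perm (Fin k)) (f : (Fin k → E d) → G) :
    ∫ ξ : Fin k → E d, f (fun j => ξ (σ j)) = ∫ ξ, f ξ :=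
  (measurePreserving_perm σ).integral_comp (measurableEmbedding_perm σ) f

lemma integrable_perm (σ : Equiv.Perm (Fin k)) {f : (Fin k → E d) → G} (hf : Integrable f) :
    Integrable fun ξ : Fin k → E d => f fun j => ξ (σ j) :=
  (measurePreserving_perm σ).integrable_comp_of_integrable hf

lemma MomentLE.perm {w g : (Fin k → E d) → ℝ} {B : ℝ} (h : MomentLE volume w g B)
    (σ : Equiv.Perm (Fin k)) (hw : ∀ ξ, w (fun j => ξ (σ j)) = w ξ) :
    MomentLE volume w (fun ξ => g fun j => ξ (σ j)) B := by
  have h1 := integrable_perm σ h.integrable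
  have h2 := (integral_perm σ fun ξ => w ξ * g ξ).trans_le h.integral_le
  simp only [hw] at h1 h2
  exact ⟨h1, h2⟩

/-- Permutations act transitively on ordered pairs of distinct indices, so a symmetric weight has
the same moment for all such pairs. -/
lemma exists_perm_of_ne {n : ℕ} {j l : Fin (n + 2)} (h : l ≠ j) :
    ∃ σ : Equiv.Perm (Fin (n + 2)), σ 0 = j ∧ σ 1 = l := by
  have h1 : Equiv.swap 0 j l ≠ 0 := by
    intro e
    rw [← Equiv.eq_symm_apply, Equiv.symm_swap, Equiv.swap_apply_left] at e
    exact h e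
  refine ⟨Equiv.swap 0 j * Equiv.swap 1 (Equiv.swap 0 j l), ?_, ?_⟩
  · rw [Equiv.Perm.mul_apply, Equiv.swap_apply_of_ne_of_ne (by simp) h1.symm,
      Equiv.swap_apply_left]
  · rw [Equiv.Perm.mul_apply, Equiv.swap_apply_left, Equiv.swap_apply_self]

variable {w : (Fin k → E d) → ℝ}

/-- Weights invariant under permutations of the frequencies. -/
def IsSymmetric {Y : Type*} (w : (Fin k → E d) → Y) : Prop :=
  ∀ (σ : Equiv.Perm (Fin k)) ξ, w (fun j => ξ (σ j)) = w ξ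

lemma MomentLE.single {n : ℕ} {w : (Fin (n + 1) → E d) → ℝ} (hw : IsSymmetric w) {g : E d → ℝ}
    {B : ℝ} (h : MomentLE volume w (fun ξ => g (ξ 0)) B) (j : Fin (n + 1)) :
    MomentLE volume w (fun ξ => g (ξ j)) B := by
  simpa using h.perm (Equiv.swap 0 j) (hw _)

lemma MomentLE.pair {n : ℕ} {w : (Fin (n + 2) → E d) → ℝ} (hw : IsSymmetric w)
    {g : E d → E d → ℝ} {B : ℝ} (h : MomentLE volume w (fun ξ => g (ξ 0) (ξ 1)) B)
    {j l : Fin (n + 2)} (hjl : l ≠ j) : MomentLE volume w (fun ξ => g (ξ j) (ξ l)) B := by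
  obtain ⟨σ, h0, h1⟩ := exists_perm_of_ne hjl
  simpa [h0, h1] using h.perm σ (hw _)

end Symmetric

/-! ### Moments of the constants `modeK1` and `modeK2` -/

section Bounds

variable {k : ℕ}

/-- Diagonal and mixed terms are separated because their moments decay differently: fewer than `k²`
mixed terms are compensated by one more power of `k` in the mixed moment. -/
lemma freqSize_sq_eq (ξ : Fin k → E d) :
    freqSize ξ ^ 2 = ∑ j, (‖ξ j‖ ^ 2 + ∑ l ∈ Finset.univ.erase j, ‖ξ j‖ * ‖ξ l‖) := by
  rw [sq, freqSize, Finset.sum_mul]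
  refine Finset.sum_congr rfl fun j _ => ?_
  rw [← Finset.mul_sum, ← Finset.add_sum_erase _ _ (Finset.mem_univ j)]
  ring

/-- Products of three distinct frequencies have no moment hypothesis of their own. Cauchy–Schwarz
replaces them by `k |ξ_l|² |ξ_j|`, and the decay `k^{-3-δ}` of that moment pays for the factor `k`.
-/
lemma freqSize_cube_le (ξ : Fin k → E d) :
    freqSize ξ ^ 3 ≤
      ∑ j, (2 * ‖ξ j‖ ^ 3 + ∑ l ∈ Finset.univ.erase j, 2 * (k : ℝ) * (‖ξ l‖ ^ 2 * ‖ξ j‖)) := by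
  have e : freqSize ξ ^ 3 = ∑ j, ‖ξ j‖ * freqSize ξ ^ 2 := by
    rw [← Finset.sum_mul, ← freqSize]; ring
  rw [e]
  refine Finset.sum_le_sum fun j _ => ?_
  have h1 : freqSize ξ = ‖ξ j‖ + ∑ l ∈ Finset.univ.erase j, ‖ξ l‖ :=
    (Finset.add_sum_erase _ _ (Finset.mem_univ j)).symm
  have h2 : (∑ l ∈ Finset.univ.erase j, ‖ξ l‖) ^ 2 ≤
      (k : ℝ) * ∑ l ∈ Finset.univ.erase j, ‖ξ l‖ ^ 2 := by
    refine sq_sum_le_card_mul_sum_sq.trans (mul_le_mul_of_nonneg_right ?_ (by positivity))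
    exact_mod_cast (Finset.card_le_univ _).trans_eq (Fintype.card_fin k)
  rw [h1, ← Finset.mul_sum, ← Finset.sum_mul]
  set R := ∑ l ∈ Finset.univ.erase j, ‖ξ l‖
  have h3 : (‖ξ j‖ + R) ^ 2 ≤ 2 * ‖ξ j‖ ^ 2 + 2 * R ^ 2 := by nlinarith [sq_nonneg (‖ξ j‖ - R)]
  calc ‖ξ j‖ * (‖ξ j‖ + R) ^ 2 ≤ ‖ξ j‖ * (2 * ‖ξ j‖ ^ 2 +
        2 * ((k : ℝ) * ∑ l ∈ Finset.univ.erase j, ‖ξ l‖ ^ 2)) := by gcongr; linarith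
    _ = _ := by ring

lemma continuous_freqSize : Continuous (freqSize : (Fin k → E d) → ℝ) := by
  unfold freqSize; fun_prop

lemma sum_erase_const_le (j : Fin k) {B : ℝ} (hB : 0 ≤ B) :
    ∑ _l ∈ Finset.univ.erase j, B ≤ k * B := by
  rw [Finset.sum_const, nsmul_eq_mul]
  refine mul_le_mul_of_nonneg_right ?_ hB
  exact_mod_cast (Finset.card_le_univ _).trans_eq (Fintype.card_fin k)

lemma momentLE_modeK1 {n : ℕ} {w : (Fin (n + 1) → E d) → ℝ} {B₀ B₁ B₂ : ℝ} (hB₂ : 0 ≤ B₂)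
    (h0 : MomentLE volume w (fun _ => 1) B₀)
    (h1 : ∀ j, MomentLE volume w (fun ξ => ‖ξ j‖) B₁)
    (h2 : ∀ j, MomentLE volume w (fun ξ => ‖ξ j‖ ^ 2) B₁)
    (h11 : ∀ j l, l ≠ j → MomentLE volume w (fun ξ => ‖ξ j‖ * ‖ξ l‖) B₂) :
    MomentLE volume w modeK1 (1 / ((n + 1 : ℕ) : ℝ) * (B₀ + 2 * Real.pi * ((n + 1 : ℕ) * B₁) +
      12 * Real.pi ^ 2 * ((n + 1 : ℕ) * (B₁ + (n + 1 : ℕ) * B₂)))) := by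
  have hS : MomentLE volume w freqSize ((n + 1 : ℕ) * B₁) := by
    refine (MomentLE.sum (s := Finset.univ) fun j _ => h1 j).mono_right (le_of_eq ?_)
    rw [Finset.sum_const, Finset.card_univ, Fintype.card_fin, nsmul_eq_mul]
  have hS2 : MomentLE volume w (fun ξ => freqSize ξ ^ 2)
      ((n + 1 : ℕ) * (B₁ + (n + 1 : ℕ) * B₂)) := by
    simp only [freqSize_sq_eq]
    refine (MomentLE.sum (s := Finset.univ) (b := fun _ => B₁ + (n + 1 : ℕ) * B₂) fun j _ =>
      (h2 j).add ((MomentLE.sum fun l hl => h11 j l (Finset.ne_of_mem_erase hl)).mono_right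
        (sum_erase_const_le j hB₂))).mono_right (le_of_eq ?_)
    rw [Finset.sum_const, Finset.card_univ, Fintype.card_fin, nsmul_eq_mul]
  exact ((h0.add (hS.const_mul (by positivity))).add (hS2.const_mul (by positivity))).const_mul
    (by positivity)

lemma momentLE_modeK2 {n : ℕ} {w : (Fin (n + 1) → E d) → ℝ} {B₁ B₂ B₃ : ℝ} (hB₂ : 0 ≤ B₂)
    (hB₃ : 0 ≤ B₃) (hw : ∀ ξ, 0 ≤ w ξ) (hwm : Measurable w)
    (h2 : ∀ j, MomentLE volume w (fun ξ => ‖ξ j‖ ^ 2) B₁)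
    (h11 : ∀ j l, l ≠ j → MomentLE volume w (fun ξ => ‖ξ j‖ * ‖ξ l‖) B₂)
    (h3 : ∀ j, MomentLE volume w (fun ξ => ‖ξ j‖ ^ 3) B₁)
    (h21 : ∀ j l, l ≠ j → MomentLE volume w (fun ξ => ‖ξ j‖ ^ 2 * ‖ξ l‖) B₃) :
    MomentLE volume w modeK2 (1 / ((n + 1 : ℕ) : ℝ) *
      (4 * Real.pi ^ 2 * ((n + 1 : ℕ) * (B₁ + (n + 1 : ℕ) * B₂)) +
      28 * Real.pi ^ 3 * ((n + 1 : ℕ) *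
        (2 * B₁ + (n + 1 : ℕ) * (2 * (n + 1 : ℕ) * B₃))))) := by
  have hS2 : MomentLE volume w (fun ξ => freqSize ξ ^ 2)
      ((n + 1 : ℕ) * (B₁ + (n + 1 : ℕ) * B₂)) := by
    simp only [freqSize_sq_eq]
    refine (MomentLE.sum (s := Finset.univ) (b := fun _ => B₁ + (n + 1 : ℕ) * B₂) fun j _ =>
      (h2 j).add ((MomentLE.sum fun l hl => h11 j l (Finset.ne_of_mem_erase hl)).mono_right
        (sum_erase_const_le j hB₂))).mono_right (le_of_eq ?_)
    rw [Finset.sum_const, Finset.card_univ, Fintype.card_fin, nsmul_eq_mul]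
  have hS3 : MomentLE volume w (fun ξ => freqSize ξ ^ 3) ((n + 1 : ℕ) *
        (2 * B₁ + (n + 1 : ℕ) * (2 * (n + 1 : ℕ) * B₃))) := by
    refine ((MomentLE.sum (s := Finset.univ)
      (b := fun _ => 2 * B₁ + (n + 1 : ℕ) * (2 * (n + 1 : ℕ) * B₃)) fun j _ =>
      ((h3 j).const_mul zero_le_two).add ((MomentLE.sum fun l hl =>
        (h21 l j (Finset.ne_of_mem_erase hl).symm).const_mul
          (c := 2 * ((n + 1 : ℕ) : ℝ)) (by positivity)).mono_right
        (sum_erase_const_le j (by positivity)))).mono_right ?_).mono_left hw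
        (hwm.mul (continuous_freqSize.pow 3).measurable).aestronglyMeasurable
        (fun ξ => pow_nonneg (freqSize_nonneg ξ) 3) fun ξ => freqSize_cube_le ξ
    rw [Finset.sum_const, Finset.card_univ, Fintype.card_fin, nsmul_eq_mul]
  exact ((hS2.const_mul (by positivity)).add (hS3.const_mul (by positivity))).const_mul
    (by positivity)

end Bounds

/-! ### Moments of the coefficients, and summability in the degree -/

section Coefficients

variable {C δ : ℝ} {a : (k : ℕ) → (Fin k → E d) → ℂ}

/-- Passing to `|C|` provides nonnegative real constants; `ENNReal.ofReal` truncates a negative `C`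
to zero. -/
lemma bound_le (C p : ℝ) (k : ℕ) :
    bound C p k ≤ ENNReal.ofReal (|C| * (k.factorial : ℝ) / (k : ℝ) ^ p) := by
  refine ENNReal.ofReal_le_ofReal ?_
  have := le_abs_self C
  gcongr

/-- The coefficient of `F^k_ξ`, divided by `k!`. -/
def coef (a : (k : ℕ) → (Fin k → E d) → ℂ) (n : ℕ) (ξ : Fin (n + 1) → E d) : ℂ :=
  1 / ((n + 1).factorial : ℂ) * a (n + 1) ξ

lemma norm_coef (n : ℕ) (ξ : Fin (n + 1) → E d) :
    ‖coef a n ξ‖ = 1 / ((n + 1).factorial : ℝ) * ‖a (n + 1) ξ‖ := by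
  rw [coef, norm_mul, norm_div, norm_one, Complex.norm_natCast]

lemma measurable_coef (ham : ∀ n, Measurable (a (n + 1))) (n : ℕ) : Measurable (coef a n) :=
  (ham n).const_mul _

lemma isSymmetric_coef (has : ∀ n, IsSymmetric (a (n + 1))) (n : ℕ) : IsSymmetric (coef a n) :=
  fun σ ξ => by rw [coef, coef, has n σ ξ]

lemma momentLE_coef (ham : ∀ n, Measurable (a (n + 1))) (n : ℕ) (p : ℝ)
    {g : (Fin (n + 1) → E d) → ℝ} (hgm : Measurable g) (hg : ∀ ξ, 0 ≤ g ξ)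
    (h : ∫⁻ ξ, ‖a (n + 1) ξ‖ₑ * ‖g ξ‖ₑ ≤ bound C p (n + 1)) :
    MomentLE volume (fun ξ => ‖coef a n ξ‖) g (|C| / ((n + 1 : ℕ) : ℝ) ^ p) := by
  have h1 : MomentLE volume (fun ξ => ‖a (n + 1) ξ‖) g
      (|C| * ((n + 1).factorial : ℝ) / ((n + 1 : ℕ) : ℝ) ^ p) := by
    refine MomentLE.of_lintegral (fun _ => norm_nonneg _) hg (by positivity)
      ((ham n).norm.mul hgm).aestronglyMeasurable ?_
    simpa only [enorm_norm] using h.trans (bound_le C p _)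
  have hf : ((n + 1).factorial : ℝ) ≠ 0 := by positivity
  simp only [norm_coef]
  refine ⟨?_, ?_⟩
  · simp only [mul_assoc]; exact h1.integrable.const_mul _
  · simp only [mul_assoc]
    rw [integral_const_mul]
    refine (mul_le_mul_of_nonneg_left h1.integral_le (by positivity)).trans_eq ?_
    field_simp

/-- The moment bounds, for all indices. -/
structure CoefMoments (C δ : ℝ) (a : (k : ℕ) → (Fin k → E d) → ℂ) : Prop where
  measurable : ∀ n, Measurable (a (n + 1))
  symmetric : ∀ n, IsSymmetric (a (n + 1))
  zeroth : ZerothMomentBound C δ a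
  first : FirstMomentBound C δ a
  mixed : MixedMomentBound C δ a

namespace CoefMoments

lemma isSymmetric_norm (h : CoefMoments C δ a) (n : ℕ) : IsSymmetric fun ξ => ‖coef a n ξ‖ :=
  fun σ ξ => by simp only [isSymmetric_coef h.symmetric n σ ξ]

lemma moment_zero (h : CoefMoments C δ a) (n : ℕ) :
    MomentLE volume (fun ξ => ‖coef a n ξ‖) (fun _ => 1) (|C| / ((n + 1 : ℕ) : ℝ) ^ δ) :=
  momentLE_coef h.measurable n δ measurable_const (fun _ => zero_le_one)
    (by simpa using h.zeroth n)

lemma moment_pow (h : CoefMoments C δ a) {n p : ℕ}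
    (hp : ∫⁻ ξ, ‖a (n + 1) ξ‖ₑ * ‖ξ 0‖ₑ ^ p ≤ bound C (1 + δ) (n + 1)) (j : Fin (n + 1)) :
    MomentLE volume (fun ξ => ‖coef a n ξ‖) (fun ξ => ‖ξ j‖ ^ p)
      (|C| / ((n + 1 : ℕ) : ℝ) ^ (1 + δ)) :=
  MomentLE.single (h.isSymmetric_norm n) (g := fun v => ‖v‖ ^ p)
    (momentLE_coef h.measurable n (1 + δ) (by fun_prop) (fun _ => by positivity)
      (by simpa [enorm_pow] using hp)) j

lemma moment_one (h : CoefMoments C δ a) (n : ℕ) (j : Fin (n + 1)) :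
    MomentLE volume (fun ξ => ‖coef a n ξ‖) (fun ξ => ‖ξ j‖)
      (|C| / ((n + 1 : ℕ) : ℝ) ^ (1 + δ)) := by
  simpa using h.moment_pow (p := 1) (by simpa using (h.first n).1) j

lemma moment_two (h : CoefMoments C δ a) (n : ℕ) (j : Fin (n + 1)) :
    MomentLE volume (fun ξ => ‖coef a n ξ‖) (fun ξ => ‖ξ j‖ ^ 2)
      (|C| / ((n + 1 : ℕ) : ℝ) ^ (1 + δ)) :=
  h.moment_pow (h.first n).2 j

lemma moment_mixed (h : CoefMoments C δ a) :
    ∀ (n : ℕ) (j l : Fin (n + 1)), l ≠ j → MomentLE volume (fun ξ => ‖coef a n ξ‖)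
      (fun ξ => ‖ξ j‖ * ‖ξ l‖) (|C| / ((n + 1 : ℕ) : ℝ) ^ (2 + δ))
  -- The index `n` stands for degree `k = n + 1`; in degree 1 there is no pair of distinct indices.
  | 0, _, _, hjl => (hjl (Subsingleton.elim (α := Fin 1) _ _)).elim
  | n + 1, _, _, hjl => MomentLE.pair (h.isSymmetric_norm (n + 1)) (g := fun u v => ‖u‖ * ‖v‖)
    (momentLE_coef h.measurable (n + 1) (2 + δ) (by fun_prop) (fun _ => by positivity)
      (by simpa [enorm_mul, mul_assoc] using h.mixed n)) hjl

lemma moment_mixed_two (h : CoefMoments C δ a) (h' : ThirdMomentBound C δ a) :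
    ∀ (n : ℕ) (j l : Fin (n + 1)), l ≠ j → MomentLE volume (fun ξ => ‖coef a n ξ‖)
      (fun ξ => ‖ξ j‖ ^ 2 * ‖ξ l‖) (|C| / ((n + 1 : ℕ) : ℝ) ^ (3 + δ))
  | 0, _, _, hjl => (hjl (Subsingleton.elim (α := Fin 1) _ _)).elim
  | n + 1, _, _, hjl => MomentLE.pair (h.isSymmetric_norm (n + 1))
    (g := fun u v => ‖u‖ ^ 2 * ‖v‖)
    (momentLE_coef h.measurable (n + 1) (3 + δ) (by fun_prop) (fun _ => by positivity)
      (by simpa [enorm_mul, enorm_pow, mul_assoc] using h'.2 n)) hjl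

lemma rpow_nat_add (n p : ℕ) (δ : ℝ) :
    ((n + 1 : ℕ) : ℝ) ^ ((p : ℝ) + δ) = ((n + 1 : ℕ) : ℝ) ^ p * ((n + 1 : ℕ) : ℝ) ^ δ := by
  rw [Real.rpow_add (by positivity), Real.rpow_natCast]

/-- With `k = n + 1`, the sums of `k` moments of order `k^{-1-δ}` and of at most `k²` mixed ones of
order `k^{-2-δ}` are of order `k^{-δ}`, like the zeroth moment. The prefactor `1/k` of `F` makes the
result summable. -/
lemma moment_modeK1 (h : CoefMoments C δ a) (n : ℕ) :
    MomentLE volume (fun ξ => ‖coef a n ξ‖) modeK1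
      (|C| * (1 + 2 * Real.pi + 24 * Real.pi ^ 2) * (1 / ((n + 1 : ℕ) : ℝ) ^ (1 + δ))) := by
  refine (momentLE_modeK1 (by positivity) (h.moment_zero n) (h.moment_one n) (h.moment_two n)
    (h.moment_mixed n)).mono_right (le_of_eq ?_)
  have h1 := rpow_nat_add n 1 δ
  have h2 := rpow_nat_add n 2 δ
  rw [Nat.cast_one] at h1
  rw [Nat.cast_ofNat] at h2
  rw [h1, h2]
  have : 0 < ((n + 1 : ℕ) : ℝ) ^ δ := by positivity
  field_simp
  ring

/-- The same count, with the cubic part: `2k` diagonal contributions of order `k^{-1-δ}` and at most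
`k²` mixed ones of order `2k · k^{-3-δ}`, whence `112 = 28 · (2 + 2)`. -/
lemma moment_modeK2 (h : CoefMoments C δ a) (h' : ThirdMomentBound C δ a) (n : ℕ) :
    MomentLE volume (fun ξ => ‖coef a n ξ‖) modeK2
      (|C| * (8 * Real.pi ^ 2 + 112 * Real.pi ^ 3) * (1 / ((n + 1 : ℕ) : ℝ) ^ (1 + δ))) := by
  refine (momentLE_modeK2 (by positivity) (by positivity) (fun _ => norm_nonneg _)
    (measurable_coef h.measurable n).norm (h.moment_two n) (h.moment_mixed n)
    (h.moment_pow (h'.1 n)) (h.moment_mixed_two h' n)).mono_right (le_of_eq ?_)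
  have h1 := rpow_nat_add n 1 δ
  have h2 := rpow_nat_add n 2 δ
  have h3 := rpow_nat_add n 3 δ
  rw [Nat.cast_one] at h1
  rw [Nat.cast_ofNat] at h2 h3
  rw [h1, h2, h3]
  have : 0 < ((n + 1 : ℕ) : ℝ) ^ δ := by positivity
  field_simp
  ring

lemma summable_one_div_rpow (hδ : 0 < δ) (c : ℝ) :
    Summable fun n : ℕ => c * (1 / ((n + 1 : ℕ) : ℝ) ^ (1 + δ)) :=
  ((summable_nat_add_iff 1).2 (Real.summable_one_div_nat_rpow.2 (by linarith))).mul_left c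

end CoefMoments

end Coefficients

/-! ### Continuity in the frequencies -/

section Continuity

variable {k : ℕ} (m : P2 d)

lemma continuous_hatProd (s : Finset (Fin k)) :
    Continuous fun ξ : Fin k → E d => hatProd ξ s m := by
  have := continuous_hat m
  unfold hatProd
  fun_prop

lemma continuous_modeU : Continuous fun ξ : Fin k → E d => modeU ξ m :=
  continuous_const.mul (continuous_hatProd m _)

lemma continuous_modeA (i : Fin d) :
    Continuous fun q : (Fin k → E d) × E d => modeA q.1 m q.2 i := by
  have := continuous_hat m
  unfold modeA freqSum freq wave hatProd
  fun_prop

lemma continuous_modeA1 (i j : Fin d) :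
    Continuous fun q : (Fin k → E d) × E d => modeA1 q.1 m q.2 i j := by
  have := continuous_hat m
  unfold modeA1 freqSum freq wave hatProd
  simp only [Matrix.of_apply]
  fun_prop

lemma continuous_modeA2 (i j : Fin d) :
    Continuous fun q : (Fin k → E d) × (E d × E d) => modeA2 q.1 m q.2.1 q.2.2 i j := by
  have := continuous_hat m
  unfold modeA2 freqSum freq wave hatProd
  simp only [Matrix.of_apply]
  fun_prop

end Continuity

/-! ### Fourier coefficients of product measures -/

instance (m : P2 d) (k : ℕ) : IsProbabilityMeasure (power m k) := by
  unfold power; infer_instance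

lemma character_eq_prod {k : ℕ} (ξ x : Fin k → E d) : character ξ x = ∏ j, wave (ξ j) (x j) := by
  unfold character wave
  rw [← Complex.exp_sum]
  push_cast
  rw [Finset.mul_sum]

lemma norm_character {k : ℕ} (ξ x : Fin k → E d) : ‖character ξ x‖ = 1 := by
  rw [character_eq_prod, norm_prod]
  simp [norm_wave]

lemma continuous_character {k : ℕ} :
    Continuous fun p : (Fin k → E d) × (Fin k → E d) => character p.1 p.2 := by
  unfold character; fun_prop

lemma integral_character {k : ℕ} (ξ : Fin k → E d) (m : P2 d) :
    ∫ x, character ξ x ∂(power m k) = hatProd ξ Finset.univ m := by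
  simp only [character_eq_prod]
  exact integral_fintype_prod_eq_prod (fun j => wave (ξ j))

lemma hatProd_perm {k : ℕ} (σ : Equiv.Perm (Fin k)) (ξ : Fin k → E d) (s : Finset (Fin k))
    (m : P2 d) : hatProd (fun j => ξ (σ j)) s m = hatProd ξ (s.map σ.toEmbedding) m := by
  simp [hatProd, Finset.prod_map]

lemma hatProd_perm_univ {k : ℕ} (σ : Equiv.Perm (Fin k)) (ξ : Fin k → E d) (m : P2 d) :
    hatProd (fun j => ξ (σ j)) Finset.univ m = hatProd ξ Finset.univ m := by
  rw [hatProd_perm, Finset.map_univ_equiv]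

lemma hatProd_perm_erase {k : ℕ} (σ : Equiv.Perm (Fin k)) (ξ : Fin k → E d) (j : Fin k)
    (m : P2 d) : hatProd (fun j => ξ (σ j)) (Finset.univ.erase j) m =
      hatProd ξ (Finset.univ.erase (σ j)) m := by
  rw [hatProd_perm, Finset.map_erase, Finset.map_univ_equiv, Equiv.coe_toEmbedding]

lemma hatProd_perm_erase_erase {k : ℕ} (σ : Equiv.Perm (Fin k)) (ξ : Fin k → E d) (j l : Fin k)
    (m : P2 d) : hatProd (fun j => ξ (σ j)) ((Finset.univ.erase j).erase l) m =
      hatProd ξ ((Finset.univ.erase (σ j)).erase (σ l)) m := by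
  rw [hatProd_perm, Finset.map_erase, Finset.map_erase, Finset.map_univ_equiv,
    Equiv.coe_toEmbedding]

/-- `F^k_ξ` as a product of Fourier transforms. -/
theorem F_eq_modeU {k : ℕ} (ξ : Fin k → E d) (m : P2 d) : F k ξ m = modeU ξ m := by
  rw [F, modeU]
  congr 1
  have hi : ∀ σ : Equiv.Perm (Fin k),
      Integrable (fun x => character (fun j => ξ (σ j)) x) (power m k) := fun σ =>
    Integrable.of_bound (continuous_character.comp
      (continuous_const.prodMk continuous_id)).aestronglyMeasurable 1
      (Eventually.of_forall fun x => (norm_character _ x).le)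
  simp only [Phi]
  rw [integral_const_mul, integral_finsetSum _ fun σ _ => hi σ]
  simp only [integral_character, hatProd_perm_univ]
  rw [Finset.sum_const, Finset.card_univ, Fintype.card_perm, Fintype.card_fin, nsmul_eq_mul]
  have : (k.factorial : ℂ) ≠ 0 := by exact_mod_cast k.factorial_ne_zero
  field_simp

lemma integral_character_cons {n : ℕ} (ξ : Fin (n + 1) → E d) (m : P2 d) (x : E d) :
    ∫ y : Fin n → E d, character ξ (Fin.cons x y) ∂(power m n) =
      wave (ξ 0) x * hatProd ξ (Finset.univ.erase 0) m := by
  simp only [character_eq_prod, Fin.prod_univ_succ, Fin.cons_zero, Fin.cons_succ]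
  rw [integral_const_mul, power, integral_fintype_prod_eq_prod (fun j : Fin n => wave (ξ j.succ))]
  congr 1
  rw [hatProd, Fin.univ_succ, Finset.erase_cons, Finset.prod_map]
  rfl

lemma integral_character_cons_cons {n : ℕ} (ξ : Fin (n + 2) → E d) (m : P2 d) (x y : E d) :
    ∫ z : Fin n → E d, character ξ (Fin.cons x (Fin.cons y z)) ∂(power m n) =
      wave (ξ 0) x * (wave (ξ 1) y * hatProd ξ ((Finset.univ.erase 0).erase 1) m) := by
  simp only [character_eq_prod, Fin.prod_univ_succ, Fin.cons_zero, Fin.cons_succ]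
  rw [integral_const_mul, integral_const_mul, power,
    integral_fintype_prod_eq_prod (fun j : Fin n => wave (ξ j.succ.succ))]
  congr 2
  have : (Finset.univ.erase (0 : Fin (n + 2))).erase 1 =
      Finset.univ.map ((Fin.succEmb n).trans (Fin.succEmb (n + 1))) := by
    ext j
    refine Fin.cases (by simp) (fun j => Fin.cases ?_ (fun j => ?_) j) j
    · simpa using fun x : Fin n => Fin.succ_succ_ne_one x
    · simp [Fin.ext_iff]
  rw [hatProd, this, Finset.prod_map]
  rfl

/-- Characters have modulus one, so integrability of `g` alone justifies Fubini. -/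
lemma integral_mul_character {k n : ℕ} {g : (Fin k → E d) → ℂ} (hg : Integrable g) (m : P2 d)
    {X : (Fin n → E d) → Fin k → E d} (hX : Continuous X) :
    ∫ p : (Fin n → E d) × (Fin k → E d), g p.2 * character p.2 (X p.1)
      ∂((power m n).prod volume) = ∫ ξ, g ξ * ∫ y, character ξ (X y) ∂(power m n) := by
  have h2 : Continuous fun p : (Fin n → E d) × (Fin k → E d) => character p.2 (X p.1) :=
    continuous_character.comp
      (f := fun p : (Fin n → E d) × (Fin k → E d) => (p.2, X p.1)) (by fun_prop)
  have hi : Integrable (fun p : (Fin n → E d) × (Fin k → E d) => g p.2 * character p.2 (X p.1))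
      ((power m n).prod volume) := by
    have h1 := hg.comp_snd (power m n)
    have h3 := h1.aestronglyMeasurable.mul h2.aestronglyMeasurable
    refine h1.mono h3 (Eventually.of_forall fun p => ?_)
    rw [norm_mul, norm_character, mul_one]
  rw [integral_prod_symm _ hi]
  simp only [integral_const_mul]

/-! ### Symmetrization -/

/-- A permutation of the variables gives all summands the same integral, so their average may be
replaced by the term at index 0. This produces the factor `ξ₁` of the stated series. -/
lemma integral_mul_sum_of_symmetric {n : ℕ} {w : (Fin (n + 1) → E d) → ℂ} (hw : IsSymmetric w)
    {T : Fin (n + 1) → (Fin (n + 1) → E d) → ℂ}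
    (hT : ∀ (σ : Equiv.Perm (Fin (n + 1))) j ξ, T (σ j) ξ = T j fun l => ξ (σ l))
    (hi : Integrable fun ξ => w ξ * T 0 ξ) :
    ∫ ξ, w ξ * (1 / ((n + 1 : ℕ) : ℂ) * ∑ j, T j ξ) = ∫ ξ, w ξ * T 0 ξ := by
  have e : ∀ j ξ, w ξ * T j ξ = (fun ξ => w ξ * T 0 ξ) fun l => ξ (Equiv.swap 0 j l) := by
    intro j ξ
    simp only [hw (Equiv.swap 0 j) ξ, ← hT, Equiv.swap_apply_left]
  have hi' : ∀ j, Integrable fun ξ => w ξ * T j ξ := fun j => by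
    simp only [e j]; exact integrable_perm _ hi
  have hI : ∀ j, ∫ ξ, w ξ * T j ξ = ∫ ξ, w ξ * T 0 ξ := fun j => by
    simp only [e j]; exact integral_perm _ fun ξ => w ξ * T 0 ξ
  have e2 : ∀ ξ, w ξ * (1 / ((n + 1 : ℕ) : ℂ) * ∑ j, T j ξ) =
      1 / ((n + 1 : ℕ) : ℂ) * ∑ j, w ξ * T j ξ := fun ξ => by
    rw [mul_left_comm, Finset.mul_sum]
  simp only [e2]
  rw [integral_const_mul, integral_finsetSum _ fun j _ => hi' j]
  simp only [hI]
  rw [Finset.sum_const, Finset.card_univ, Fintype.card_fin, nsmul_eq_mul, one_div, ← mul_assoc,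
    inv_mul_cancel₀ (Nat.cast_ne_zero.2 n.succ_ne_zero), one_mul]

/-- There are `k(k - 1)` ordered pairs with equal integrals. Division by `k = n + 2` leaves the
factor `k - 1 = n + 1` of the Hessian series. -/
lemma integral_mul_sum_sum_of_symmetric {n : ℕ} {w : (Fin (n + 2) → E d) → ℂ}
    (hw : IsSymmetric w) {T : Fin (n + 2) → Fin (n + 2) → (Fin (n + 2) → E d) → ℂ}
    (hT : ∀ (σ : Equiv.Perm (Fin (n + 2))) j l ξ, T (σ j) (σ l) ξ = T j l fun l => ξ (σ l))
    (hi : Integrable fun ξ => w ξ * T 0 1 ξ) :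
    ∫ ξ, w ξ * (1 / ((n + 2 : ℕ) : ℂ) * ∑ j, ∑ l ∈ Finset.univ.erase j, T j l ξ) =
      ((n : ℂ) + 1) * ∫ ξ, w ξ * T 0 1 ξ := by
  have e : ∀ j l, l ≠ j → ∃ σ : Equiv.Perm (Fin (n + 2)), ∀ ξ,
      w ξ * T j l ξ = (fun ξ => w ξ * T 0 1 ξ) fun l => ξ (σ l) := by
    intro j l hjl
    obtain ⟨σ, h0, h1⟩ := exists_perm_of_ne hjl
    refine ⟨σ, fun ξ => ?_⟩
    simp only [hw σ ξ, ← hT, h0, h1]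
  have hi' : ∀ j, ∀ l ∈ Finset.univ.erase j, Integrable fun ξ => w ξ * T j l ξ := fun j l hl => by
    obtain ⟨σ, hσ⟩ := e j l (Finset.ne_of_mem_erase hl)
    simp only [hσ]; exact integrable_perm _ hi
  have hI : ∀ j, ∀ l ∈ Finset.univ.erase j, ∫ ξ, w ξ * T j l ξ = ∫ ξ, w ξ * T 0 1 ξ :=
    fun j l hl => by
      obtain ⟨σ, hσ⟩ := e j l (Finset.ne_of_mem_erase hl)
      simp only [hσ]; exact integral_perm _ fun ξ => w ξ * T 0 1 ξ
  have e2 : ∀ ξ, w ξ * (1 / ((n + 2 : ℕ) : ℂ) * ∑ j, ∑ l ∈ Finset.univ.erase j, T j l ξ) =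
      1 / ((n + 2 : ℕ) : ℂ) * ∑ j, ∑ l ∈ Finset.univ.erase j, w ξ * T j l ξ := fun ξ => by
    rw [mul_left_comm, Finset.mul_sum]
    simp only [Finset.mul_sum]
  simp only [e2]
  rw [integral_const_mul, integral_finsetSum _ fun j _ => integrable_finsetSum _ fun l hl => hi' j l hl]
  rw [Finset.sum_congr rfl fun j _ => (integral_finsetSum _ fun l hl => hi' j l hl).trans
    (Finset.sum_congr rfl fun l hl => hI j l hl)]
  simp only [Finset.sum_const, Finset.card_erase_of_mem (Finset.mem_univ _), Finset.card_univ,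
    Fintype.card_fin, nsmul_eq_mul]
  have h2 : ((n + 2 : ℕ) : ℂ) ≠ 0 := Nat.cast_ne_zero.2 (by omega)
  rw [one_div, ← mul_assoc, inv_mul_cancel₀ h2, one_mul]
  push_cast [Nat.add_sub_cancel]
  ring

/-! ### The terms of the series -/

section Terms

variable {C δ : ℝ} {a : (k : ℕ) → (Fin k → E d) → ℂ}

lemma CoefMoments.integrable_coef_mul (h : CoefMoments C δ a) {n : ℕ}
    {g : (Fin (n + 1) → E d) → ℝ} {B c : ℝ}
    (hg : MomentLE volume (fun ξ => ‖coef a n ξ‖) g B) {T : (Fin (n + 1) → E d) → ℂ}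
    (hT : Continuous T) (hb : ∀ ξ, ‖T ξ‖ ≤ c * g ξ) : Integrable fun ξ => coef a n ξ * T ξ := by
  refine (hg.integrable.const_mul c).mono'
    ((measurable_coef h.measurable n).aestronglyMeasurable.mul hT.aestronglyMeasurable)
    (Eventually.of_forall fun ξ => ?_)
  rw [norm_mul, mul_left_comm]
  exact mul_le_mul_of_nonneg_left (hb ξ) (norm_nonneg _)

lemma norm_coord_le (v : E d) (i : Fin d) : ‖((v i : ℝ) : ℂ)‖ ≤ 1 * ‖v‖ := by
  rw [Complex.norm_real, one_mul]; exact PiLp.norm_apply_le v i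

lemma factorial_ne_zero' (n : ℕ) : (n.factorial : ℂ) ≠ 0 := by
  exact_mod_cast n.factorial_ne_zero

lemma eq_factorial_mul_coef (n : ℕ) (ξ : Fin (n + 1) → E d) :
    a (n + 1) ξ = ((n + 1).factorial : ℂ) * coef a n ξ := by
  have := factorial_ne_zero' (n + 1)
  rw [coef]
  field_simp

lemma U0Term_eq (n : ℕ) (m : P2 d) : U0Term a n m = ∫ ξ, coef a n ξ * modeU ξ m := by
  simp only [U0Term, F_eq_modeU, coef, mul_assoc]
  rw [integral_const_mul]

lemma CoefMoments.gradTerm_eq (h : CoefMoments C δ a) (n : ℕ) (m : P2 d) (x : E d) (i : Fin d) :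
    gradTerm a n m x i = ∫ ξ, coef a n ξ * modeA ξ m x i := by
  have hh := continuous_hat m
  have hg : Integrable fun ξ : Fin (n + 1) → E d => a (n + 1) ξ * (ξ 0 i : ℂ) := by
    simp only [eq_factorial_mul_coef (a := a), mul_assoc]
    exact (h.integrable_coef_mul (h.moment_one n 0) (by fun_prop)
      fun ξ => norm_coord_le _ _).const_mul _
  rw [gradTerm, integral_mul_character hg m (X := fun y => Fin.cons x y) (by fun_prop)]
  simp only [integral_character_cons]
  have hi : Integrable fun ξ : Fin (n + 1) → E d => coef a n ξ *
      (freq (ξ 0) i * (wave (ξ 0) x * hatProd ξ (Finset.univ.erase 0) m)) := by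
    refine h.integrable_coef_mul (c := 2 * Real.pi) (h.moment_one n 0)
      (by unfold freq wave hatProd; fun_prop) fun ξ => ?_
    rw [norm_mul]
    exact (mul_le_of_le_one_right (norm_nonneg _) (norm_wave_mul_hatProd_le _ _ _ _ _)).trans
      (norm_freq_le _ _)
  simp only [modeA, freqSum]
  rw [integral_mul_sum_of_symmetric (isSymmetric_coef h.symmetric n)
    (T := fun j ξ => freq (ξ j) i * (wave (ξ j) x * hatProd ξ (Finset.univ.erase j) m))
    (fun σ j ξ => by simp only [hatProd_perm_erase]) hi, ← integral_const_mul]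
  refine integral_congr_ae (Eventually.of_forall fun ξ => ?_)
  simp only [coef, freq]
  ring

lemma CoefMoments.jacTerm_eq (h : CoefMoments C δ a) (n : ℕ) (m : P2 d) (x : E d)
    (i i' : Fin d) : jacTerm a n m x i i' = ∫ ξ, coef a n ξ * modeA1 ξ m x i i' := by
  have hh := continuous_hat m
  have hg : Integrable fun ξ : Fin (n + 1) → E d => a (n + 1) ξ * (ξ 0 i : ℂ) * (ξ 0 i' : ℂ) := by
    simp only [eq_factorial_mul_coef (a := a), mul_assoc]
    refine (h.integrable_coef_mul (c := 1) (h.moment_two n 0) (by fun_prop)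
      fun ξ => ?_).const_mul _
    rw [norm_mul, one_mul, sq]
    have := norm_coord_le (ξ 0) i
    have := norm_coord_le (ξ 0) i'
    rw [one_mul] at *
    gcongr
  rw [jacTerm, integral_mul_character hg m (X := fun y => Fin.cons x y) (by fun_prop)]
  simp only [integral_character_cons]
  have hi : Integrable fun ξ : Fin (n + 1) → E d => coef a n ξ *
      (freq (ξ 0) i * (freq (ξ 0) i' *
        (wave (ξ 0) x * hatProd ξ (Finset.univ.erase 0) m))) := by
    refine h.integrable_coef_mul (c := 4 * Real.pi ^ 2) (h.moment_two n 0)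
      (by unfold freq wave hatProd; fun_prop) fun ξ => ?_
    rw [← mul_assoc, norm_mul]
    refine (mul_le_of_le_one_right (norm_nonneg _) (norm_wave_mul_hatProd_le _ _ _ _ _)).trans ?_
    rw [norm_mul]
    refine (mul_le_mul (norm_freq_le _ _) (norm_freq_le _ _) (norm_nonneg _)
      (by positivity)).trans_eq ?_
    ring
  simp only [modeA1, Matrix.of_apply, freqSum]
  rw [integral_mul_sum_of_symmetric (isSymmetric_coef h.symmetric n)
    (T := fun j ξ => freq (ξ j) i * (freq (ξ j) i' *
      (wave (ξ j) x * hatProd ξ (Finset.univ.erase j) m)))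
    (fun σ j ξ => by simp only [hatProd_perm_erase]) hi, ← integral_const_mul]
  refine integral_congr_ae (Eventually.of_forall fun ξ => ?_)
  simp only [coef, freq]
  -- Two frequencies carry `(-2πi)² = -4π²`; the multiple of `I² = -1` is all that `ring` cannot
  -- see.
  linear_combination (-(4 * (Real.pi : ℂ) ^ 2 / ((n + 1).factorial : ℂ) * a (n + 1) ξ *
    (ξ 0 i : ℂ) * (ξ 0 i' : ℂ) * (wave (ξ 0) x * hatProd ξ (Finset.univ.erase 0) m))) *
    Complex.I_sq

lemma CoefMoments.hessTerm_eq (h : CoefMoments C δ a) (n : ℕ) (m : P2 d) (x y : E d)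
    (i i' : Fin d) :
    hessTerm a n m x y i i' = ∫ ξ, coef a (n + 1) ξ * modeA2 ξ m x y i i' := by
  have hh := continuous_hat m
  have h01 := h.moment_mixed (n + 1) 0 1 (by simp)
  have hg : Integrable fun ξ : Fin (n + 2) → E d => a (n + 2) ξ * (ξ 0 i : ℂ) * (ξ 1 i' : ℂ) := by
    simp only [eq_factorial_mul_coef (a := a) (n + 1), mul_assoc]
    refine (h.integrable_coef_mul (c := 1) h01 (by fun_prop) fun ξ => ?_).const_mul _
    rw [norm_mul, one_mul]
    have := norm_coord_le (ξ 0) i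
    have := norm_coord_le (ξ 1) i'
    rw [one_mul] at *
    gcongr
  rw [hessTerm, integral_mul_character hg m
    (X := fun z => Fin.cons x (Fin.cons y z : Fin (n + 1) → E d)) (by fun_prop)]
  simp only [integral_character_cons_cons]
  have hi : Integrable fun ξ : Fin (n + 2) → E d => coef a (n + 1) ξ *
      (freq (ξ 0) i * (wave (ξ 0) x * (freq (ξ 1) i' *
        (wave (ξ 1) y * hatProd ξ ((Finset.univ.erase 0).erase 1) m)))) := by
    refine h.integrable_coef_mul (c := 4 * Real.pi ^ 2) h01
      (by unfold freq wave hatProd; fun_prop) fun ξ => ?_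
    rw [norm_mul, norm_mul, norm_wave, one_mul, norm_mul]
    refine (mul_le_mul (norm_freq_le _ _) ((mul_le_of_le_one_right (norm_nonneg _)
      (norm_wave_mul_hatProd_le _ _ _ _ _)).trans (norm_freq_le _ _)) (by positivity)
      (by positivity)).trans_eq ?_
    ring
  simp only [modeA2, Matrix.of_apply, freqSum, Finset.mul_sum (s := Finset.univ.erase _)]
  rw [integral_mul_sum_sum_of_symmetric (isSymmetric_coef h.symmetric (n + 1))
    (T := fun j l ξ => freq (ξ j) i * (wave (ξ j) x * (freq (ξ l) i' *
      (wave (ξ l) y * hatProd ξ ((Finset.univ.erase j).erase l) m))))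
    (fun σ j l ξ => by simp only [hatProd_perm_erase_erase]) hi, ← integral_const_mul,
    ← integral_const_mul]
  refine integral_congr_ae (Eventually.of_forall fun ξ => ?_)
  simp only [coef, freq]
  linear_combination (-(4 * (Real.pi : ℂ) ^ 2 * ((n : ℂ) + 1) / ((n + 2).factorial : ℂ) *
    a (n + 2) ξ * (ξ 0 i : ℂ) * (ξ 1 i' : ℂ) * (wave (ξ 0) x *
    (wave (ξ 1) y * hatProd ξ ((Finset.univ.erase 0).erase 1) m)))) * Complex.I_sq

/-- A single frequency leaves no second index. This reconciles `modeA2Term`, indexed by `k = n + 1`,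
with `hessTerm`, indexed by `k = n + 2`. -/
lemma modeA2_one (ξ : Fin 1 → E d) (m : P2 d) (x y : E d) (i j : Fin d) :
    modeA2 ξ m x y i j = 0 := by
  simp [modeA2, freqSum]

end Terms

/-! ### Expansion of the series -/

lemma FirstOrder.const_mul {K : ℝ} {U : P2 d → ℂ} {A : P2 d → E d → Fin d → ℂ}
    (h : FirstOrder K U A) (c : ℂ) :
    FirstOrder (‖c‖ * K) (fun m => c * U m) (fun m x i => c * A m x i) := by
  simpa using h.comp_clm (ContinuousLinearMap.mul ℝ ℂ c)

lemma SecondOrder.const_mul {K : ℝ} {A : P2 d → E d → Fin d → ℂ}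
    {A1 : P2 d → E d → Matrix (Fin d) (Fin d) ℂ}
    {A2 : P2 d → E d → E d → Matrix (Fin d) (Fin d) ℂ} (h : SecondOrder K A A1 A2) (c : ℂ) :
    SecondOrder (‖c‖ * K) (fun m x i => c * A m x i)
      (fun m x => Matrix.of fun i j => c * A1 m x i j)
      (fun m x y => Matrix.of fun i j => c * A2 m x y i j) := by
  have := h.comp_clm (ContinuousLinearMap.mul ℝ ℂ c)
  rwa [ContinuousLinearMap.opNorm_mul_apply] at this

lemma SecondOrder.lap_const_mul {K : ℝ} {A : P2 d → E d → Fin d → ℂ}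
    {A1 : P2 d → E d → Matrix (Fin d) (Fin d) ℂ}
    {A2 : P2 d → E d → E d → Matrix (Fin d) (Fin d) ℂ} (h : SecondOrder K A A1 A2) (c : ℂ)
    (ε : ℝ) (m : P2 d) :
    lap ε (fun m x => Matrix.of fun i j => c * A1 m x i j)
      (fun m x y => Matrix.of fun i j => c * A2 m x y i j) m = c * lap ε A1 A2 m :=
  h.lap_comp_clm (ContinuousLinearMap.mul ℝ ℂ c) ε m

/-- Absolutely convergent series are integrals for the counting measure, so the results on integrals
of expansions also serve for the sum over degrees. -/
lemma integral_count_eq_tsum {f : ℕ → ℂ} (hf : Summable f) :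
    ∫ n, f n ∂Measure.count = ∑' n, f n := by
  rw [integral_countable (integrable_count_iff.2 hf.norm)]
  simp

section Series

variable {C δ : ℝ} {a : (k : ℕ) → (Fin k → E d) → ℂ}

/-- The terms of the series for `∇²_w U₀`, including the vanishing one. -/
def modeA2Term (a : (k : ℕ) → (Fin k → E d) → ℂ) (n : ℕ) (m : P2 d) (x y : E d) :
    Matrix (Fin d) (Fin d) ℂ :=
  Matrix.of fun i j => ∫ ξ, coef a n ξ * modeA2 ξ m x y i j

lemma modeK1_nonneg {k : ℕ} (ξ : Fin k → E d) : 0 ≤ modeK1 ξ := by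
  have := freqSize_nonneg ξ
  unfold modeK1; positivity

lemma modeK2_nonneg {k : ℕ} (ξ : Fin k → E d) : 0 ≤ modeK2 ξ := by
  have := freqSize_nonneg ξ
  unfold modeK2; positivity

/-- The size of the first order expansion of a term. -/
def termK1 (a : (k : ℕ) → (Fin k → E d) → ℂ) (n : ℕ) : ℝ := ∫ ξ, ‖coef a n ξ‖ * modeK1 ξ

/-- The size of the second order expansion of a term. -/
def termK2 (a : (k : ℕ) → (Fin k → E d) → ℂ) (n : ℕ) : ℝ := ∫ ξ, ‖coef a n ξ‖ * modeK2 ξ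

namespace CoefMoments

lemma integrable_termK1 (h : CoefMoments C δ a) (hδ : 0 < δ) :
    Integrable (termK1 a) Measure.count := by
  refine integrable_count_iff.2 (Summable.norm (Summable.of_nonneg_of_le (fun n => ?_)
    (fun n => (h.moment_modeK1 n).integral_le) (summable_one_div_rpow hδ _)))
  exact integral_nonneg fun ξ => mul_nonneg (norm_nonneg _) (modeK1_nonneg ξ)

lemma integrable_termK2 (h : CoefMoments C δ a) (h' : ThirdMomentBound C δ a) (hδ : 0 < δ) :
    Integrable (termK2 a) Measure.count := by
  refine integrable_count_iff.2 (Summable.norm (Summable.of_nonneg_of_le (fun n => ?_)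
    (fun n => (h.moment_modeK2 h' n).integral_le) (summable_one_div_rpow hδ _)))
  exact integral_nonneg fun ξ => mul_nonneg (norm_nonneg _) (modeK2_nonneg ξ)

lemma stronglyMeasurable_coef_mul (h : CoefMoments C δ a) (n : ℕ) {X : Type*}
    [MeasurableSpace X] {f : (Fin (n + 1) → E d) × X → ℂ} (hf : Measurable f) :
    StronglyMeasurable fun q : (Fin (n + 1) → E d) × X => coef a n q.1 * f q :=
  (((measurable_coef h.measurable n).comp measurable_fst).mul hf).stronglyMeasurable

lemma aestronglyMeasurable_coef_mul (h : CoefMoments C δ a) (n : ℕ)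
    {f : (Fin (n + 1) → E d) → ℂ} (hf : Measurable f) :
    AEStronglyMeasurable (fun ξ => coef a n ξ * f ξ) volume :=
  ((measurable_coef h.measurable n).mul hf).aestronglyMeasurable

/-- Integration over the frequencies in a fixed degree, with the weight `‖coef a n ξ‖ * modeK1 ξ`.
-/
lemma firstOrder_term (h : CoefMoments C δ a) (n : ℕ) :
    FirstOrder (termK1 a n) (U0Term a n) (gradTerm a n) := by
  have := FirstOrder.integral (μ := volume) (h.moment_modeK1 n).integrable
    (fun ξ => (firstOrder_mode ξ).const_mul (coef a n ξ))
    (fun m => h.aestronglyMeasurable_coef_mul n (continuous_modeU m).measurable)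
    (fun m i => h.stronglyMeasurable_coef_mul n (continuous_modeA m i).measurable)
  simp only [← U0Term_eq, ← h.gradTerm_eq] at this
  exact this

lemma secondOrder_term (h : CoefMoments C δ a) (h' : ThirdMomentBound C δ a) (n : ℕ) :
    SecondOrder (termK2 a n) (gradTerm a n) (fun m x => Matrix.of (jacTerm a n m x))
      (modeA2Term a n) := by
  have := SecondOrder.integral (μ := volume) (h.moment_modeK1 n).integrable
    (fun ξ => ((firstOrder_mode ξ).const_mul (coef a n ξ)).grad_bound)
    (h.moment_modeK2 h' n).integrable
    (fun ξ => (secondOrder_mode ξ).const_mul (coef a n ξ))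
    (fun m x i => h.aestronglyMeasurable_coef_mul n
      ((continuous_modeA m i).comp (.prodMk_left x)).measurable)
    (fun m x i j => h.aestronglyMeasurable_coef_mul n
      ((continuous_modeA1 m i j).comp (.prodMk_left x)).measurable)
    (fun m i j => h.stronglyMeasurable_coef_mul n (continuous_modeA2 m i j).measurable)
  simp only [← h.gradTerm_eq, ← h.jacTerm_eq, Matrix.of_apply] at this
  exact this

lemma integrable_and_lap_term (h : CoefMoments C δ a) (h' : ThirdMomentBound C δ a) (n : ℕ)
    (ε : ℝ) (m : P2 d) :
    Integrable (fun ξ : Fin (n + 1) → E d => coef a n ξ * lap ε (modeA1 ξ) (modeA2 ξ) m) ∧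
    lap ε (fun m x => Matrix.of (jacTerm a n m x)) (modeA2Term a n) m =
      ∫ ξ, coef a n ξ * lap ε (modeA1 ξ) (modeA2 ξ) m := by
  have := integrable_lap_and_lap_integral (μ := volume) (h.moment_modeK2 h' n).integrable
    (fun ξ => (secondOrder_mode ξ).const_mul (coef a n ξ))
    (fun m i j => h.stronglyMeasurable_coef_mul n (continuous_modeA1 m i j).measurable)
    (fun m i j => h.stronglyMeasurable_coef_mul n (continuous_modeA2 m i j).measurable) ε m
  simp only [← h.jacTerm_eq, Matrix.of_apply, (secondOrder_mode _).lap_const_mul] at this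
  exact this

lemma summable_of_norm_le {f : ℕ → ℂ} {k : ℕ → ℝ} (hk : Integrable k Measure.count)
    (hf : ∀ n, ‖f n‖ ≤ k n) : Summable f :=
  (integrable_count_iff.1 hk).of_norm_bounded fun n => (hf n).trans (le_abs_self _)

lemma summable_U0Term (h : CoefMoments C δ a) (hδ : 0 < δ) (m : P2 d) :
    Summable fun n => U0Term a n m :=
  summable_of_norm_le (h.integrable_termK1 hδ) fun n => (h.firstOrder_term n).bound m

lemma summable_gradTerm (h : CoefMoments C δ a) (hδ : 0 < δ) (m : P2 d) (x : E d) (i : Fin d) :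
    Summable fun n => gradTerm a n m x i :=
  summable_of_norm_le (h.integrable_termK1 hδ) fun n => (h.firstOrder_term n).grad_bound m x i

lemma summable_jacTerm (h : CoefMoments C δ a) (h' : ThirdMomentBound C δ a) (hδ : 0 < δ)
    (m : P2 d) (x : E d) (i j : Fin d) : Summable fun n => jacTerm a n m x i j :=
  summable_of_norm_le (h.integrable_termK2 h' hδ) fun n =>
    (h.secondOrder_term h' n).bound₁ m x i j

lemma summable_modeA2Term (h : CoefMoments C δ a) (h' : ThirdMomentBound C δ a) (hδ : 0 < δ)
    (m : P2 d) (x y : E d) (i j : Fin d) : Summable fun n => modeA2Term a n m x y i j :=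
  summable_of_norm_le (h.integrable_termK2 h' hδ) fun n =>
    (h.secondOrder_term h' n).bound₂ m x y i j

lemma modeA2Term_succ (h : CoefMoments C δ a) (n : ℕ) (m : P2 d) (x y : E d) (i j : Fin d) :
    modeA2Term a (n + 1) m x y i j = hessTerm a n m x y i j :=
  (h.hessTerm_eq n m x y i j).symm

lemma summable_hessTerm (h : CoefMoments C δ a) (h' : ThirdMomentBound C δ a) (hδ : 0 < δ)
    (m : P2 d) (x y : E d) (i j : Fin d) : Summable fun n => hessTerm a n m x y i j := by
  simpa only [h.modeA2Term_succ] using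
    (summable_nat_add_iff 1).2 (h.summable_modeA2Term h' hδ m x y i j)

lemma tsum_modeA2Term (h : CoefMoments C δ a) (h' : ThirdMomentBound C δ a) (hδ : 0 < δ)
    (m : P2 d) (x y : E d) (i j : Fin d) :
    ∑' n, modeA2Term a n m x y i j = hessSeries a m x y i j := by
  -- The vanishing term of degree 1 is split off and the index moves by one.
  rw [(h.summable_modeA2Term h' hδ m x y i j).tsum_eq_zero_add]
  have : modeA2Term a 0 m x y i j = 0 := by
    simp [modeA2Term, modeA2_one]
  simp only [this, zero_add, h.modeA2Term_succ, hessSeries, Matrix.of_apply]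

lemma stronglyMeasurable_nat_prod {X : Type*} [TopologicalSpace X] [MeasurableSpace X]
    [OpensMeasurableSpace X] {f : ℕ × X → ℂ} (hf : ∀ n, Continuous fun x => f (n, x)) :
    StronglyMeasurable f :=
  (measurable_from_prod_countable_right fun n => (hf n).measurable).stronglyMeasurable

/-- Integration over the degrees, for the counting measure; the constants `termK1` are summable. -/
lemma firstOrder_U0 (h : CoefMoments C δ a) (hδ : 0 < δ) :
    FirstOrder (∫ n, termK1 a n ∂Measure.count) (U0 a) (gradSeries a) := by
  have := FirstOrder.integral (h.integrable_termK1 hδ) h.firstOrder_term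
    (fun m => (measurable_of_countable _).aestronglyMeasurable)
    (fun m i => stronglyMeasurable_nat_prod fun n => (h.firstOrder_term n).continuous m i)
  simp only [integral_count_eq_tsum (h.summable_U0Term hδ _),
    integral_count_eq_tsum (h.summable_gradTerm hδ _ _ _)] at this
  exact this

lemma secondOrder_U0 (h : CoefMoments C δ a) (h' : ThirdMomentBound C δ a) (hδ : 0 < δ) :
    SecondOrder (∫ n, termK2 a n ∂Measure.count) (gradSeries a) (jacSeries a)
      (hessSeries a) := by
  have := SecondOrder.integral (h.integrable_termK1 hδ)
    (fun n => (h.firstOrder_term n).grad_bound) (h.integrable_termK2 h' hδ)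
    (h.secondOrder_term h') (fun m x i => (measurable_of_countable _).aestronglyMeasurable)
    (fun m x i j => (measurable_of_countable _).aestronglyMeasurable)
    (fun m i j => stronglyMeasurable_nat_prod fun n => (h.secondOrder_term h' n).continuous₂ m i j)
  simp only [Matrix.of_apply, integral_count_eq_tsum (h.summable_gradTerm hδ _ _ _),
    integral_count_eq_tsum (h.summable_jacTerm h' hδ _ _ _ _),
    integral_count_eq_tsum (h.summable_modeA2Term h' hδ _ _ _ _ _),
    h.tsum_modeA2Term h' hδ] at this
  exact this

/-- `lap` is linear in the two derivatives, so it commutes with the sum over degrees and, within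
each degree, with the integral over frequencies. -/
lemma hasSum_lap (h : CoefMoments C δ a) (h' : ThirdMomentBound C δ a) (hδ : 0 < δ) (ε : ℝ)
    (m : P2 d) : HasSum (fun n => ∫ ξ : Fin (n + 1) → E d,
      coef a n ξ * lap ε (modeA1 ξ) (modeA2 ξ) m) (lap ε (jacSeries a) (hessSeries a) m) := by
  have := integrable_lap_and_lap_integral (h.integrable_termK2 h' hδ) (h.secondOrder_term h')
    (fun m i j => stronglyMeasurable_nat_prod fun n => (h.secondOrder_term h' n).continuous₁ m i j)
    (fun m i j => stronglyMeasurable_nat_prod fun n => (h.secondOrder_term h' n).continuous₂ m i j)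
    ε m
  have hs := (integrable_count_iff.1 this.1).of_norm
  have e := this.2.trans (integral_count_eq_tsum hs)
  simp only [Matrix.of_apply, integral_count_eq_tsum (h.summable_jacTerm h' hδ _ _ _ _),
    integral_count_eq_tsum (h.summable_modeA2Term h' hδ _ _ _ _ _),
    h.tsum_modeA2Term h' hδ] at e
  simp only [← (h.integrable_and_lap_term h' _ ε m).2]
  exact e ▸ hs.hasSum

end CoefMoments

end Series

/-! ### Real and imaginary parts -/

section Complex

variable {K K' : ℝ} {U : P2 d → ℂ} {A : P2 d → E d → Fin d → ℂ}
  {A1 : P2 d → E d → Matrix (Fin d) (Fin d) ℂ}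
  {A2 : P2 d → E d → E d → Matrix (Fin d) (Fin d) ℂ}

theorem FirstOrder.hasContinuousGradientC (h : FirstOrder K U A) : HasContinuousGradientC U A :=
  ⟨(h.comp_clm Complex.reCLM).hasContinuousGradient,
    (h.comp_clm Complex.imCLM).hasContinuousGradient⟩

theorem SecondOrder.hasContinuousHessianC (h : FirstOrder K U A) (h' : SecondOrder K' A A1 A2) :
    HasContinuousHessianC U A A1 A2 :=
  ⟨SecondOrder.hasContinuousHessian (h.comp_clm Complex.reCLM) (h'.comp_clm Complex.reCLM),
    SecondOrder.hasContinuousHessian (h.comp_clm Complex.imCLM) (h'.comp_clm Complex.imCLM)⟩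

theorem FirstOrder.isWLaplacianAtC (h : FirstOrder K U A) (h' : SecondOrder K' A A1 A2) (ε : ℝ)
    (m : P2 d) : IsWLaplacianAtC ε U m (lap ε A1 A2 m) := by
  have h1 := (h.comp_clm Complex.reCLM).isWLaplacianAt (h'.comp_clm Complex.reCLM) ε m
  have h2 := (h.comp_clm Complex.imCLM).isWLaplacianAt (h'.comp_clm Complex.imCLM) ε m
  rw [h'.lap_comp_clm] at h1 h2
  exact ⟨h1, h2⟩

end Complex

end Wass

end

/-! ### The main theorem -/

theorem mainTheorem11 (d : ℕ) (s δ C : ℝ) (hs : 0 < s) (hδ : 0 < δ)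
    (a : (k : ℕ) → (Fin k → Wass.E d) → ℂ) (ha : MemAs s a)
    (h0 : ZerothMomentBound C δ a) (h1 : FirstMomentBound C δ a) (h2 : MixedMomentBound C δ a) :
    (∀ m, Summable fun n => U0Term a n m) ∧
    ((∀ m x i, Summable fun n => gradTerm a n m x i) ∧
      HasContinuousGradientC (U0 a) (gradSeries a)) ∧
    (ThirdMomentBound C δ a →
      ((∀ m x i j, Summable fun n => jacTerm a n m x i j) ∧
        (∀ m x y i j, Summable fun n => hessTerm a n m x y i j) ∧
        HasContinuousHessianC (U0 a) (gradSeries a) (jacSeries a) (hessSeries a)) ∧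
      ∀ ε : ℝ, 0 ≤ ε →
        ∃ (LU : P2 d → ℂ) (LF : (k : ℕ) → (Fin k → Wass.E d) → P2 d → ℂ),
          (∀ m, IsWLaplacianAtC ε (U0 a) m (LU m)) ∧
          (∀ n ξ m, IsWLaplacianAtC ε (F (n + 1) ξ) m (LF (n + 1) ξ m)) ∧
          ∀ m, (∀ n, MeasureTheory.Integrable fun ξ => a (n + 1) ξ * LF (n + 1) ξ m) ∧
            HasSum (fun n : ℕ => 1 / (Nat.factorial (n + 1) : ℂ) *
              ∫ ξ, a (n + 1) ξ * LF (n + 1) ξ m) (LU m)) := by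
  have h : CoefMoments C δ a := ⟨ha.measurable, ha.symmetric, h0, h1, h2⟩
  refine ⟨h.summable_U0Term hδ, ⟨h.summable_gradTerm hδ,
    (h.firstOrder_U0 hδ).hasContinuousGradientC⟩, fun h' => ⟨⟨h.summable_jacTerm h' hδ,
    h.summable_hessTerm h' hδ, SecondOrder.hasContinuousHessianC (h.firstOrder_U0 hδ)
    (h.secondOrder_U0 h' hδ)⟩, fun ε _ => ⟨fun m => lap ε (jacSeries a) (hessSeries a) m,
    fun _ ξ m => lap ε (modeA1 ξ) (modeA2 ξ) m, fun m =>
    (h.firstOrder_U0 hδ).isWLaplacianAtC (h.secondOrder_U0 h' hδ) ε m, fun n ξ m => ?_,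
    fun m => ⟨fun n => ?_, ?_⟩⟩⟩⟩
  · rw [show F (n + 1) ξ = modeU ξ from funext fun m => F_eq_modeU ξ m]
    exact (firstOrder_mode ξ).isWLaplacianAtC (secondOrder_mode ξ) ε m
  -- Integrability was shown for `coef`, which contains the factor `1/k!`; it is removed by a
  -- constant multiple.
  · simp only [eq_factorial_mul_coef (a := a) n, mul_assoc]
    exact (h.integrable_and_lap_term h' n ε m).1.const_mul _
  · have := h.hasSum_lap h' hδ ε m
    simp only [coef, mul_assoc, integral_const_mul] at this
    exact this
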